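/- Let $k$ be a commutative ring, $A$ a commutative $k$-algebra with an augmentation $\varepsilon\colon A\to k$, and $I=\ker\varepsilon$; regard $k$ as an $A$-module via $\varepsilon$. *Symmetric side.* Let $\Delta S$ be the category with objects $\underline n=\{1,\dots,n\}$, $n\ge 1$, whose morphisms $\underline n\to\underline m$ are maps together with a total order on each fibre (equivalently pairs $(\phi,g)$ with $\phi\colon\underline n\to\underline m$ order-preserving and $g\in\Sigma_n$), and let $\mathrm{Epi}\Delta S$ be its subcategory of epimorphisms. Let $B_I^{sym}\colon \mathrm{Epi}\Delta S\to k\text{-Mod}$, $\underline n\mapsto I^{\otimes n}$, be the functor which multiplies tensor factors over the fibres. Let $CS_\star(I)$ be the simplicial $k$-module $CS_n(I)=\bigoplus_{\underline{x}\to\cdots\to\underline{x_n}} I^{\otimes x}$ (sum over strings $(f_n,\dots,f_1)$ of $n$ composable morphisms of $\mathrm{Epi}\Delta S$), where $\partial_0$ deletes $f_1$ and applies $B_I^{sym}(f_1)$, $\partial_i$ for $0<i<n$ composes $f_{i+1}$ with $f_i$, $\partial_n$ deletes $f_n$, and degeneracies insert identities. The reduced symmetric homology of $A$ is $\widetilde{HS}_n(A)=H_n(CS_\star(I))$.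 *Gamma side.* Let $\Omega$ be the category of the sets $\underline n$, $n\ge1$, and surjections. For an $A$-module $M$ let $C\Gamma_\star(A,M)$ be the simplicial $k$-module $C\Gamma_n(A,M)=\bigoplus k\,[f_n|\cdots|f_1]\otimes A^{\otimes x}\otimes M$, summed over the strings $\underline x\xrightarrow{f_1}\cdots\xrightarrow{f_n}\underline 1$ in $\Omega$, where $\partial_0$ deletes $f_1$ and multiplies tensor factors along $f_1$, $\partial_i$ for $0<i<n$ composes $f_{i+1}$ with $f_i$, and $\partial_n$ is the sum over $i\in\underline{x_{n-1}}$ of the terms given by the string of preimages of $i$ (re-indexed in the order-preserving way), the tensor factors indexed by the preimage of $i$, and the product of the other factors acting on $M$. Let $C\Gamma_\star(I,M)\subseteq C\Gamma_\star(A,M)$ be the analogous simplicial module with $I^{\otimes x}$ in place of $A^{\otimes x}$, and $H\Gamma_n(I,k)=H_n(C\Gamma_\star(I,k))$. The $\Gamma$-homology of $A$ is $H\Gamma_n(A,k)=\mathrm{Tor}^\Gamma_n(t,\mathcal L(A,k))$, where $\Gamma$ is the category of the based sets $[n]=\{0,\dots,n\}$, $t=\mathrm{Hom}_{\mathbf{Set}_\star}(-,k)$,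 and $\mathcal L(A,k)$ is the Loday functor $[n]\mapsto A^{\otimes n}\otimes k$. *Comparison.* Let $NCS_\star(I)$ and $NC\Gamma_\star(I,k)$ be the normalized complexes (quotients by degenerate elements) of $CS_\star(I)$ and $C\Gamma_\star(I,k)$, let $q$ be the quotient map of $NCS_\star(I)$ by the subcomplex generated by the strings with last object $\underline{x_n}\ne\underline 1$, and let $\Phi$ be the map from this quotient to $NC\Gamma_\star(I,k)$ with $\Phi[(f_n,\dots,f_1),(y_1\otimes\cdots\otimes y_x)]=[\,[U(f_n)|\cdots|U(f_1)]\otimes(y_1\otimes\cdots\otimes y_x)\otimes 1_k]$, where $U\colon\mathrm{Epi}\Delta S\to\Omega$ forgets the orders. Then: 1. The sequence of chain complexes $$0\to\mathrm{Ker}(\Phi\circ q)\to NCS_\star(I)\xrightarrow{\Phi\circ q}NC\Gamma_\star(I,k)\to 0$$ is exact. 2. The projections $CS_\star(I)\to NCS_\star(I)$ and $C\Gamma_\star(I,k)\to NC\Gamma_\star(I,k)$ are quasi-isomorphisms, and under the induced identifications of homology the short exact sequence gives rise to a long exact sequence $$\cdots\to H_n(\mathrm{Ker}(\Phi\circ q))\to\widetilde{HS}_n(A)\to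 H\Gamma_n(I,k)\xrightarrow{\ \delta\ }H_{n-1}(\mathrm{Ker}(\Phi\circ q))\to\cdots\to H_0(\mathrm{Ker}(\Phi\circ q))\to\widetilde{HS}_0(A)\to H\Gamma_0(I,k)\to0,$$ whose maps are induced by the inclusion of the kernel and by $\Phi\circ q$, and where $\delta$ is the connecting homomorphism of the short exact sequence. 3. For every $n\ge0$ there is an isomorphism $H_n(C\Gamma_\star(A,k))\cong H\Gamma_n(A,k)$ whose composite with the map $H\Gamma_n(I,k)\to H_n(C\Gamma_\star(A,k))$ induced by the inclusion is a split monomorphism. So $H\Gamma_n(I,k)$ is a direct summand of the $\Gamma$-homology $H\Gamma_n(A,k)$ of $A$. -/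

import Mathlib

open CategoryTheory Limits
open scoped TensorProduct DirectSum

universe u

namespace GammaSym

/-! ### The categories `Γ`, `Ω`, `ΔS` and `EpiΔS` -/

/-- The category `Γ`: the object `⟨n⟩` is the based set `[n] = {0, 1, …, n}`, modelled as
`Fin (n + 1)` based at `0`. -/
structure GammaCat : Type where
  n : ℕ

/-- A basepoint-preserving map `[a] → [b]`. -/
@[ext] structure GammaCat.Hom (a b : GammaCat) : Type where
  toFun : Fin (a.n + 1) → Fin (b.n + 1)
  map_zero : toFun 0 = 0

instance : Category GammaCat where
  Hom a b := GammaCat.Hom a b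
  id a := ⟨id, rfl⟩
  comp f g := ⟨g.toFun ∘ f.toFun, by simp [f.map_zero, g.map_zero]⟩

@[simp] theorem GammaCat.id_toFun (a : GammaCat) : GammaCat.Hom.toFun (𝟙 a) = id := rfl

@[simp] theorem GammaCat.comp_toFun {a b c : GammaCat} (f : a ⟶ b) (g : b ⟶ c) :
    GammaCat.Hom.toFun (f ≫ g) = g.toFun ∘ f.toFun := rfl

/-- The class of surjective based maps. -/
def gammaSurj : MorphismProperty GammaCat := fun _ _ f => Function.Surjective f.toFun

instance : gammaSurj.IsMultiplicative where
  id_mem _ := Function.surjective_id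
  comp_mem _ _ hf hg := hg.comp hf

/-- The wide subcategory of `Γ` on the surjective based maps. -/
abbrev GammaSurj : Type := WideSubcategory gammaSurj

/-- The category `Ω`: objects are the sets `{1, …, n}` with `n ≥ 1`, modelled as `Fin n`. -/
@[ext] structure Omega : Type where
  card : ℕ
  pos : 0 < card

/-- A surjection of finite sets. -/
@[ext] structure Omega.Hom (a b : Omega) : Type where
  toFun : Fin a.card → Fin b.card
  surj : Function.Surjective toFun

instance : Category Omega where
  Hom a b := Omega.Hom a b
  id a := ⟨id, Function.surjective_id⟩
  comp f g := ⟨g.toFun ∘ f.toFun, g.surj.comp f.surj⟩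

@[simp] theorem Omega.id_toFun (a : Omega) : Omega.Hom.toFun (𝟙 a) = id := rfl

@[simp] theorem Omega.comp_toFun {a b c : Omega} (f : a ⟶ b) (g : b ⟶ c) :
    Omega.Hom.toFun (f ≫ g) = g.toFun ∘ f.toFun := rfl

@[ext] theorem Omega.hom_ext {a b : Omega} {f g : a ⟶ b} (h : f.toFun = g.toFun) : f = g :=
  Omega.Hom.ext h

@[ext] theorem GammaCat.hom_ext {a b : GammaCat} {f g : a ⟶ b} (h : f.toFun = g.toFun) : f = g :=
  GammaCat.Hom.ext h

/-- The category `ΔS`: objects are the sets `{1, …, n}` with `n ≥ 1`, modelled as `Fin n`. -/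
@[ext] structure DeltaS : Type where
  card : ℕ
  pos : 0 < card

/-- A morphism of `ΔS` is a pair `(φ, g)` of an order-preserving map and a permutation of the
source. -/
@[ext] structure DeltaS.Hom (a b : DeltaS) : Type where
  mono : Fin a.card →o Fin b.card
  perm : Equiv.Perm (Fin a.card)

/-- The underlying map of sets `φ ∘ g` of a morphism `(φ, g)` of `ΔS`. -/
def DeltaS.Hom.toFun {a b : DeltaS} (f : DeltaS.Hom a b) : Fin a.card → Fin b.card :=
  fun i => f.mono (f.perm i)

/-- The permutation `φ^*(h)`: it is increasing on each fibre of `φ`, and `h ∘ φ ∘ φ^*(h)⁻¹` is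
order-preserving.  (`Tuple.sort f` is the permutation `σ` such that `f ∘ σ` is monotone and `σ` is
increasing on each fibre of `f ∘ σ`.) -/
def DeltaS.pullPerm {a b : ℕ} (φ : Fin a →o Fin b) (h : Equiv.Perm (Fin b)) :
    Equiv.Perm (Fin a) :=
  (Tuple.sort (h ∘ φ))⁻¹

/-- The order-preserving map `h_*(φ)`, determined by `h ∘ φ = h_*(φ) ∘ φ^*(h)`. -/
def DeltaS.pushMono {a b : ℕ} (h : Equiv.Perm (Fin b)) (φ : Fin a →o Fin b) :
    Fin a →o Fin b :=
  ⟨(h ∘ φ) ∘ Tuple.sort (h ∘ φ), Tuple.monotone_sort _⟩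

theorem DeltaS.push_pull {a b : ℕ} (h : Equiv.Perm (Fin b)) (φ : Fin a →o Fin b) (i : Fin a) :
    pushMono h φ (pullPerm φ h i) = h (φ i) := by
  simp [pushMono, pullPerm]

theorem DeltaS.sort_assoc {a b c : ℕ} (u : Fin a → Fin b) (v : Fin b → Fin c) :
    Tuple.sort ((Tuple.sort v).symm ∘ u)
      = (Tuple.sort (v ∘ u ∘ Tuple.sort u)).trans (Tuple.sort u) := by
  set S := Tuple.sort v with hS
  set T := Tuple.sort u with hT
  set R := Tuple.sort (v ∘ u ∘ T) with hR
  have hSm : Monotone (v ∘ S) := Tuple.monotone_sort v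
  have hSs := (Tuple.eq_sort_iff.1 hS).2
  have hTm : Monotone (u ∘ T) := Tuple.monotone_sort u
  have hTs := (Tuple.eq_sort_iff.1 hT).2
  have hRm : Monotone ((v ∘ u ∘ T) ∘ R) := Tuple.monotone_sort _
  have hRs := (Tuple.eq_sort_iff.1 hR).2
  symm
  rw [Tuple.eq_sort_iff]
  have key : ∀ i j, i < j → S.symm (u (T (R i))) ≤ S.symm (u (T (R j))) := by
    intro i j hij
    by_contra hlt
    rw [not_le] at hlt
    have h1 : v (u (T (R j))) ≤ v (u (T (R i))) := by
      have := hSm hlt.le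
      simpa using this
    have h2 : v (u (T (R i))) ≤ v (u (T (R j))) := hRm hij.le
    have h3 := le_antisymm h2 h1
    have h4 : R i < R j := hRs i j hij h3
    have h5 : u (T (R i)) ≤ u (T (R j)) := hTm h4.le
    have h6 := hSs _ _ hlt (by simpa using h3.symm)
    simp only [Equiv.apply_symm_apply] at h6
    exact absurd h5 (not_le.2 h6)
  refine ⟨?_, ?_⟩
  · intro i j hij
    rcases hij.eq_or_lt with rfl | h
    · exact le_rfl
    · exact key i j h
  · intro i j hij h
    have h' : u (T (R i)) = u (T (R j)) := S.symm.injective h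
    have h4 : R i < R j := hRs i j hij (congrArg v h')
    exact hTs _ _ h4 h'

theorem DeltaS.sort_of_monotone {a b : ℕ} {u : Fin a → Fin b} (h : Monotone u) :
    Tuple.sort u = 1 :=
  Tuple.sort_eq_refl_iff_monotone.2 h

/-- The composition of `ΔS`: `(ψ, h) ∘ (φ, g) = (ψ ∘ h_*(φ), φ^*(h) ∘ g)`. -/
def DeltaS.Hom.comp {a b c : DeltaS} (f : DeltaS.Hom a b) (f' : DeltaS.Hom b c) :
    DeltaS.Hom a c :=
  ⟨f'.mono.comp (DeltaS.pushMono f'.perm f.mono), DeltaS.pullPerm f.mono f'.perm * f.perm⟩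

theorem DeltaS.Hom.comp_toFun' {a b c : DeltaS} (f : DeltaS.Hom a b) (f' : DeltaS.Hom b c) :
    (f.comp f').toFun = f'.toFun ∘ f.toFun := by
  funext i
  exact congrArg f'.mono (DeltaS.push_pull f'.perm f.mono (f.perm i))

theorem DeltaS.Hom.ext_toFun {a b : DeltaS} {f f' : DeltaS.Hom a b}
    (h : f.toFun = f'.toFun) (h' : f.perm = f'.perm) : f = f' := by
  refine DeltaS.Hom.ext ?_ h'
  ext i : 2
  have := congrFun h (f.perm.symm i)
  simpa [DeltaS.Hom.toFun, ← h'] using this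

theorem DeltaS.Hom.comp_assoc {a b c d : DeltaS} (f : DeltaS.Hom a b) (f' : DeltaS.Hom b c)
    (f'' : DeltaS.Hom c d) : (f.comp f').comp f'' = f.comp (f'.comp f'') := by
  apply DeltaS.Hom.ext_toFun
  · simp only [DeltaS.Hom.comp_toFun', Function.comp_assoc]
  · have key := DeltaS.sort_assoc (f'.perm ∘ f.mono) (f''.perm ∘ f'.mono)
    change (Tuple.sort ((f''.perm ∘ f'.mono) ∘ (f'.perm ∘ f.mono) ∘
        Tuple.sort (f'.perm ∘ f.mono)))⁻¹ * ((Tuple.sort (f'.perm ∘ f.mono))⁻¹ * f.perm)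
      = (Tuple.sort ((Tuple.sort (f''.perm ∘ f'.mono)).symm ∘ f'.perm ∘ f.mono))⁻¹ * f.perm
    rw [key, ← mul_assoc, ← mul_inv_rev]
    rfl

instance : Category DeltaS where
  Hom a b := DeltaS.Hom a b
  id a := ⟨OrderHom.id, 1⟩
  comp f g := DeltaS.Hom.comp f g
  id_comp f := by
    apply DeltaS.Hom.ext_toFun
    · rw [DeltaS.Hom.comp_toFun']; rfl
    · change DeltaS.pullPerm OrderHom.id f.perm * 1 = f.perm
      have : f.perm.symm = Tuple.sort (f.perm ∘ (OrderHom.id : Fin _ →o Fin _)) := by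
        rw [Tuple.eq_sort_iff]
        refine ⟨fun i j h => by simpa using h, fun i j hij h => ?_⟩
        simp at h
        exact absurd h hij.ne
      rw [DeltaS.pullPerm, ← this, mul_one]
      rfl
  comp_id f := by
    apply DeltaS.Hom.ext_toFun
    · rw [DeltaS.Hom.comp_toFun']; rfl
    · change (Tuple.sort (⇑(1 : Equiv.Perm (Fin _)) ∘ f.mono))⁻¹ * f.perm = f.perm
      rw [DeltaS.sort_of_monotone (by simpa using f.mono.monotone)]
      simp
  assoc f g h := DeltaS.Hom.comp_assoc f g h

@[simp] theorem DeltaS.id_toFun (a : DeltaS) : DeltaS.Hom.toFun (𝟙 a) = id := rfl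

@[simp] theorem DeltaS.comp_toFun {a b c : DeltaS} (f : a ⟶ b) (g : b ⟶ c) :
    DeltaS.Hom.toFun (f ≫ g) = DeltaS.Hom.toFun g ∘ DeltaS.Hom.toFun f :=
  DeltaS.Hom.comp_toFun' f g

/-- An epimorphism of `ΔS` is surjective. -/
theorem DeltaS.surjective_of_epi {a b : DeltaS} (f : a ⟶ b) [Epi f] :
    Function.Surjective (DeltaS.Hom.toFun f) := by
  intro j
  by_contra hj
  push Not at hj
  let c : DeltaS := ⟨b.card + 1, Nat.succ_pos _⟩
  let u : b ⟶ c := (⟨j.castSucc.succAboveOrderEmb.toOrderHom, 1⟩ : DeltaS.Hom b c)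
  let v : b ⟶ c := (⟨j.succ.succAboveOrderEmb.toOrderHom, 1⟩ : DeltaS.Hom b c)
  have huv : f ≫ u = f ≫ v := by
    apply DeltaS.Hom.ext_toFun
    · rw [DeltaS.comp_toFun, DeltaS.comp_toFun]
      funext i
      change j.castSucc.succAbove (DeltaS.Hom.toFun f i) = j.succ.succAbove (DeltaS.Hom.toFun f i)
      rcases lt_or_gt_of_ne (hj i) with h | h
      · rw [Fin.succAbove_of_castSucc_lt _ _ (by simpa using h),
          Fin.succAbove_of_castSucc_lt _ _ (by
            rw [Fin.lt_def] at h ⊢; simp; omega)]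
      · rw [Fin.succAbove_of_le_castSucc _ _ (by simpa using h.le),
          Fin.succAbove_of_le_castSucc _ _ (by
            rw [Fin.le_def]; rw [Fin.lt_def] at h; simp; omega)]
    · rfl
  have h := congrArg (fun w : b ⟶ c => DeltaS.Hom.toFun w j) ((cancel_epi f).1 huv)
  change j.castSucc.succAbove j = j.succ.succAbove j at h
  exact absurd (by simpa using h) (Fin.castSucc_lt_succ (i := j)).ne'

/-- The class of epimorphisms of `ΔS`. -/
abbrev deltaSEpi : MorphismProperty DeltaS := MorphismProperty.epimorphisms DeltaS

/-- The category `EpiΔS`: all objects of `ΔS`, with the epimorphisms of `ΔS` as morphisms. -/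
abbrev EpiDeltaS : Type := WideSubcategory deltaSEpi

theorem EpiDeltaS.surjective {a b : EpiDeltaS} (f : a ⟶ b) :
    Function.Surjective (DeltaS.Hom.toFun f.hom) :=
  haveI : Epi f.hom := f.property
  DeltaS.surjective_of_epi f.hom

/-- The forgetful functor `U : EpiΔS → Ω`. -/
def forgetU : EpiDeltaS ⥤ Omega where
  obj a := ⟨a.obj.card, a.obj.pos⟩
  map f := ⟨DeltaS.Hom.toFun f.hom, EpiDeltaS.surjective f⟩
  map_comp f g := by
    ext1
    exact DeltaS.comp_toFun f.hom g.hom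

/-! ### The Gabriel-Zisman complex -/

section Simplicial

variable {k : Type u} [CommRing k]

/-- The composite of a string `C₀ → ⋯ → Cₙ` of composable morphisms with a simplicial operator. -/
abbrev pull {C : Type} [Category.{0} C] {m n : SimplexCategory} (θ : m ⟶ n)
    (s : Fin (n.len + 1) ⥤ C) : Fin (m.len + 1) ⥤ C :=
  { obj := fun j => s.obj (θ.toOrderHom j)
    map := fun f => s.map (homOfLE (θ.toOrderHom.monotone (leOfHom f)))
    map_id := fun _ => s.map_id _
    map_comp := fun _ _ => s.map_comp _ _ }

/-- The morphism `C₀ → C_{θ(0)}` of a string. -/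
abbrev toStart {C : Type} [Category.{0} C] {m n : SimplexCategory} (θ : m ⟶ n)
    (s : Fin (n.len + 1) ⥤ C) : s.obj 0 ⟶ s.obj (θ.toOrderHom 0) :=
  s.map (homOfLE (Fin.zero_le _))

noncomputable instance {C : Type} [Category.{0} C] (n : ℕ) : DecidableEq (Fin (n + 1) ⥤ C) :=
  Classical.decEq _

/-- The operator `θ^*` of the Gabriel-Zisman simplicial module: the generator
`(fₙ, …, f₁, x)`, i.e. a string `s` with `x ∈ F(s₀)`, is sent to the string `s ∘ θ` with the image
of `x` in `F(s_{θ(0)})`. -/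
noncomputable def gzOp {C : Type} [Category.{0} C] (F : C ⥤ ModuleCat.{u} k)
    {m n : SimplexCategory} (θ : m ⟶ n) :
    (⨁ s : Fin (n.len + 1) ⥤ C, F.obj (s.obj 0)) →ₗ[k]
      (⨁ s : Fin (m.len + 1) ⥤ C, F.obj (s.obj 0)) :=
  DirectSum.toModule k _ _ fun s =>
    DirectSum.lof k (Fin (m.len + 1) ⥤ C) (fun s => F.obj (s.obj 0)) (pull θ s) ∘ₗ
      (F.map (toStart θ s)).hom

theorem gzOp_lof {C : Type} [Category.{0} C] (F : C ⥤ ModuleCat.{u} k)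
    {m n : SimplexCategory} (θ : m ⟶ n) (s : Fin (n.len + 1) ⥤ C) (x : F.obj (s.obj 0)) :
    gzOp F θ (DirectSum.lof k _ _ s x) =
      DirectSum.lof k (Fin (m.len + 1) ⥤ C) (fun s => F.obj (s.obj 0)) (pull θ s)
        ((F.map (toStart θ s)).hom x) := by
  rw [gzOp, DirectSum.toModule_lof]; rfl

/-- The Gabriel-Zisman simplicial `k`-module `C_*(C, F)`:
`Cₙ(C, F) = ⨁_{C₀ → ⋯ → Cₙ} F(C₀)`. -/
noncomputable def gzComplex {C : Type} [Category.{0} C] (F : C ⥤ ModuleCat.{u} k) :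
    SimplicialObject (ModuleCat.{u} k) where
  obj Δ := ModuleCat.of k (⨁ s : Fin (Δ.unop.len + 1) ⥤ C, F.obj (s.obj 0))
  map θ := ModuleCat.ofHom (gzOp F θ.unop)
  map_id Δ := by
    ext1
    refine DirectSum.linearMap_ext k fun s => LinearMap.ext fun x => ?_
    simp only [ModuleCat.hom_ofHom, LinearMap.comp_apply, gzOp_lof]
    have h : F.map (toStart (𝟙 Δ).unop s) = 𝟙 _ := by
      rw [← F.map_id]
      exact congrArg F.map (s.map_id _)
    rw [h]; rfl
  map_comp {Δ Δ' Δ''} θ η := by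
    ext1
    refine DirectSum.linearMap_ext k fun s => LinearMap.ext fun x => ?_
    simp only [ModuleCat.hom_ofHom, ModuleCat.hom_comp, LinearMap.comp_apply, gzOp_lof]
    have h : F.map (toStart (θ ≫ η).unop s) =
        F.map (toStart θ.unop s) ≫ F.map (toStart η.unop (pull θ.unop s)) := by
      rw [← F.map_comp]
      exact congrArg F.map (s.map_comp _ _)
    rw [h]
    exact (gzOp_lof F η.unop (pull θ.unop s) ((F.map (toStart θ.unop s)).hom x)).symm

/-! ### Components of a string in `Ω` and the Robinson-Whitehouse complex -/

/-- `NΩₙ(-, 1)`: strings of `n` composable morphisms in `Ω` ending in the one-element set. -/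
abbrev Str (n : ℕ) : Type := {s : Fin (n + 1) ⥤ Omega // (s.obj (Fin.last n)).card = 1}

noncomputable instance (n : ℕ) : DecidableEq (Str n) := Classical.decEq _

/-- The composite of a string to its last object. -/
abbrev toLast {n : ℕ} (s : Fin (n + 1) ⥤ Omega) (j : Fin (n + 1)) :
    s.obj j ⟶ s.obj (Fin.last n) :=
  s.map (homOfLE (Fin.le_last j))

theorem toLast_map {n : ℕ} (s : Fin (n + 1) ⥤ Omega) {j j' : Fin (n + 1)} (f : j ⟶ j')
    (p : Fin (s.obj j).card) :
    (toLast s j').toFun ((s.map f).toFun p) = (toLast s j).toFun p := by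
  have h : s.map f ≫ toLast s j' = toLast s j := by
    rw [← s.map_comp]; rfl
  rw [← h]; rfl

/-- The preimage of the element `i` of the last set of the string in the `j`-th set. -/
def fib {n : ℕ} (s : Fin (n + 1) ⥤ Omega) (i : Fin (s.obj (Fin.last n)).card)
    (j : Fin (n + 1)) : Finset (Fin (s.obj j).card) :=
  Finset.univ.filter fun p => (toLast s j).toFun p = i

theorem mem_fib {n : ℕ} {s : Fin (n + 1) ⥤ Omega} {i : Fin (s.obj (Fin.last n)).card}
    {j : Fin (n + 1)} {p : Fin (s.obj j).card} :
    p ∈ fib s i j ↔ (toLast s j).toFun p = i := by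
  simp [fib]

theorem fib_card_pos {n : ℕ} (s : Fin (n + 1) ⥤ Omega) (i : Fin (s.obj (Fin.last n)).card)
    (j : Fin (n + 1)) : 0 < (fib s i j).card := by
  obtain ⟨p, hp⟩ := (toLast s j).surj i
  exact Finset.card_pos.2 ⟨p, mem_fib.2 hp⟩

/-- The canonical (order-preserving) indexing of the preimage of `i` by `{1, …, c}`. -/
def fibIso {n : ℕ} (s : Fin (n + 1) ⥤ Omega) (i : Fin (s.obj (Fin.last n)).card)
    (j : Fin (n + 1)) : Fin (fib s i j).card ≃o fib s i j :=
  (fib s i j).orderIsoOfFin rfl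

/-- The canonical indexing of the preimage of `i`, as an embedding. -/
def fibEmb {n : ℕ} (s : Fin (n + 1) ⥤ Omega) (i : Fin (s.obj (Fin.last n)).card)
    (j : Fin (n + 1)) : Fin (fib s i j).card ↪o Fin (s.obj j).card :=
  (fibIso s i j).toOrderEmbedding.trans (OrderEmbedding.subtype _)

theorem fibEmb_symm {n : ℕ} (s : Fin (n + 1) ⥤ Omega) (i : Fin (s.obj (Fin.last n)).card)
    (j : Fin (n + 1)) (p : fib s i j) : fibEmb s i j ((fibIso s i j).symm p) = p := by
  simp [fibEmb]

theorem fibEmb_mem {n : ℕ} (s : Fin (n + 1) ⥤ Omega) (i : Fin (s.obj (Fin.last n)).card)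
    (j : Fin (n + 1)) (p : Fin (fib s i j).card) :
    (toLast s j).toFun (fibEmb s i j p) = i :=
  mem_fib.1 (fibIso s i j p).2

theorem range_fibEmb {n : ℕ} (s : Fin (n + 1) ⥤ Omega) (i : Fin (s.obj (Fin.last n)).card)
    (j : Fin (n + 1)) : Set.range (fibEmb s i j) = {p | (toLast s j).toFun p = i} := by
  ext p
  constructor
  · rintro ⟨q, rfl⟩
    exact fibEmb_mem s i j q
  · intro hp
    exact ⟨_, fibEmb_symm s i j ⟨p, mem_fib.2 hp⟩⟩

/-- The map of the `i`-th component of a string. -/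
def compMap {n : ℕ} (s : Fin (n + 1) ⥤ Omega) (i : Fin (s.obj (Fin.last n)).card)
    {j j' : Fin (n + 1)} (f : j ⟶ j') (p : Fin (fib s i j).card) : Fin (fib s i j').card :=
  (fibIso s i j').symm ⟨(s.map f).toFun (fibEmb s i j p), by
    rw [mem_fib, toLast_map]; exact fibEmb_mem s i j p⟩

theorem fibEmb_compMap {n : ℕ} (s : Fin (n + 1) ⥤ Omega) (i : Fin (s.obj (Fin.last n)).card)
    {j j' : Fin (n + 1)} (f : j ⟶ j') (p : Fin (fib s i j).card) :
    fibEmb s i j' (compMap s i f p) = (s.map f).toFun (fibEmb s i j p) := by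
  rw [compMap, fibEmb_symm]

/-- The `i`-th component of a string: the string of the preimages of the element `i` of the last
set, re-indexed in the order-preserving way. -/
abbrev component {n : ℕ} (s : Fin (n + 1) ⥤ Omega) (i : Fin (s.obj (Fin.last n)).card) :
    Fin (n + 1) ⥤ Omega where
  obj j := ⟨(fib s i j).card, fib_card_pos s i j⟩
  map {j j'} f := ⟨compMap s i f, by
    intro q
    obtain ⟨p, hp⟩ := (s.map f).surj (fibEmb s i j' q)
    have hm : p ∈ fib s i j := by
      rw [mem_fib, ← toLast_map s f, hp]; exact fibEmb_mem s i j' q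
    refine ⟨(fibIso s i j).symm ⟨p, hm⟩, (fibEmb s i j').injective ?_⟩
    rw [fibEmb_compMap, fibEmb_symm]; exact hp⟩
  map_id j := by
    ext1; funext p
    apply (fibEmb s i j).injective
    change fibEmb s i j (compMap s i (𝟙 j) p) = _
    rw [fibEmb_compMap, s.map_id]; rfl
  map_comp {j j' j''} f g := by
    ext1; funext p
    apply (fibEmb s i j'').injective
    change fibEmb s i j'' (compMap s i (f ≫ g) p)
      = fibEmb s i j'' (compMap s i g (compMap s i f p))
    rw [fibEmb_compMap, fibEmb_compMap, fibEmb_compMap, s.map_comp]; rfl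

theorem component_last {n : ℕ} (s : Fin (n + 1) ⥤ Omega) (i : Fin (s.obj (Fin.last n)).card) :
    ((component s i).obj (Fin.last n)).card = 1 := by
  change (fib s i (Fin.last n)).card = 1
  rw [Finset.card_eq_one]
  refine ⟨i, ?_⟩
  ext p
  rw [mem_fib, Finset.mem_singleton]
  have h : toLast s (Fin.last n) = 𝟙 _ := by
    rw [← s.map_id]; rfl
  rw [h]; rfl

/-- The `i`-th component, as an element of `NΩₙ(-, 1)`. -/
abbrev componentStr {n : ℕ} (s : Fin (n + 1) ⥤ Omega) (i : Fin (s.obj (Fin.last n)).card) : Str n :=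
  ⟨component s i, component_last s i⟩

/-- The functor adding a basepoint, from `Ω` to the surjective based maps. -/
abbrev addBase : Omega ⥤ GammaSurj where
  obj a := ⟨⟨a.card⟩⟩
  map {a b} f := ⟨⟨Fin.cases 0 fun p => (f.toFun p).succ, rfl⟩, by
    intro q
    refine Fin.cases ⟨0, rfl⟩ (fun q => ?_) q
    obtain ⟨p, rfl⟩ := f.surj q
    exact ⟨p.succ, rfl⟩⟩
  map_id a := by
    apply WideSubcategory.hom_ext
    apply GammaCat.Hom.ext
    funext p
    refine Fin.cases rfl (fun p => rfl) p
  map_comp f g := by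
    apply WideSubcategory.hom_ext
    apply GammaCat.Hom.ext
    funext p
    refine Fin.cases rfl (fun p => rfl) p

/-- The based map which collapses to the basepoint everything outside of the preimage of `i`, and
re-indexes that preimage in the order-preserving way. -/
def collapseFun {n : ℕ} (s : Fin (n + 1) ⥤ Omega) (i : Fin (s.obj (Fin.last n)).card) :
    Fin ((s.obj 0).card + 1) → Fin ((fib s i 0).card + 1) :=
  Fin.cases 0 fun p => if h : p ∈ fib s i 0 then ((fibIso s i 0).symm ⟨p, h⟩).succ else 0

theorem collapseFun_iff {n : ℕ} (s : Fin (n + 1) ⥤ Omega) (i : Fin (s.obj (Fin.last n)).card)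
    (p : Fin (s.obj 0).card) (q : Fin (fib s i 0).card) :
    collapseFun s i p.succ = q.succ ↔ fibEmb s i 0 q = p := by
  have e : collapseFun s i p.succ =
    if h : p ∈ fib s i 0 then ((fibIso s i 0).symm ⟨p, h⟩).succ else 0 := rfl
  rw [e]
  split_ifs with h
  · constructor
    · intro hq
      rw [← (Fin.succ_injective _ hq : _ = q), fibEmb_symm]
    · rintro rfl
      congr 1
      rw [OrderIso.symm_apply_eq]; rfl
  · constructor
    · intro hq; exact absurd hq.symm (Fin.succ_ne_zero _)
    · rintro rfl
      exact absurd (mem_fib.2 (fibEmb_mem s i 0 q)) h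

/-- The map `collapseFun`, as a surjective based map. -/
def collapse {n : ℕ} (s : Fin (n + 1) ⥤ Omega) (i : Fin (s.obj (Fin.last n)).card) :
    addBase.obj (s.obj 0) ⟶ addBase.obj ((component s i).obj 0) :=
  ⟨⟨collapseFun s i, rfl⟩, fun q =>
    Fin.cases ⟨0, rfl⟩ (fun q => ⟨(fibEmb s i 0 q).succ, (collapseFun_iff s i _ q).2 rfl⟩) q⟩

theorem addBase_iff {a b : Omega} (f : a ⟶ b) (p : Fin a.card) (q : Fin b.card) :
    (addBase.map f).hom.toFun p.succ = q.succ ↔ f.toFun p = q := by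
  have e : (addBase.map f).hom.toFun p.succ = (f.toFun p).succ := rfl
  rw [e]
  exact (Fin.succ_injective _).eq_iff

/-- Two strings embedded with the same image in a third one are equal, compatibly with the maps
of a based set into their initial sets. -/
theorem lof_unique (F : GammaSurj ⥤ ModuleCat.{u} k) {n : ℕ} {t : Fin (n + 1) ⥤ Omega}
    {s s' : Str n}
    (m : ∀ j, Fin (s.1.obj j).card ↪o Fin (t.obj j).card)
    (m' : ∀ j, Fin (s'.1.obj j).card ↪o Fin (t.obj j).card)
    (hr : ∀ j, Set.range (m j) = Set.range (m' j))
    (hm : ∀ {j j'} (f : j ⟶ j') p, m j' ((s.1.map f).toFun p) = (t.map f).toFun (m j p))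
    (hm' : ∀ {j j'} (f : j ⟶ j') p, m' j' ((s'.1.map f).toFun p) = (t.map f).toFun (m' j p))
    {a : GammaSurj} (w : a ⟶ addBase.obj (s.1.obj 0)) (w' : a ⟶ addBase.obj (s'.1.obj 0))
    (r : Fin a.obj.n → Fin (t.obj 0).card)
    (hw : ∀ p q, w.hom.toFun p.succ = Fin.succ q ↔ m 0 q = r p)
    (hw' : ∀ p q, w'.hom.toFun p.succ = Fin.succ q ↔ m' 0 q = r p) (x : F.obj a) :
    DirectSum.lof k (Str n) (fun s => F.obj (addBase.obj (s.1.obj 0))) s ((F.map w).hom x) =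
    DirectSum.lof k (Str n) (fun s => F.obj (addBase.obj (s.1.obj 0))) s' ((F.map w').hom x) := by
  obtain ⟨⟨o, mp, hid, hcomp⟩, hs⟩ := s
  obtain ⟨⟨o', mp', hid', hcomp'⟩, hs'⟩ := s'
  have ho : o = o' := by
    funext j
    apply Omega.ext
    have h1 := Set.card_range_of_injective (m j).injective
    have h2 := Set.card_range_of_injective (m' j).injective
    simp only [Fintype.card_fin] at h1 h2
    rw [← h1, ← h2]
    exact Fintype.card_congr (Equiv.setCongr (hr j))
  subst ho
  have hmm : m = m' := by
    funext j
    exact OrderEmbedding.range_inj.1 (hr j)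
  subst hmm
  have hmp : @mp = @mp' := by
    funext j j' f
    ext1; funext p
    apply (m j').injective
    exact (hm f p).trans (hm' f p).symm
  subst hmp
  have hww : w = w' := by
    apply WideSubcategory.hom_ext
    apply GammaCat.Hom.ext
    funext p
    refine Fin.cases (w.hom.map_zero.trans w'.hom.map_zero.symm) (fun p => ?_) p
    rcases Fin.eq_zero_or_eq_succ (w.hom.toFun p.succ) with h | ⟨q, h⟩
    · rcases Fin.eq_zero_or_eq_succ (w'.hom.toFun p.succ) with h' | ⟨q', h'⟩
      · rw [h, h']
      · exact absurd (h.symm.trans ((hw p q').2 ((hw' p q').1 h'))) (Fin.succ_ne_zero _).symm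
    · exact h.trans ((hw' p q).2 ((hw p q).1 h)).symm
  rw [hww]

/-- The `i`-th summand of the operator `rwOp` below: the generator given by a string `s` in
`NΩₙ(-, 1)` and `x ∈ F([s₀])` is sent to the `i`-th component of the string `s ∘ θ` with the image
of `x` under the based map `[s₀] → [s_{θ(0)}]` followed by the map that collapses all but the
preimage of `i`. -/
noncomputable def rwTerm (F : GammaSurj ⥤ ModuleCat.{u} k) {m n : SimplexCategory} (θ : m ⟶ n)
    (s : Str n.len) (i : Fin (s.1.obj (θ.toOrderHom (Fin.last m.len))).card) :
    F.obj (addBase.obj (s.1.obj 0)) →ₗ[k] (⨁ s : Str m.len, F.obj (addBase.obj (s.1.obj 0))) :=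
  DirectSum.lof k (Str m.len) (fun s => F.obj (addBase.obj (s.1.obj 0)))
      (componentStr (pull θ s.1) i) ∘ₗ
    (F.map (addBase.map (toStart θ s.1) ≫ collapse (pull θ s.1) i)).hom

/-- The operator `θ^*` of the Robinson-Whitehouse simplicial module: the sum of the maps `rwTerm`
over the elements `i` of the last set of the string `s ∘ θ`.  For a face map other than the last
one that set has one element. -/
noncomputable def rwOp (F : GammaSurj ⥤ ModuleCat.{u} k) {m n : SimplexCategory} (θ : m ⟶ n) :
    (⨁ s : Str n.len, F.obj (addBase.obj (s.1.obj 0))) →ₗ[k]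
      (⨁ s : Str m.len, F.obj (addBase.obj (s.1.obj 0))) :=
  DirectSum.toModule k _ _ fun s => ∑ i, rwTerm F θ s i

theorem rwOp_lof (F : GammaSurj ⥤ ModuleCat.{u} k) {m n : SimplexCategory} (θ : m ⟶ n)
    (s : Str n.len) (x : F.obj (addBase.obj (s.1.obj 0))) :
    rwOp F θ (DirectSum.lof k (Str n.len) (fun s => F.obj (addBase.obj (s.1.obj 0))) s x) =
      ∑ i, rwTerm F θ s i x := by
  rw [rwOp, DirectSum.toModule_lof, LinearMap.sum_apply]

theorem rwTerm_id (F : GammaSurj ⥤ ModuleCat.{u} k) (n : SimplexCategory) (s : Str n.len)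
    (i : Fin (s.1.obj (Fin.last n.len)).card) (x : F.obj (addBase.obj (s.1.obj 0))) :
    rwTerm F (𝟙 n) s i x =
      DirectSum.lof k (Str n.len) (fun s => F.obj (addBase.obj (s.1.obj 0))) s x := by
  have hs : (s.1.obj (Fin.last n.len)).card = 1 := s.2
  have huniq : ∀ i i' : Fin (s.1.obj (Fin.last n.len)).card, i = i' := by
    rw [hs]; exact fun i i' => Subsingleton.elim _ _
  have h0 : x = (F.map (𝟙 _)).hom x := by rw [F.map_id]; rfl
  conv_rhs => rw [h0]
  refine lof_unique F (t := s.1) (fibEmb s.1 i) (fun j => RelEmbedding.refl _) ?_ ?_ ?_ _ _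
    id ?_ ?_ x
  · intro j
    refine (range_fibEmb s.1 i j).trans ?_
    ext p
    exact ⟨fun _ => ⟨p, rfl⟩, fun _ => huniq _ _⟩
  · intro j j' f p
    exact fibEmb_compMap s.1 i f p
  · intro j j' f p
    rfl
  · intro p q
    refine (collapseFun_iff s.1 i _ q).trans ?_
    rw [show (toStart (𝟙 n) s.1) = 𝟙 _ from s.1.map_id _]
    rfl
  · intro p q
    exact (Fin.succ_injective _).eq_iff.trans eq_comm

theorem rw_id (F : GammaSurj ⥤ ModuleCat.{u} k) (n : SimplexCategory) :
    rwOp F (𝟙 n) = LinearMap.id := by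
  refine DirectSum.linearMap_ext k fun s => LinearMap.ext fun x => ?_
  refine (rwOp_lof F (𝟙 n) s x).trans ?_
  have hs : (s.1.obj (Fin.last n.len)).card = 1 := s.2
  have huniq : ∀ i i' : Fin (s.1.obj (Fin.last n.len)).card, i = i' := by
    rw [hs]; exact fun i i' => Subsingleton.elim _ _
  let i₀ : Fin (s.1.obj (Fin.last n.len)).card := ⟨0, by rw [hs]; exact one_pos⟩
  exact (Fintype.sum_eq_single i₀ fun i hi => absurd (huniq i i₀) hi).trans
    (rwTerm_id F n s i₀ x)

theorem range_fibEmb_fibEmb {l m : SimplexCategory} (η : l ⟶ m) (t : Fin (m.len + 1) ⥤ Omega)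
    (i : Fin (t.obj (Fin.last m.len)).card)
    (p : Fin (fib t i (η.toOrderHom (Fin.last l.len))).card) (j : Fin (l.len + 1)) :
    Set.range (fun q => fibEmb t i (η.toOrderHom j) (fibEmb (pull η (component t i)) p j q)) =
      Set.ofPred fun q => (toLast (pull η t) j).toFun q =
        fibEmb t i (η.toOrderHom (Fin.last l.len)) p := by
  ext q
  constructor
  · rintro ⟨q', rfl⟩
    have h := fibEmb_mem (pull η (component t i)) p j q'
    exact (fibEmb_compMap t i _ _).symm.trans
      (congrArg (fibEmb t i (η.toOrderHom (Fin.last l.len))) h)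
  · intro hq
    have hq' : (t.map (homOfLE (η.toOrderHom.monotone (Fin.le_last j)))).toFun q =
      fibEmb t i (η.toOrderHom (Fin.last l.len)) p := hq
    have h1 : q ∈ fib t i (η.toOrderHom j) := by
      rw [mem_fib, ← toLast_map t (homOfLE (η.toOrderHom.monotone (Fin.le_last j))) q, hq']
      exact fibEmb_mem _ _ _ p
    have h2 : (fibIso t i (η.toOrderHom j)).symm ⟨q, h1⟩ ∈
        fib (pull η (component t i)) p j := by
      refine mem_fib.2 ?_
      apply (fibEmb t i (η.toOrderHom (Fin.last l.len))).injective
      refine (fibEmb_compMap t i (homOfLE (η.toOrderHom.monotone (Fin.le_last j))) _).trans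
        (Eq.trans ?_ hq')
      exact congrArg _ (fibEmb_symm t i _ ⟨q, h1⟩)
    refine ⟨(fibIso _ _ _).symm ⟨_, h2⟩, ?_⟩
    exact (congrArg (fibEmb t i (η.toOrderHom j)) (fibEmb_symm _ _ _ ⟨_, h2⟩)).trans
      (fibEmb_symm t i _ ⟨q, h1⟩)

theorem collapse_collapse {l m : SimplexCategory} (η : l ⟶ m) {a : Omega}
    (t : Fin (m.len + 1) ⥤ Omega) (f : a ⟶ t.obj 0)
    (i : Fin (t.obj (Fin.last m.len)).card)
    (p : Fin (fib t i (η.toOrderHom (Fin.last l.len))).card) (q : Fin a.card)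
    (r : Fin (fib (pull η (component t i)) p 0).card) :
    collapseFun (pull η (component t i)) p
        ((addBase.map (toStart η (component t i))).hom.toFun
          (collapseFun t i (f.toFun q).succ)) = r.succ ↔
      fibEmb t i (η.toOrderHom 0) (fibEmb (pull η (component t i)) p 0 r) =
        (toStart η t).toFun (f.toFun q) := by
  rcases Fin.eq_zero_or_eq_succ (collapseFun t i (f.toFun q).succ) with h | ⟨c, h⟩
  · rw [h]
    constructor
    · intro h'
      exact absurd h'.symm (Fin.succ_ne_zero _)
    · intro h'
      exfalso
      have hm : f.toFun q ∈ fib t i 0 := by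
        rw [mem_fib, ← toLast_map t (homOfLE (Fin.zero_le (η.toOrderHom 0)))]
        exact (congrArg (toLast t (η.toOrderHom 0)).toFun h').symm.trans (fibEmb_mem t i _ _)
      have := (collapseFun_iff t i (f.toFun q) ((fibIso t i 0).symm ⟨_, hm⟩)).2
        (fibEmb_symm t i 0 ⟨_, hm⟩)
      rw [h] at this
      exact absurd this.symm (Fin.succ_ne_zero _)
  · rw [h]
    have hc := (collapseFun_iff t i _ c).1 h
    refine (collapseFun_iff (pull η (component t i)) p
      ((toStart η (component t i)).toFun c) r).trans ?_
    rw [← hc]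
    have e : fibEmb t i (η.toOrderHom 0) ((toStart η (component t i)).toFun c) =
      (toStart η t).toFun (fibEmb t i 0 c) := fibEmb_compMap t i _ c
    rw [← e]
    exact (fibEmb t i (η.toOrderHom 0)).injective.eq_iff.symm

theorem rwTerm_rwTerm (F : GammaSurj ⥤ ModuleCat.{u} k) {l m n : SimplexCategory} (η : l ⟶ m)
    (θ : m ⟶ n) (s : Str n.len) (i : Fin (s.1.obj (θ.toOrderHom (Fin.last m.len))).card)
    (p : Fin (fib (pull θ s.1) i (η.toOrderHom (Fin.last l.len))).card)
    (x : F.obj (addBase.obj (s.1.obj 0))) :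
    rwTerm F η (componentStr (pull θ s.1) i) p
        ((F.map (addBase.map (toStart θ s.1) ≫ collapse (pull θ s.1) i)).hom x) =
      rwTerm F (η ≫ θ) s (fibEmb (pull θ s.1) i (η.toOrderHom (Fin.last l.len)) p) x := by
  unfold rwTerm
  rw [LinearMap.comp_apply, LinearMap.comp_apply, ← LinearMap.comp_apply
    (ModuleCat.Hom.hom (F.map (addBase.map (toStart η _) ≫ _))), ← ModuleCat.hom_comp,
    ← F.map_comp]
  have hst : (toStart (η ≫ θ) s.1).toFun =
      (toStart η (pull θ s.1)).toFun ∘ (toStart θ s.1).toFun :=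
    congrArg Omega.Hom.toFun (s.1.map_comp (homOfLE (Fin.zero_le (θ.toOrderHom 0)))
      (homOfLE (θ.toOrderHom.monotone (Fin.zero_le (η.toOrderHom 0)))))
  refine lof_unique F (t := pull η (pull θ s.1))
    (fun j => (fibEmb (pull η (component (pull θ s.1) i)) p j).trans
      (fibEmb (pull θ s.1) i (η.toOrderHom j)))
    (fun j => fibEmb (pull η (pull θ s.1))
      (fibEmb (pull θ s.1) i (η.toOrderHom (Fin.last l.len)) p) j)
    ?_ ?_ ?_ _ _ (toStart (η ≫ θ) s.1).toFun ?_ ?_ x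
  · intro j
    exact (range_fibEmb_fibEmb η (pull θ s.1) i p j).trans
      (range_fibEmb (pull η (pull θ s.1)) _ j).symm
  · intro j j' f q
    exact (congrArg (fibEmb (pull θ s.1) i (η.toOrderHom j'))
      (fibEmb_compMap (pull η (component (pull θ s.1) i)) p f q)).trans
      (fibEmb_compMap (pull θ s.1) i _ _)
  · intro j j' f q
    exact fibEmb_compMap (pull η (pull θ s.1)) _ f q
  · intro q r
    rw [hst]
    exact collapse_collapse η (pull θ s.1) (toStart θ s.1) i p q r
  · intro q r
    exact collapseFun_iff (pull η (pull θ s.1)) _ ((toStart (η ≫ θ) s.1).toFun q) r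

theorem rw_comp (F : GammaSurj ⥤ ModuleCat.{u} k) {l m n : SimplexCategory} (η : l ⟶ m)
    (θ : m ⟶ n) : rwOp F (η ≫ θ) = rwOp F η ∘ₗ rwOp F θ := by
  refine DirectSum.linearMap_ext k fun s => LinearMap.ext fun x => ?_
  refine (rwOp_lof F (η ≫ θ) s x).trans ?_
  refine Eq.trans ?_ (congrArg (rwOp F η) (rwOp_lof F θ s x)).symm
  rw [map_sum]
  refine Eq.trans ?_ (Finset.sum_congr rfl fun i _ => (rwOp_lof F η
    (componentStr (pull θ s.1) i)
    ((F.map (addBase.map (toStart θ s.1) ≫ collapse (pull θ s.1) i)).hom x)).symm)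
  rw [Finset.sum_sigma']
  symm
  refine Fintype.sum_bijective
    (fun z : (Σ i : Fin (s.1.obj (θ.toOrderHom (Fin.last m.len))).card,
      Fin (fib (pull θ s.1) i (η.toOrderHom (Fin.last l.len))).card) =>
      (fibEmb (pull θ s.1) z.1 (η.toOrderHom (Fin.last l.len)) z.2 :
        Fin (s.1.obj (θ.toOrderHom (η.toOrderHom (Fin.last l.len)))).card)) ?_ _ _ ?_
  · constructor
    · rintro ⟨i, p⟩ ⟨i', p'⟩ h
      have h1 := fibEmb_mem (pull θ s.1) i _ p
      have h2 := fibEmb_mem (pull θ s.1) i' _ p'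
      dsimp only at h
      have hii : i = i' := by
        rw [← h1, ← h2]
        exact congrArg _ h
      subst hii
      rw [(fibEmb (pull θ s.1) i (η.toOrderHom (Fin.last l.len))).injective h]
    · intro q
      refine ⟨⟨(toLast (pull θ s.1) (η.toOrderHom (Fin.last l.len))).toFun q,
        (fibIso _ _ _).symm ⟨q, mem_fib.2 rfl⟩⟩, ?_⟩
      exact fibEmb_symm _ _ _ _
  · rintro ⟨i, p⟩
    exact rwTerm_rwTerm F η θ s i p x

/-- The Robinson-Whitehouse simplicial `k`-module of a functor on the surjective based maps:
in degree `n` it is `⨁_{[fₙ|⋯|f₁] ∈ NΩₙ(x, 1)} F([x])`. -/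
noncomputable def rwComplex (F : GammaSurj ⥤ ModuleCat.{u} k) :
    SimplicialObject (ModuleCat.{u} k) where
  obj Δ := ModuleCat.of k (⨁ s : Str Δ.unop.len, F.obj (addBase.obj (s.1.obj 0)))
  map θ := ModuleCat.ofHom (rwOp F θ.unop)
  map_id Δ := by
    ext1
    exact rw_id F _
  map_comp θ η := by
    ext1
    exact rw_comp F η.unop θ.unop

/-- Functoriality of the Robinson-Whitehouse simplicial module. -/
noncomputable def rwComplexMap {F G : GammaSurj ⥤ ModuleCat.{u} k} (α : F ⟶ G) :
    rwComplex F ⟶ rwComplex G where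
  app Δ := ModuleCat.ofHom (DirectSum.lmap fun s : Str Δ.unop.len =>
    (α.app (addBase.obj (s.1.obj 0))).hom)
  naturality {Δ Δ'} θ := by
    ext1
    refine DirectSum.linearMap_ext k fun s => LinearMap.ext fun x => ?_
    let L (Δ : SimplexCategoryᵒᵖ) : (⨁ s : Str Δ.unop.len, F.obj (addBase.obj (s.1.obj 0))) →ₗ[k]
        (⨁ s : Str Δ.unop.len, G.obj (addBase.obj (s.1.obj 0))) :=
      DirectSum.lmap fun s : Str Δ.unop.len => (α.app (addBase.obj (s.1.obj 0))).hom
    change L Δ' (rwOp F θ.unop (DirectSum.lof k (Str Δ.unop.len)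
      (fun s => F.obj (addBase.obj (s.1.obj 0))) s x)) =
      rwOp G θ.unop (L Δ (DirectSum.lof k (Str Δ.unop.len)
      (fun s => F.obj (addBase.obj (s.1.obj 0))) s x))
    rw [rwOp_lof, map_sum, DirectSum.lmap_lof]
    refine Eq.trans ?_ (rwOp_lof G θ.unop s _).symm
    refine Finset.sum_congr rfl fun i _ => ?_
    refine (DirectSum.lmap_lof _ _ _).trans ?_
    refine congrArg (DirectSum.lof k (Str Δ'.unop.len)
      (fun s => G.obj (addBase.obj (s.1.obj 0))) _) ?_
    exact congrArg (fun f : F.obj (addBase.obj (s.1.obj 0)) ⟶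
        G.obj (addBase.obj ((component (pull θ.unop s.1) i).obj 0)) => f.hom x)
      (α.naturality (addBase.map (toStart θ.unop s.1) ≫ collapse (pull θ.unop s.1) i))

end Simplicial

/-! ### The Loday functor and the symmetric bar construction -/

section Tensor

variable {k : Type u} [CommRing k]

/-- The product of the entries of a tuple over a fibre of a map. -/
abbrev fibProd {A : Type u} [CommRing A] {ι κ : Type} [Fintype ι] [DecidableEq κ]
    (f : ι → κ) (l : κ) (y : ι → A) : A :=
  ∏ i with f i = l, y i

theorem fibProd_update {A V : Type u} [CommRing A] {ι κ : Type} [Fintype ι] [DecidableEq ι]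
    [DecidableEq κ] (f : ι → κ) (ℓ : V → A) (y : ι → V) (i : ι) (a : V) :
    fibProd f (f i) (fun i' => ℓ (Function.update y i a i')) =
      ℓ a * ∏ i' ∈ (Finset.univ.filter fun i' => f i' = f i).erase i, ℓ (y i') := by
  have hi : i ∈ Finset.univ.filter fun i' => f i' = f i := by simp
  rw [fibProd, ← Finset.mul_prod_erase _ _ hi]
  congr 1
  · simp
  · refine Finset.prod_congr rfl fun i' hi' => ?_
    rw [Function.update_of_ne (Finset.ne_of_mem_erase hi')]

theorem fibProd_update_ne {A V : Type u} [CommRing A] {ι κ : Type} [Fintype ι] [DecidableEq ι]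
    [DecidableEq κ] (f : ι → κ) (ℓ : V → A) (y : ι → V) (i : ι) (a : V) {l : κ} (h : f i ≠ l) :
    fibProd f l (fun i' => ℓ (Function.update y i a i')) = fibProd f l (fun i' => ℓ (y i')) := by
  refine Finset.prod_congr rfl fun i' hi' => ?_
  dsimp only
  rw [Function.update_of_ne]
  rintro rfl
  exact h (Finset.mem_filter.1 hi').2

/-- Multiplying the entries of a tuple along a map of sets, in a form that applies to an algebra
and to its augmentation ideal. -/
structure MulData (k : Type u) [CommRing k] (A V : Type u) [CommRing A] [Algebra k A]
    [AddCommGroup V] [Module k V] : Type u where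
  incl : V →ₗ[k] A
  inj : Function.Injective incl

theorem MulData.update {A V : Type u} [CommRing A] [Algebra k A] [AddCommGroup V] [Module k V]
    (D : MulData k A V) {ι κ J : Type} [Fintype ι] [DecidableEq ι] [DecidableEq κ] [DecidableEq J]
    (f : ι → κ) (e : J → κ) (he : Function.Injective e) (P : (ι → V) → J → V)
    (hP : ∀ y j, D.incl (P y j) = fibProd f (e j) fun i => D.incl (y i))
    (y : ι → V) (i : ι) (j : J) (hj : f i = e j) (a b : V) :
    P (Function.update y i b) =
      Function.update (P (Function.update y i a)) j (P (Function.update y i b) j) := by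
  funext j'
  by_cases h : j' = j
  · subst h; simp
  · rw [Function.update_of_ne h]
    apply D.inj
    have h' : f i ≠ e j' := by
      rw [hj]; exact fun h' => h (he h').symm
    rw [hP, hP, fibProd_update_ne f D.incl y i b h', fibProd_update_ne f D.incl y i a h']

theorem MulData.update_ne {A V : Type u} [CommRing A] [Algebra k A] [AddCommGroup V] [Module k V]
    (D : MulData k A V) {ι κ J : Type} [Fintype ι] [DecidableEq ι] [DecidableEq κ]
    (f : ι → κ) (e : J → κ) (P : (ι → V) → J → V)
    (hP : ∀ y j, D.incl (P y j) = fibProd f (e j) fun i => D.incl (y i))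
    (y : ι → V) (i : ι) (hj : ∀ j, f i ≠ e j) (a : V) :
    P (Function.update y i a) = P y := by
  funext j'
  apply D.inj
  rw [hP, hP, fibProd_update_ne f D.incl y i a (hj j')]

theorem MulData.tprod_add {A V : Type u} [CommRing A] [Algebra k A] [AddCommGroup V] [Module k V]
    (D : MulData k A V) {ι κ J : Type} [Fintype ι] [DecidableEq ι] [DecidableEq κ] [DecidableEq J]
    (f : ι → κ) (e : J → κ) (he : Function.Injective e) (P : (ι → V) → J → V)
    (hP : ∀ y j, D.incl (P y j) = fibProd f (e j) fun i => D.incl (y i))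
    (y : ι → V) (i : ι) (j : J) (hj : f i = e j) (a b : V) :
    PiTensorProduct.tprod k (P (Function.update y i (a + b))) =
      PiTensorProduct.tprod k (P (Function.update y i a)) +
        PiTensorProduct.tprod k (P (Function.update y i b)) := by
  have h : P (Function.update y i (a + b)) j =
      P (Function.update y i a) j + P (Function.update y i b) j := by
    apply D.inj
    rw [map_add, hP, hP, hP, ← hj, fibProd_update f D.incl, fibProd_update f D.incl,
      fibProd_update f D.incl, map_add, add_mul]
  rw [D.update f e he P hP y i j hj a (a + b), h, (PiTensorProduct.tprod k).map_update_add,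
    Function.update_eq_self, ← D.update f e he P hP y i j hj a b]

theorem MulData.tprod_smul {A V : Type u} [CommRing A] [Algebra k A] [AddCommGroup V] [Module k V]
    (D : MulData k A V) {ι κ J : Type} [Fintype ι] [DecidableEq ι] [DecidableEq κ] [DecidableEq J]
    (f : ι → κ) (e : J → κ) (he : Function.Injective e) (P : (ι → V) → J → V)
    (hP : ∀ y j, D.incl (P y j) = fibProd f (e j) fun i => D.incl (y i))
    (y : ι → V) (i : ι) (j : J) (hj : f i = e j) (c : k) (a : V) :
    PiTensorProduct.tprod k (P (Function.update y i (c • a))) =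
      c • PiTensorProduct.tprod k (P (Function.update y i a)) := by
  have h : P (Function.update y i (c • a)) j = c • P (Function.update y i a) j := by
    apply D.inj
    rw [map_smul, hP, hP, ← hj, fibProd_update f D.incl, fibProd_update f D.incl, map_smul,
      smul_mul_assoc]
  rw [D.update f e he P hP y i j hj a (c • a), h, (PiTensorProduct.tprod k).map_update_smul,
    Function.update_eq_self]

/-- The linear map `V^{⊗ι} → V^{⊗J}` given on elementary tensors by a rule `P` that multiplies the
entries over the fibres of a map `f : ι → J`. -/
noncomputable def MulData.tensorMap {A V : Type u} [CommRing A] [Algebra k A] [AddCommGroup V]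
    [Module k V] (D : MulData k A V) {ι J : Type} [Fintype ι] [DecidableEq J]
    (f : ι → J) (P : (ι → V) → J → V)
    (hP : ∀ y j, D.incl (P y j) = fibProd f j fun i => D.incl (y i)) :
    (⨂[k] _ : ι, V) →ₗ[k] (⨂[k] _ : J, V) :=
  PiTensorProduct.lift
    { toFun := fun y => PiTensorProduct.tprod k (P y)
      map_update_add' := fun y i a b =>
        D.tprod_add f id Function.injective_id P hP y i (f i) rfl a b
      map_update_smul' := fun y i c a =>
        D.tprod_smul f id Function.injective_id P hP y i (f i) rfl c a }

theorem MulData.tensorMap_tprod {A V : Type u} [CommRing A] [Algebra k A] [AddCommGroup V]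
    [Module k V] (D : MulData k A V) {ι J : Type} [Fintype ι] [DecidableEq J]
    (f : ι → J) (P : (ι → V) → J → V)
    (hP : ∀ y j, D.incl (P y j) = fibProd f j fun i => D.incl (y i)) (y : ι → V) :
    D.tensorMap f P hP (PiTensorProduct.tprod k y) = PiTensorProduct.tprod k (P y) :=
  PiTensorProduct.lift.tprod _

/-- The linear map `V^{⊗a} ⊗ M → V^{⊗b} ⊗ M` given on elementary tensors by a rule `P` that
multiplies the entries over the fibres of a based map `f : [a] → [b]` other than the fibre of the
basepoint, while the product of the entries in the fibre of the basepoint acts on `M`. -/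
noncomputable def MulData.basedMap {A V : Type u} [CommRing A] [Algebra k A] [AddCommGroup V]
    [Module k V] (D : MulData k A V) (M : Type u) [AddCommGroup M] [Module k M] [Module A M]
    [IsScalarTower k A M] {a b : ℕ} (f : Fin a → Fin (b + 1)) (P : (Fin a → V) → Fin b → V)
    (hP : ∀ y j, D.incl (P y j) = fibProd f j.succ fun i => D.incl (y i)) :
    ((⨂[k] _ : Fin a, V) ⊗[k] M) →ₗ[k] ((⨂[k] _ : Fin b, V) ⊗[k] M) :=
  TensorProduct.lift (PiTensorProduct.lift
    { toFun := fun y => TensorProduct.mk k _ M (PiTensorProduct.tprod k (P y)) ∘ₗ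
        Algebra.lsmul k k M (fibProd f 0 fun i => D.incl (y i))
      map_update_add' := fun {_} y i v w => by
        have hdec : ‹DecidableEq (Fin a)› = instDecidableEqFin a := Subsingleton.elim _ _
        subst hdec
        rcases Fin.eq_zero_or_eq_succ (f i) with h | ⟨j, h⟩
        · have hn : ∀ j : Fin b, f i ≠ j.succ := fun j => by
            rw [h]; exact (Fin.succ_ne_zero j).symm
          rw [D.update_ne f Fin.succ P hP y i hn, D.update_ne f Fin.succ P hP y i hn,
            D.update_ne f Fin.succ P hP y i hn, ← h, fibProd_update f D.incl,
            fibProd_update f D.incl, fibProd_update f D.incl, map_add, add_mul, map_add,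
            LinearMap.comp_add]
        · have hn : f i ≠ 0 := by rw [h]; exact Fin.succ_ne_zero j
          rw [D.tprod_add f Fin.succ (Fin.succ_injective b) P hP y i j h,
            fibProd_update_ne f D.incl y i _ hn, fibProd_update_ne f D.incl y i _ hn,
            fibProd_update_ne f D.incl y i _ hn, map_add, LinearMap.add_comp]
      map_update_smul' := fun {_} y i c v => by
        have hdec : ‹DecidableEq (Fin a)› = instDecidableEqFin a := Subsingleton.elim _ _
        subst hdec
        rcases Fin.eq_zero_or_eq_succ (f i) with h | ⟨j, h⟩
        · have hn : ∀ j : Fin b, f i ≠ j.succ := fun j => by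
            rw [h]; exact (Fin.succ_ne_zero j).symm
          rw [D.update_ne f Fin.succ P hP y i hn, D.update_ne f Fin.succ P hP y i hn, ← h,
            fibProd_update f D.incl, fibProd_update f D.incl, map_smul, smul_mul_assoc, map_smul,
            LinearMap.comp_smul]
        · have hn : f i ≠ 0 := by rw [h]; exact Fin.succ_ne_zero j
          rw [D.tprod_smul f Fin.succ (Fin.succ_injective b) P hP y i j h,
            fibProd_update_ne f D.incl y i _ hn, fibProd_update_ne f D.incl y i _ hn, map_smul,
            LinearMap.smul_comp] })

theorem MulData.basedMap_tmul {A V : Type u} [CommRing A] [Algebra k A] [AddCommGroup V]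
    [Module k V] (D : MulData k A V) (M : Type u) [AddCommGroup M] [Module k M] [Module A M]
    [IsScalarTower k A M] {a b : ℕ} (f : Fin a → Fin (b + 1)) (P : (Fin a → V) → Fin b → V)
    (hP : ∀ y j, D.incl (P y j) = fibProd f j.succ fun i => D.incl (y i)) (y : Fin a → V) (m : M) :
    D.basedMap M f P hP (PiTensorProduct.tprod k y ⊗ₜ m) =
      PiTensorProduct.tprod k (P y) ⊗ₜ[k] ((fibProd f 0 fun i => D.incl (y i)) • m) := by
  rw [MulData.basedMap, TensorProduct.lift.tmul, PiTensorProduct.lift.tprod]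
  rfl

theorem fibProd_comp {A : Type u} [CommRing A] {a b : ℕ} {κ : Type} [DecidableEq κ]
    (f : Fin a → Fin (b + 1)) (g : Fin (b + 1) → κ) (l : κ) (y : Fin a → A) :
    fibProd (g ∘ f) l y =
      (if g 0 = l then fibProd f 0 y else 1) *
        fibProd (fun j : Fin b => g j.succ) l fun j => fibProd f j.succ y := by
  have h1 : fibProd (g ∘ f) l y = fibProd g l fun c => fibProd f c y := by
    simp only [fibProd, Finset.prod_filter]
    have : ∀ c, (if g c = l then ∏ i, (if f i = c then y i else 1) else 1) =
        ∏ i, (if f i = c then (if g c = l then y i else 1) else 1) := by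
      intro c
      split_ifs with h
      · rfl
      · simp
    rw [Finset.prod_congr rfl fun c _ => this c, Finset.prod_comm]
    refine Finset.prod_congr rfl fun i _ => ?_
    rw [Finset.prod_ite_eq]
    simp
  rw [h1]
  simp only [fibProd, Finset.prod_filter]
  rw [Fin.prod_univ_succ]

theorem fibProd_comp' {A : Type u} [CommRing A] {ι J κ : Type} [Fintype ι] [Fintype J]
    [DecidableEq J] [DecidableEq κ]
    (f : ι → J) (g : J → κ) (l : κ) (y : ι → A) :
    fibProd (g ∘ f) l y = fibProd g l fun c => fibProd f c y := by
  simp only [fibProd, Finset.prod_filter]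
  have : ∀ c, (if g c = l then ∏ i, (if f i = c then y i else 1) else 1) =
      ∏ i, (if f i = c then (if g c = l then y i else 1) else 1) := by
    intro c
    split_ifs with h
    · rfl
    · simp
  rw [Finset.prod_congr rfl fun c _ => this c, Finset.prod_comm]
  refine Finset.prod_congr rfl fun i _ => ?_
  rw [Finset.prod_ite_eq]
  simp

theorem tensor_ext {V M N : Type u} [AddCommGroup V] [Module k V] [AddCommGroup M] [Module k M]
    [AddCommGroup N] [Module k N] {ι : Type} {f g : ((⨂[k] _ : ι, V) ⊗[k] M) →ₗ[k] N}
    (h : ∀ (y : ι → V) (m : M), f (PiTensorProduct.tprod k y ⊗ₜ m) =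
      g (PiTensorProduct.tprod k y ⊗ₜ m)) : f = g :=
  TensorProduct.ext (PiTensorProduct.ext (MultilinearMap.ext fun y => LinearMap.ext fun m => h y m))

theorem fibProd_id {A : Type u} [CommRing A] {ι : Type} [Fintype ι] [DecidableEq ι]
    (y : ι → A) (j : ι) : fibProd (fun i => i) j y = y j := by
  simp [fibProd, Finset.prod_filter]

theorem fibProd_succ {A : Type u} [CommRing A] {a : ℕ} (y : Fin a → A) (j : Fin a) :
    fibProd (fun i : Fin a => i.succ) j.succ y = y j := by
  simp [fibProd, Finset.prod_filter]

theorem fibProd_succ_zero {A : Type u} [CommRing A] {a : ℕ} (y : Fin a → A) :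
    fibProd (fun i : Fin a => i.succ) 0 y = 1 := by
  simp [fibProd]

/-- An algebra, embedded in itself. -/
def selfData (k A : Type u) [CommRing k] [CommRing A] [Algebra k A] : MulData k A A :=
  ⟨LinearMap.id, Function.injective_id⟩

section Loday

variable (k) (A M : Type u) [CommRing A] [Algebra k A] [AddCommGroup M]
  [Module k M] [Module A M] [IsScalarTower k A M]

/-- The map `A^{⊗p} ⊗ M → A^{⊗q} ⊗ M` induced by a based map `f : [p] → [q]`: it multiplies the
tensor factors over each of the preimages of `1, …, q`, and the product of the factors in the
preimage of `0` acts on `M`. -/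
noncomputable def lodayMap {a b : GammaCat} (f : a ⟶ b) :
    ((⨂[k] _ : Fin a.n, A) ⊗[k] M) →ₗ[k] ((⨂[k] _ : Fin b.n, A) ⊗[k] M) :=
  (selfData k A).basedMap M (fun i => f.toFun i.succ)
    (fun y j => fibProd (fun i : Fin a.n => f.toFun i.succ) j.succ y) (fun _ _ => rfl)

theorem lodayMap_tmul {a b : GammaCat} (f : a ⟶ b) (y : Fin a.n → A) (m : M) :
    lodayMap k A M f (PiTensorProduct.tprod k y ⊗ₜ m) =
      (PiTensorProduct.tprod k fun j : Fin b.n =>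
        fibProd (fun i : Fin a.n => f.toFun i.succ) j.succ y) ⊗ₜ[k]
          (fibProd (fun i : Fin a.n => f.toFun i.succ) 0 y • m) :=
  (selfData k A).basedMap_tmul M _ _ _ y m

/-- The Loday functor `L(A, M) : Γ → k-Mod`, `[n] ↦ A^{⊗n} ⊗ M`. -/
noncomputable def loday : GammaCat ⥤ ModuleCat.{u} k where
  obj a := ModuleCat.of k ((⨂[k] _ : Fin a.n, A) ⊗[k] M)
  map f := ModuleCat.ofHom (lodayMap k A M f)
  map_id a := by
    ext1
    refine tensor_ext fun y m => (lodayMap_tmul k A M (𝟙 a) y m).trans ?_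
    have h1 : (fun j : Fin a.n => fibProd (fun i : Fin a.n => i.succ) j.succ y) = y :=
      funext fun j => fibProd_succ y j
    have h2 := fibProd_succ_zero y
    simp only [GammaCat.id_toFun, id_eq]
    rw [h1, h2, one_smul]
    rfl
  map_comp {a b c} f g := by
    ext1
    refine tensor_ext fun y m => (lodayMap_tmul k A M (f ≫ g) y m).trans ?_
    change _ = lodayMap k A M g (lodayMap k A M f (PiTensorProduct.tprod k y ⊗ₜ m))
    rw [lodayMap_tmul, lodayMap_tmul]
    have hg : g.toFun 0 = 0 := g.map_zero
    have h (l : Fin (c.n + 1)) := fibProd_comp (fun i : Fin a.n => f.toFun i.succ) g.toFun l y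
    have h1 : (fun j : Fin c.n => fibProd (fun i : Fin a.n => (f ≫ g).toFun i.succ) j.succ y) =
        fun j : Fin c.n => fibProd (fun i : Fin b.n => g.toFun i.succ) j.succ
          fun j' => fibProd (fun i : Fin a.n => f.toFun i.succ) j'.succ y := by
      funext j
      refine (h j.succ).trans ?_
      rw [hg, if_neg (Fin.succ_ne_zero j).symm, one_mul]
    have h2 : fibProd (fun i : Fin a.n => (f ≫ g).toFun i.succ) 0 y =
        fibProd (fun i : Fin b.n => g.toFun i.succ) 0
          (fun j' => fibProd (fun i : Fin a.n => f.toFun i.succ) j'.succ y) *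
          fibProd (fun i : Fin a.n => f.toFun i.succ) 0 y := by
      refine (h 0).trans ?_
      rw [hg, if_pos rfl, mul_comm]
    rw [h1, h2, mul_smul]

end Loday

variable {A : Type u} [CommRing A] [Algebra k A]

/-- The augmentation ideal of an augmented algebra. -/
abbrev augIdeal (ε : A →ₐ[k] k) : Ideal A := RingHom.ker ε

/-- The ground ring `k`, as an `A`-module via the augmentation. -/
def Triv (_ε : A →ₐ[k] k) : Type u := k

section Triv

variable (ε : A →ₐ[k] k)

noncomputable instance : AddCommGroup (Triv ε) := inferInstanceAs (AddCommGroup k)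

noncomputable instance : Module k (Triv ε) := inferInstanceAs (Module k k)

noncomputable instance : Module A (Triv ε) := Module.compHom k (ε : A →+* k)

theorem Triv.smul_def (a : A) (m : Triv ε) : a • m = (ε a • m : Triv ε) := rfl

instance : IsScalarTower k A (Triv ε) where
  smul_assoc c a m := by
    rw [Triv.smul_def, Triv.smul_def, map_smul, smul_assoc]

end Triv

/-- The augmentation ideal, embedded in the algebra. -/
def idealData (ε : A →ₐ[k] k) : MulData k A (augIdeal ε) :=
  ⟨(augIdeal ε).subtype.restrictScalars k, Subtype.val_injective⟩

theorem fibProd_mem {ι κ : Type} [Fintype ι] [DecidableEq κ] (ε : A →ₐ[k] k) (f : ι → κ) (l : κ)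
    (hl : ∃ i, f i = l) (y : ι → augIdeal ε) :
    fibProd f l (fun i => (y i : A)) ∈ augIdeal ε := by
  classical
  obtain ⟨i, hi⟩ := hl
  have hm : i ∈ Finset.univ.filter fun i => f i = l := by simp [hi]
  rw [fibProd, ← Finset.mul_prod_erase _ _ hm]
  exact Ideal.mul_mem_right _ _ (y i).2

theorem GammaSurj.exists_succ {a b : GammaSurj} (f : a ⟶ b) (j : Fin b.obj.n) :
    ∃ i : Fin a.obj.n, f.hom.toFun i.succ = j.succ := by
  obtain ⟨i, hi⟩ := f.property j.succ
  rcases Fin.eq_zero_or_eq_succ i with rfl | ⟨i, rfl⟩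
  · exact absurd (f.hom.map_zero.symm.trans hi).symm (Fin.succ_ne_zero j)
  · exact ⟨i, hi⟩

/-- The entries of the image of an elementary tensor in `I^{⊗a}` under a surjective based map:
products, which lie in `I`, of the entries over the preimages of `1, …, q`. -/
def idealRule (ε : A →ₐ[k] k) {a b : GammaSurj} (f : a ⟶ b) (y : Fin a.obj.n → augIdeal ε)
    (j : Fin b.obj.n) : augIdeal ε :=
  ⟨fibProd (fun i : Fin a.obj.n => f.hom.toFun i.succ) j.succ fun i => (y i : A),
    fibProd_mem ε _ _ (GammaSurj.exists_succ f j) y⟩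

section LodayIdeal

variable (ε : A →ₐ[k] k) (M : Type u) [AddCommGroup M] [Module k M]

/-- The map `I^{⊗n} ⊗ M → A^{⊗n} ⊗ M` induced by the inclusion of `I` in `A`. -/
noncomputable def idealIncl (n : ℕ) :
    ((⨂[k] _ : Fin n, augIdeal ε) ⊗[k] M) →ₗ[k] ((⨂[k] _ : Fin n, A) ⊗[k] M) :=
  TensorProduct.map (PiTensorProduct.map fun _ : Fin n => (idealData ε).incl) LinearMap.id

theorem idealIncl_tmul (n : ℕ) (y : Fin n → augIdeal ε) (m : M) :
    idealIncl ε M n (PiTensorProduct.tprod k y ⊗ₜ m) =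
      PiTensorProduct.tprod k (fun i => (y i : A)) ⊗ₜ[k] m := by
  rw [idealIncl, TensorProduct.map_tmul, PiTensorProduct.map_tprod]
  rfl

variable [Module A M] [IsScalarTower k A M]

/-- The map `I^{⊗p} ⊗ M → I^{⊗q} ⊗ M` induced by a surjective based map `f : [p] → [q]`. -/
noncomputable def lodayIdealMap {a b : GammaSurj} (f : a ⟶ b) :
    ((⨂[k] _ : Fin a.obj.n, augIdeal ε) ⊗[k] M) →ₗ[k]
      ((⨂[k] _ : Fin b.obj.n, augIdeal ε) ⊗[k] M) :=
  (idealData ε).basedMap M (fun i => f.hom.toFun i.succ) (idealRule ε f) (fun _ _ => rfl)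

theorem lodayIdealMap_tmul {a b : GammaSurj} (f : a ⟶ b) (y : Fin a.obj.n → augIdeal ε) (m : M) :
    lodayIdealMap ε M f (PiTensorProduct.tprod k y ⊗ₜ m) =
      PiTensorProduct.tprod k (idealRule ε f y) ⊗ₜ[k]
        (fibProd (fun i : Fin a.obj.n => f.hom.toFun i.succ) 0 (fun i => (y i : A)) • m) :=
  (idealData ε).basedMap_tmul M _ _ _ y m

/-- The analogue `[n] ↦ I^{⊗n} ⊗ M` of the Loday functor for the augmentation ideal, on the
surjective based maps. -/
noncomputable def lodayIdeal : GammaSurj ⥤ ModuleCat.{u} k where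
  obj a := ModuleCat.of k ((⨂[k] _ : Fin a.obj.n, augIdeal ε) ⊗[k] M)
  map f := ModuleCat.ofHom (lodayIdealMap ε M f)
  map_id a := by
    ext1
    refine tensor_ext fun y m => (lodayIdealMap_tmul ε M (𝟙 a) y m).trans ?_
    have h1 : idealRule ε (𝟙 a) y = y :=
      funext fun j => Subtype.ext (fibProd_succ (fun i => (y i : A)) j)
    have h2 : fibProd (fun i : Fin a.obj.n => GammaCat.Hom.toFun (𝟙 a : a ⟶ a).hom i.succ) 0
      (fun i => (y i : A)) = 1 := fibProd_succ_zero fun i => (y i : A)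
    rw [h1, h2, one_smul]
    rfl
  map_comp {a b c} f g := by
    ext1
    refine tensor_ext fun y m => (lodayIdealMap_tmul ε M (f ≫ g) y m).trans ?_
    change _ = lodayIdealMap ε M g (lodayIdealMap ε M f (PiTensorProduct.tprod k y ⊗ₜ m))
    rw [lodayIdealMap_tmul, lodayIdealMap_tmul]
    have hg : g.hom.toFun 0 = 0 := g.hom.map_zero
    have h (l : Fin (c.obj.n + 1)) :=
      fibProd_comp (fun i : Fin a.obj.n => f.hom.toFun i.succ) g.hom.toFun l fun i => (y i : A)
    have h1 : idealRule ε (f ≫ g) y = idealRule ε g (idealRule ε f y) := by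
      funext j
      apply Subtype.ext
      refine (h j.succ).trans ?_
      rw [hg, if_neg (Fin.succ_ne_zero j).symm, one_mul]
      rfl
    have h2 : fibProd (fun i : Fin a.obj.n => (f ≫ g).hom.toFun i.succ) 0
          (fun i => (y i : A)) =
        fibProd (fun i : Fin b.obj.n => g.hom.toFun i.succ) 0
          (fun j => (idealRule ε f y j : A)) *
          fibProd (fun i : Fin a.obj.n => f.hom.toFun i.succ) 0 (fun i => (y i : A)) := by
      refine (h 0).trans ?_
      rw [hg, if_pos rfl, mul_comm]
      rfl
    rw [h1, h2, mul_smul]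

/-- The inclusions `I^{⊗n} ⊗ M → A^{⊗n} ⊗ M`, as a natural transformation. -/
noncomputable def lodayIncl :
    lodayIdeal ε M ⟶ wideSubcategoryInclusion gammaSurj ⋙ loday k A M where
  app a := ModuleCat.ofHom (idealIncl ε M a.obj.n)
  naturality {a b} f := by
    ext1
    refine tensor_ext fun y m => ?_
    change idealIncl ε M b.obj.n (lodayIdealMap ε M f (PiTensorProduct.tprod k y ⊗ₜ m)) =
      lodayMap k A M f.hom (idealIncl ε M a.obj.n (PiTensorProduct.tprod k y ⊗ₜ m))
    rw [lodayIdealMap_tmul, idealIncl_tmul, idealIncl_tmul, lodayMap_tmul]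
    rfl

end LodayIdeal

/-- The product in `A` of the entries of a tuple in `I` over the preimage of `j` under a morphism
`(φ, g)` of `EpiΔS`, in the order prescribed by `φ` and `g`. -/
def symProd (ε : A →ₐ[k] k) {a b : EpiDeltaS} (f : a ⟶ b) (y : Fin a.obj.card → augIdeal ε)
    (j : Fin b.obj.card) : A :=
  (((Finset.univ.filter fun i => f.hom.mono i = j).sort (· ≤ ·)).map
    fun i => (y (f.hom.perm.symm i) : A)).prod

theorem symProd_eq (ε : A →ₐ[k] k) {a b : EpiDeltaS} (f : a ⟶ b) (y : Fin a.obj.card → augIdeal ε)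
    (j : Fin b.obj.card) :
    symProd ε f y j = fibProd (DeltaS.Hom.toFun f.hom) j fun i => (y i : A) := by
  rw [symProd, ← Multiset.prod_coe, ← Multiset.map_coe, Finset.sort_eq]
  change ∏ i with f.hom.mono i = j, (y (f.hom.perm.symm i) : A) = _
  rw [fibProd, Finset.prod_filter, Finset.prod_filter, ← Equiv.prod_comp f.hom.perm]
  simp only [Equiv.symm_apply_apply]
  rfl

/-- The entries of `B_I^{sym}(φ, g)(y₁ ⊗ ⋯ ⊗ yₙ)`. -/
def symRule (ε : A →ₐ[k] k) {a b : EpiDeltaS} (f : a ⟶ b) (y : Fin a.obj.card → augIdeal ε)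
    (j : Fin b.obj.card) : augIdeal ε :=
  ⟨symProd ε f y j, by
    rw [symProd_eq]; exact fibProd_mem ε _ _ (EpiDeltaS.surjective f j) y⟩

theorem symRule_eq (ε : A →ₐ[k] k) {a b : EpiDeltaS} (f : a ⟶ b) (y : Fin a.obj.card → augIdeal ε)
    (j : Fin b.obj.card) :
    (symRule ε f y j : A) = fibProd (DeltaS.Hom.toFun f.hom) j fun i => (y i : A) :=
  symProd_eq ε f y j

/-- The map `B_I^{sym}(φ, g) : I^{⊗a} → I^{⊗b}`. -/
noncomputable def symMap (ε : A →ₐ[k] k) {a b : EpiDeltaS} (f : a ⟶ b) :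
    (⨂[k] _ : Fin a.obj.card, augIdeal ε) →ₗ[k] (⨂[k] _ : Fin b.obj.card, augIdeal ε) :=
  (idealData ε).tensorMap (DeltaS.Hom.toFun f.hom) (symRule ε f) (symRule_eq ε f)

theorem symMap_tprod (ε : A →ₐ[k] k) {a b : EpiDeltaS} (f : a ⟶ b)
    (y : Fin a.obj.card → augIdeal ε) :
    symMap ε f (PiTensorProduct.tprod k y) = PiTensorProduct.tprod k (symRule ε f y) :=
  (idealData ε).tensorMap_tprod _ _ _ y

/-- The symmetric bar construction `B_I^{sym} : EpiΔS → k-Mod`, `n ↦ I^{⊗n}`. -/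
noncomputable def symBar (ε : A →ₐ[k] k) : EpiDeltaS ⥤ ModuleCat.{u} k where
  obj a := ModuleCat.of k (⨂[k] _ : Fin a.obj.card, augIdeal ε)
  map f := ModuleCat.ofHom (symMap ε f)
  map_id a := by
    ext1
    refine PiTensorProduct.ext (MultilinearMap.ext fun y => ?_)
    refine (symMap_tprod ε (𝟙 a) y).trans ?_
    refine congrArg (PiTensorProduct.tprod k) (funext fun j => Subtype.ext ?_)
    exact (symRule_eq ε (𝟙 a) y j).trans (fibProd_id (fun i => (y i : A)) j)
  map_comp {a b c} f g := by
    ext1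
    refine PiTensorProduct.ext (MultilinearMap.ext fun y => ?_)
    change symMap ε (f ≫ g) (PiTensorProduct.tprod k y) =
      symMap ε g (symMap ε f (PiTensorProduct.tprod k y))
    rw [symMap_tprod, symMap_tprod, symMap_tprod]
    refine congrArg (PiTensorProduct.tprod k) (funext fun j => Subtype.ext ?_)
    rw [symRule_eq, symRule_eq]
    have h : DeltaS.Hom.toFun (f ≫ g).hom = DeltaS.Hom.toFun g.hom ∘ DeltaS.Hom.toFun f.hom :=
      DeltaS.comp_toFun f.hom g.hom
    rw [h, fibProd_comp']
    exact congrArg (fibProd (DeltaS.Hom.toFun g.hom) j) (funext fun i => (symRule_eq ε f y i).symm)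

end Tensor

/-! ### Quotient complexes, normalized complexes and the comparison map -/

section Complexes

variable {k : Type u} [CommRing k]

/-- The quotient of a chain complex of `k`-modules by a subcomplex. -/
noncomputable def quotComplex (K : ChainComplex (ModuleCat.{u} k) ℕ)
    (p : ∀ n, Submodule k (K.X n)) (hp : ∀ i j, p i ≤ (p j).comap (K.d i j).hom) :
    ChainComplex (ModuleCat.{u} k) ℕ where
  X n := ModuleCat.of k (K.X n ⧸ p n)
  d i j := ModuleCat.ofHom (Submodule.mapQ _ _ (K.d i j).hom (hp i j))
  shape i j h := by
    ext1
    refine Submodule.linearMap_qext _ (LinearMap.ext fun x => ?_)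
    have h0 := K.shape i j h
    simp [h0]
  d_comp_d' i j l _ _ := by
    ext1
    refine Submodule.linearMap_qext _ (LinearMap.ext fun x => ?_)
    have h0 := congrArg (fun f => f.hom x) (K.d_comp_d i j l)
    change Submodule.Quotient.mk ((K.d j l).hom ((K.d i j).hom x)) = 0
    rw [show (K.d j l).hom ((K.d i j).hom x) = 0 from h0, Submodule.Quotient.mk_zero]

/-- The projection onto a quotient complex. -/
noncomputable def quotComplexπ (K : ChainComplex (ModuleCat.{u} k) ℕ)
    (p : ∀ n, Submodule k (K.X n)) (hp : ∀ i j, p i ≤ (p j).comap (K.d i j).hom) :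
    K ⟶ quotComplex K p hp where
  f n := ModuleCat.ofHom (p n).mkQ

/-- The map out of a quotient complex induced by a map which vanishes on the subcomplex. -/
noncomputable def quotComplexDesc (K : ChainComplex (ModuleCat.{u} k) ℕ)
    (p : ∀ n, Submodule k (K.X n)) (hp : ∀ i j, p i ≤ (p j).comap (K.d i j).hom)
    {L : ChainComplex (ModuleCat.{u} k) ℕ} (f : K ⟶ L)
    (hf : ∀ n, p n ≤ LinearMap.ker (f.f n).hom) : quotComplex K p hp ⟶ L where
  f n := ModuleCat.ofHom ((p n).liftQ (f.f n).hom (hf n))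
  comm' i j _ := by
    ext1
    refine Submodule.linearMap_qext _ (LinearMap.ext fun x => ?_)
    exact congrArg (fun g => g.hom x) (f.comm i j)

/-- The chain complex of a simplicial module, with the alternating sum of the face maps as
boundary map. -/
noncomputable abbrev chains (X : SimplicialObject (ModuleCat.{u} k)) :
    ChainComplex (ModuleCat.{u} k) ℕ :=
  (AlgebraicTopology.alternatingFaceMapComplex _).obj X

/-- The submodule of a simplicial module generated by the degenerate elements. -/
noncomputable def degenerate (X : SimplicialObject (ModuleCat.{u} k)) :
    (n : ℕ) → Submodule k ((chains X).X n)
  | 0 => ⊥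
  | n + 1 => ⨆ i : Fin (n + 1), LinearMap.range (X.σ i).hom

theorem degenerate_eq_ker (X : SimplicialObject (ModuleCat.{u} k)) (n : ℕ) :
    degenerate X n =
      LinearMap.ker ((AlgebraicTopology.DoldKan.PInfty (X := X)).f n).hom := by
  apply le_antisymm
  · cases n with
    | zero => exact bot_le
    | succ n =>
      refine iSup_le fun i => ?_
      rintro _ ⟨x, rfl⟩
      exact congrArg (fun g => g.hom x) (AlgebraicTopology.DoldKan.σ_comp_PInfty X i)
  · intro x hx
    have h := congrArg (fun g => g.hom x)
      (AlgebraicTopology.DoldKan.PInfty_f_add_QInfty_f (X := X) n)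
    have h' : ((AlgebraicTopology.DoldKan.PInfty (X := X)).f n).hom x +
      ((AlgebraicTopology.DoldKan.QInfty (X := X)).f n).hom x = x := h
    rw [show ((AlgebraicTopology.DoldKan.PInfty (X := X)).f n).hom x = 0 from hx, zero_add] at h'
    rw [← h']
    cases n with
    | zero =>
      rw [AlgebraicTopology.DoldKan.QInfty_f_0]
      exact Submodule.zero_mem _
    | succ n =>
      rw [AlgebraicTopology.DoldKan.QInfty_f, AlgebraicTopology.DoldKan.decomposition_Q,
        ModuleCat.hom_sum, LinearMap.sum_apply]
      refine Submodule.sum_mem _ fun i _ => ?_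
      exact Submodule.mem_iSup_of_mem (Fin.rev i) ⟨_, rfl⟩

theorem degenerate_le (X : SimplicialObject (ModuleCat.{u} k)) (i j : ℕ) :
    degenerate X i ≤ (degenerate X j).comap
      ((chains X).d i j).hom := by
  rw [degenerate_eq_ker, degenerate_eq_ker]
  intro x hx
  have h := congrArg (fun g => g.hom x) ((AlgebraicTopology.DoldKan.PInfty (X := X)).comm i j)
  refine Eq.trans h.symm ?_
  change ((chains X).d i j).hom
    (((AlgebraicTopology.DoldKan.PInfty (X := X)).f i).hom x) = 0
  rw [show ((AlgebraicTopology.DoldKan.PInfty (X := X)).f i).hom x = 0 from hx, map_zero]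

/-- The normalized chain complex of a simplicial module: the quotient of its chain complex by the
subcomplex generated by the degenerate elements. -/
noncomputable def normalized (X : SimplicialObject (ModuleCat.{u} k)) :
    ChainComplex (ModuleCat.{u} k) ℕ :=
  quotComplex (chains X) (degenerate X) (degenerate_le X)

/-- The projection of the chain complex of a simplicial module onto the normalized one. -/
noncomputable def normalizedπ (X : SimplicialObject (ModuleCat.{u} k)) :
    chains X ⟶ normalized X :=
  quotComplexπ _ _ _

theorem normalizedπ_degenerate (X : SimplicialObject (ModuleCat.{u} k)) (n : ℕ)
    {x : (chains X).X n} (hx : x ∈ degenerate X n) : ((normalizedπ X).f n).hom x = 0 :=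
  (Submodule.Quotient.mk_eq_zero _).2 hx

/-- Functoriality of the normalized chain complex. -/
noncomputable def normalizedMap {X Y : SimplicialObject (ModuleCat.{u} k)} (f : X ⟶ Y) :
    normalized X ⟶ normalized Y :=
  quotComplexDesc _ _ _ ((AlgebraicTopology.alternatingFaceMapComplex _).map f ≫ normalizedπ Y) <| by
    intro n
    cases n with
    | zero => exact bot_le
    | succ n =>
      refine iSup_le fun i => ?_
      rintro _ ⟨x, rfl⟩
      refine normalizedπ_degenerate Y (n + 1) (Submodule.mem_iSup_of_mem i ⟨(f.app _).hom x, ?_⟩)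
      exact (congrArg (fun g => g.hom x) (SimplicialObject.σ_naturality f i)).symm

variable {A : Type u} [CommRing A] [Algebra k A] (ε : A →ₐ[k] k)

/-- `CS_*(I) = C_*(EpiΔS, B_I^{sym})`. -/
noncomputable def CS : SimplicialObject (ModuleCat.{u} k) := gzComplex (symBar ε)

/-- `CΓ_*(A, M)`. -/
noncomputable def CGamma (k A M : Type u) [CommRing k] [CommRing A] [Algebra k A] [AddCommGroup M]
    [Module k M] [Module A M] [IsScalarTower k A M] : SimplicialObject (ModuleCat.{u} k) :=
  rwComplex (wideSubcategoryInclusion gammaSurj ⋙ loday k A M)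

/-- `CΓ_*(I, M)`. -/
noncomputable def CGammaIdeal (M : Type u) [AddCommGroup M]
    [Module k M] [Module A M] [IsScalarTower k A M] : SimplicialObject (ModuleCat.{u} k) :=
  rwComplex (lodayIdeal ε M)

/-- The inclusion of `CΓ_*(I, M)` in `CΓ_*(A, M)`. -/
noncomputable def CGammaIncl (M : Type u) [AddCommGroup M]
    [Module k M] [Module A M] [IsScalarTower k A M] : CGammaIdeal ε M ⟶ CGamma k A M :=
  rwComplexMap (lodayIncl ε M)

/-- The submodule of `CSₙ(I)` generated by the strings whose last object has more than one
element. -/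
noncomputable def lastNeOne (n : ℕ) :
    Submodule k (⨁ s : Fin (n + 1) ⥤ EpiDeltaS, (symBar ε).obj (s.obj 0)) :=
  ⨆ s : {s : Fin (n + 1) ⥤ EpiDeltaS // (s.obj (Fin.last n)).obj.card ≠ 1},
    LinearMap.range (DirectSum.lof k (Fin (n + 1) ⥤ EpiDeltaS)
      (fun s => (symBar ε).obj (s.obj 0)) s.1)

theorem EpiDeltaS.card_ne_one {a b : EpiDeltaS} (f : a ⟶ b) (h : b.obj.card ≠ 1) :
    a.obj.card ≠ 1 := by
  intro ha
  have h1 := Fintype.card_le_of_surjective _ (EpiDeltaS.surjective f)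
  simp only [Fintype.card_fin] at h1
  have := b.obj.pos
  omega

theorem gzOp_lastNeOne {m n : SimplexCategory} (θ : m ⟶ n) :
    lastNeOne ε n.len ≤ (lastNeOne ε m.len).comap (gzOp (symBar ε) θ) := by
  refine iSup_le ?_
  rintro ⟨s, hs⟩
  rintro _ ⟨x, rfl⟩
  rw [Submodule.mem_comap, gzOp_lof (symBar ε) θ s x]
  exact Submodule.mem_iSup_of_mem (p := fun s : {s : Fin (m.len + 1) ⥤ EpiDeltaS //
      (s.obj (Fin.last m.len)).obj.card ≠ 1} =>
    LinearMap.range (DirectSum.lof k (Fin (m.len + 1) ⥤ EpiDeltaS)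
      (fun s => (symBar ε).obj (s.obj 0)) s.1)) ⟨pull θ s, EpiDeltaS.card_ne_one
    (s.map (homOfLE (Fin.le_last (θ.toOrderHom (Fin.last m.len))))) hs⟩ ⟨_, rfl⟩

/-- The submodule `lastNeOne`, in the chain complex `CS_*(I)`. -/
noncomputable def CSOne (n : ℕ) : Submodule k ((chains (CS ε)).X n) := lastNeOne ε n

theorem CSOne_le (i j : ℕ) : CSOne ε i ≤ (CSOne ε j).comap ((chains (CS ε)).d i j).hom := by
  intro x hx
  rw [Submodule.mem_comap]
  by_cases hij : j + 1 = i
  · subst hij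
    rw [AlgebraicTopology.alternatingFaceMapComplex_obj_d]
    rw [AlgebraicTopology.AlternatingFaceMapComplex.objD, ModuleCat.hom_sum, LinearMap.sum_apply]
    refine Submodule.sum_mem _ fun l _ => ?_
    rw [ModuleCat.hom_zsmul, LinearMap.smul_apply]
    have h : ((CS ε).δ l).hom x ∈ CSOne ε j := gzOp_lastNeOne ε (SimplexCategory.δ l) hx
    exact zsmul_mem h _
  · have h := (chains (CS ε)).shape i j hij
    rw [h]
    exact Submodule.zero_mem _

/-- `NCS_*(I)`. -/
noncomputable abbrev NCS : ChainComplex (ModuleCat.{u} k) ℕ := normalized (CS ε)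

/-- `NCS¹_*(I)`: the subcomplex of `NCS_*(I)` generated by the classes of the strings whose last
object has more than one element. -/
noncomputable def NCSOne (n : ℕ) : Submodule k ((NCS ε).X n) :=
  (CSOne ε n).map ((normalizedπ (CS ε)).f n).hom

theorem NCSOne_le (i j : ℕ) : NCSOne ε i ≤ (NCSOne ε j).comap ((NCS ε).d i j).hom := by
  rintro _ ⟨x, hx, rfl⟩
  exact ⟨_, CSOne_le ε i j hx, congrArg (fun g => g.hom x) ((normalizedπ (CS ε)).comm i j).symm⟩

/-- The quotient of `NCS_*(I)` by `NCS¹_*(I)`. -/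
noncomputable def NCSBar : ChainComplex (ModuleCat.{u} k) ℕ :=
  quotComplex (NCS ε) (NCSOne ε) (NCSOne_le ε)

/-- The quotient map `q`. -/
noncomputable def q : NCS ε ⟶ NCSBar ε := quotComplexπ _ _ _

/-- `NCΓ_*(I, k)`. -/
noncomputable abbrev NCGamma : ChainComplex (ModuleCat.{u} k) ℕ :=
  normalized (CGammaIdeal ε (Triv ε))

/-- The element `1_k` of `k`. -/
def unitTriv : Triv ε := (1 : k)

/-- The map `x ↦ x ⊗ 1_k`. -/
noncomputable def tmulOne (n : ℕ) :
    (⨂[k] _ : Fin n, augIdeal ε) →ₗ[k] ((⨂[k] _ : Fin n, augIdeal ε) ⊗[k] Triv ε) :=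
  (TensorProduct.mk k _ (Triv ε)).flip (unitTriv ε)

theorem fibProd_comp_succ {a b : ℕ} (f : Fin a → Fin b) (j : Fin b) (y : Fin a → A) :
    fibProd (fun i => (f i).succ) j.succ y = fibProd f j y := by
  simp only [fibProd, Fin.succ_inj]

theorem lodayIdealMap_addBase {a b : EpiDeltaS} (f : a ⟶ b)
    (x : ⨂[k] _ : Fin a.obj.card, augIdeal ε) :
    lodayIdealMap ε (Triv ε) (addBase.map (forgetU.map f)) (tmulOne ε a.obj.card x) =
      tmulOne ε b.obj.card (symMap ε f x) := by
  have h : (lodayIdealMap ε (Triv ε) (addBase.map (forgetU.map f))) ∘ₗ tmulOne ε a.obj.card =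
      tmulOne ε b.obj.card ∘ₗ symMap ε f := by
    refine PiTensorProduct.ext (MultilinearMap.ext fun y => ?_)
    refine (lodayIdealMap_tmul ε (Triv ε) (addBase.map (forgetU.map f)) y _).trans ?_
    change _ = tmulOne ε b.obj.card (symMap ε f (PiTensorProduct.tprod k y))
    rw [symMap_tprod]
    have h1 : idealRule ε (addBase.map (forgetU.map f)) y = symRule ε f y := by
      funext j
      apply Subtype.ext
      refine Eq.trans ?_ (symRule_eq ε f y j).symm
      exact fibProd_comp_succ (DeltaS.Hom.toFun f.hom) j fun i => (y i : A)
    have h2 : fibProd (fun i : Fin a.obj.card =>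
        (addBase.map (forgetU.map f)).hom.toFun i.succ) 0 (fun i => (y i : A)) = 1 := by
      refine Finset.prod_eq_one fun i hi => ?_
      exact absurd (Finset.mem_filter.1 hi).2 (Fin.succ_ne_zero _)
    exact congrArg₂ (fun (u : Fin b.obj.card → augIdeal ε) (v : Triv ε) =>
      PiTensorProduct.tprod k u ⊗ₜ[k] v) h1 ((congrArg (fun c : A => c • unitTriv ε) h2).trans
        (one_smul A (unitTriv ε)))
  exact congrArg (fun g => g x) h

/-- The string in `NΩₙ(-, 1)` underlying a string in `EpiΔS` that ends in the one-element set. -/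
def forgetStr {n : ℕ} (s : Fin (n + 1) ⥤ EpiDeltaS) (h : (s.obj (Fin.last n)).obj.card = 1) :
    Str n :=
  ⟨s ⋙ forgetU, h⟩

/-- The map `CSₙ(I) → CΓₙ(I, k)` which sends the generator given by a string `(fₙ, …, f₁)` in
`EpiΔS` and `y₁ ⊗ ⋯ ⊗ yₓ` to `[U(fₙ) | ⋯ | U(f₁)] ⊗ (y₁ ⊗ ⋯ ⊗ yₓ) ⊗ 1_k` if the last object of the
string is the one-element set, and to zero otherwise. -/
noncomputable def phiLinear (n : ℕ) :
    (⨁ s : Fin (n + 1) ⥤ EpiDeltaS, (symBar ε).obj (s.obj 0)) →ₗ[k]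
      (⨁ s : Str n, (lodayIdeal ε (Triv ε)).obj (addBase.obj (s.1.obj 0))) :=
  DirectSum.toModule k _ _ fun s =>
    if h : (s.obj (Fin.last n)).obj.card = 1 then
      DirectSum.lof k (Str n) (fun s => (lodayIdeal ε (Triv ε)).obj (addBase.obj (s.1.obj 0)))
        (forgetStr s h) ∘ₗ tmulOne ε (s.obj 0).obj.card
    else 0

theorem phiLinear_lof {n : ℕ} (s : Fin (n + 1) ⥤ EpiDeltaS)
    (h : (s.obj (Fin.last n)).obj.card = 1) (x : (symBar ε).obj (s.obj 0)) :
    phiLinear ε n (DirectSum.lof k (Fin (n + 1) ⥤ EpiDeltaS)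
        (fun s => (symBar ε).obj (s.obj 0)) s x) =
      DirectSum.lof k (Str n) (fun s => (lodayIdeal ε (Triv ε)).obj (addBase.obj (s.1.obj 0)))
        (forgetStr s h) (tmulOne ε (s.obj 0).obj.card x) := by
  rw [phiLinear, DirectSum.toModule_lof, dif_pos h]; rfl

theorem phiLinear_lof_ne {n : ℕ} (s : Fin (n + 1) ⥤ EpiDeltaS)
    (h : (s.obj (Fin.last n)).obj.card ≠ 1) (x : (symBar ε).obj (s.obj 0)) :
    phiLinear ε n (DirectSum.lof k (Fin (n + 1) ⥤ EpiDeltaS)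
        (fun s => (symBar ε).obj (s.obj 0)) s x) = 0 := by
  rw [phiLinear, DirectSum.toModule_lof, dif_neg h]; rfl

theorem rwTerm_eq_zero {m n : SimplexCategory} (θ : m ⟶ n) (s : Str n.len)
    (i i' : Fin (s.1.obj (θ.toOrderHom (Fin.last m.len))).card) (hi : i' ≠ i)
    (x : ⨂[k] _ : Fin (s.1.obj 0).card, augIdeal ε) :
    rwTerm (lodayIdeal ε (Triv ε)) θ s i (tmulOne ε _ x) = 0 := by
  have h : rwTerm (lodayIdeal ε (Triv ε)) θ s i ∘ₗ tmulOne ε (s.1.obj 0).card = 0 := by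
    refine PiTensorProduct.ext (MultilinearMap.ext fun y => ?_)
    set f := addBase.map (toStart θ s.1) ≫ collapse (pull θ s.1) i with hf
    have h0 : lodayIdealMap ε (Triv ε) f
        (PiTensorProduct.tprod k y ⊗ₜ[k] unitTriv ε) = 0 := by
      rw [lodayIdealMap_tmul]
      obtain ⟨p, hp⟩ := (toStart θ s.1 ≫ toLast (pull θ s.1) 0).surj i'
      have hp0 : f.hom.toFun p.succ = 0 := by
        rcases Fin.eq_zero_or_eq_succ (f.hom.toFun p.succ) with h | ⟨c, h⟩
        · exact h
        · exfalso
          have h1 := (collapseFun_iff (pull θ s.1) i ((toStart θ s.1).toFun p) c).1 h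
          have h2 := fibEmb_mem (pull θ s.1) i 0 c
          rw [h1] at h2
          exact hi (hp.symm.trans h2)
      have hmem := fibProd_mem ε (fun i : Fin (s.1.obj 0).card => f.hom.toFun i.succ) 0
        ⟨p, hp0⟩ y
      have hz : (fibProd (fun i : Fin (s.1.obj 0).card => f.hom.toFun i.succ) 0
          (fun i => (y i : A))) • unitTriv ε = 0 := by
        rw [Triv.smul_def, (RingHom.mem_ker).1 hmem]
        exact zero_smul k (unitTriv ε)
      exact (congrArg _ hz).trans (TensorProduct.tmul_zero _ _)
    exact (congrArg (DirectSum.lof k (Str m.len)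
      (fun s => (lodayIdeal ε (Triv ε)).obj (addBase.obj (s.1.obj 0)))
      (componentStr (pull θ s.1) i)) h0).trans (map_zero _)
  exact congrArg (fun g => g x) h

theorem phiLinear_naturality {m n : SimplexCategory} (θ : m ⟶ n) :
    phiLinear ε m.len ∘ₗ gzOp (symBar ε) θ =
      rwOp (lodayIdeal ε (Triv ε)) θ ∘ₗ phiLinear ε n.len := by
  refine DirectSum.linearMap_ext k fun s => LinearMap.ext fun x => ?_
  refine (congrArg (phiLinear ε m.len) (gzOp_lof (symBar ε) θ s x)).trans ?_
  by_cases hs : (s.obj (Fin.last n.len)).obj.card = 1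
  · refine Eq.trans ?_ (congrArg (rwOp (lodayIdeal ε (Triv ε)) θ) (phiLinear_lof ε s hs x)).symm
    refine Eq.trans ?_ (rwOp_lof (lodayIdeal ε (Triv ε)) θ (forgetStr s hs) _).symm
    by_cases hm : (s.obj (θ.toOrderHom (Fin.last m.len))).obj.card = 1
    · have huniq : ∀ i i' : Fin (s.obj (θ.toOrderHom (Fin.last m.len))).obj.card, i = i' := by
        rw [hm]; exact fun i i' => Subsingleton.elim _ _
      let i₀ : Fin (s.obj (θ.toOrderHom (Fin.last m.len))).obj.card := ⟨0, by rw [hm]; exact one_pos⟩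
      refine Eq.trans ?_ (Fintype.sum_eq_single (M := ⨁ s : Str m.len,
        (lodayIdeal ε (Triv ε)).obj (addBase.obj (s.1.obj 0)))
        i₀ fun i hi => absurd (huniq i i₀) hi).symm
      refine (phiLinear_lof ε (pull θ s) hm _).trans ?_
      have e : tmulOne ε (s.obj (θ.toOrderHom 0)).obj.card (symMap ε (toStart θ s) x) =
          ((lodayIdeal ε (Triv ε)).map (addBase.map (forgetU.map (toStart θ s)))).hom
            (tmulOne ε (s.obj 0).obj.card x) :=
        (lodayIdealMap_addBase ε (toStart θ s) x).symm
      refine (congrArg (DirectSum.lof k (Str m.len)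
        (fun s => (lodayIdeal ε (Triv ε)).obj (addBase.obj (s.1.obj 0)))
        (forgetStr (pull θ s) hm)) e).trans ?_
      refine lof_unique (lodayIdeal ε (Triv ε)) (t := pull θ (s ⋙ forgetU))
        (fun j => RelEmbedding.refl _) (fun j => fibEmb (pull θ (s ⋙ forgetU)) i₀ j) ?_ ?_ ?_ _ _
        (toStart θ (s ⋙ forgetU)).toFun ?_ ?_ _
      · intro j
        refine Eq.trans ?_ (range_fibEmb (pull θ (s ⋙ forgetU)) i₀ j).symm
        ext p
        exact ⟨fun _ => huniq _ _, fun _ => ⟨p, rfl⟩⟩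
      · intro j j' f p
        rfl
      · intro j j' f p
        exact fibEmb_compMap (pull θ (s ⋙ forgetU)) i₀ f p
      · intro p q
        exact (Fin.succ_injective _).eq_iff.trans eq_comm
      · intro p q
        exact collapseFun_iff (pull θ (s ⋙ forgetU)) i₀ _ q
    · refine (phiLinear_lof_ne ε (pull θ s) hm _).trans ?_
      symm
      refine Finset.sum_eq_zero fun i _ => ?_
      have hpos := (s.obj (θ.toOrderHom (Fin.last m.len))).obj.pos
      have hnt : Nontrivial (Fin (s.obj (θ.toOrderHom (Fin.last m.len))).obj.card) :=
        Fin.nontrivial_iff_two_le.2 (by omega)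
      obtain ⟨i', hi'⟩ := @exists_ne _ hnt i
      exact rwTerm_eq_zero ε θ (forgetStr s hs) i i' hi' x
  · refine Eq.trans ?_ (congrArg (rwOp (lodayIdeal ε (Triv ε)) θ)
      (phiLinear_lof_ne ε s hs x)).symm
    refine Eq.trans ?_ (map_zero (rwOp (lodayIdeal ε (Triv ε)) θ)).symm
    exact phiLinear_lof_ne ε (pull θ s) (EpiDeltaS.card_ne_one
      (s.map (homOfLE (Fin.le_last (θ.toOrderHom (Fin.last m.len))))) hs) _

/-- The maps `phiLinear`, as a map of simplicial modules. -/
noncomputable def phiSimplicial : CS ε ⟶ CGammaIdeal ε (Triv ε) where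
  app Δ := ModuleCat.ofHom (phiLinear ε Δ.unop.len)
  naturality {Δ Δ'} θ := by
    ext1
    exact phiLinear_naturality ε θ.unop

theorem phiLinear_CSOne (n : ℕ) : lastNeOne ε n ≤ LinearMap.ker (phiLinear ε n) := by
  refine iSup_le ?_
  rintro ⟨s, hs⟩ _ ⟨x, rfl⟩
  exact phiLinear_lof_ne ε s hs x

/-- The map `Φ : NCS_*(I) / NCS¹_*(I) → NCΓ_*(I, k)`, which sends the class of
`((fₙ, …, f₁), y₁ ⊗ ⋯ ⊗ yₓ)` to that of `[U(fₙ) | ⋯ | U(f₁)] ⊗ (y₁ ⊗ ⋯ ⊗ yₓ) ⊗ 1_k`. -/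
noncomputable def Phi : NCSBar ε ⟶ NCGamma ε :=
  quotComplexDesc _ _ _ (normalizedMap (phiSimplicial ε)) <| by
    rintro n _ ⟨x, hx, rfl⟩
    have h : phiLinear ε n x = 0 := phiLinear_CSOne ε n hx
    exact (congrArg ((normalizedπ (CGammaIdeal ε (Triv ε))).f n).hom h).trans (map_zero _)

/-- The reduced symmetric homology of `A`: the homology of `CS_*(I)`. -/
noncomputable def HSReduced (n : ℕ) : ModuleCat.{u} k := (chains (CS ε)).homology n

/-- `HΓₙ(I, k)`: the homology of `CΓ_*(I, k)`. -/
noncomputable def HGammaIdeal (n : ℕ) : ModuleCat.{u} k :=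
  (chains (CGammaIdeal ε (Triv ε))).homology n

end Complexes

/-! ### `Tor` functors and `Γ`-homology -/

section Tor

variable {k : Type u} [CommRing k] {C : Type} [Category.{0} C]

/-- The set-valued functor `e ↦ {(d, x, h) | x ∈ G(d), h : d → e}`. -/
def elementsCover (G : C ⥤ ModuleCat.{u} k) : C ⥤ Type u where
  obj e := Σ d : C, (G.obj d) × (d ⟶ e)
  map f := ↾fun z => ⟨z.1, z.2.1, z.2.2 ≫ f⟩
  map_id e := by
    refine ConcreteCategory.hom_ext _ _ fun z => ?_
    exact congrArg (fun h => (⟨z.1, z.2.1, h⟩ : Σ d : C, (G.obj d) × (d ⟶ e)))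
      (Category.comp_id z.2.2)
  map_comp {e e' e''} f g := by
    refine ConcreteCategory.hom_ext _ _ fun z => ?_
    exact congrArg (fun h => (⟨z.1, z.2.1, h⟩ : Σ d : C, (G.obj d) × (d ⟶ e'')))
      (Category.assoc z.2.2 f g).symm

theorem elementsCover_map (G : C ⥤ ModuleCat.{u} k) {d e e' : C} (x : G.obj d) (h : d ⟶ e)
    (f : e ⟶ e') : (elementsCover G).map f ⟨d, x, h⟩ = ⟨d, x, h ≫ f⟩ := rfl

/-- A map out of `elementsCover G` given by a family of elements. -/
def elementsDesc (G : C ⥤ ModuleCat.{u} k) (X : C ⥤ ModuleCat.{u} k)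
    (z : ∀ d, G.obj d → X.obj d) : elementsCover G ⟶ X ⋙ forget (ModuleCat.{u} k) where
  app e := ↾fun w => (X.map w.2.2).hom (z w.1 w.2.1)
  naturality {e e'} f := by
    ext w
    exact congrArg (fun g => g.hom (z w.1 w.2.1)) (X.map_comp w.2.2 f)

theorem exists_elementsDesc (G X : C ⥤ ModuleCat.{u} k)
    (α : elementsCover G ⟶ X ⋙ forget (ModuleCat.{u} k)) :
    ∃ z, α = elementsDesc G X z := by
  refine ⟨fun d x => α.app d ⟨d, x, 𝟙 d⟩, ?_⟩
  ext e w
  obtain ⟨d, x, h⟩ := w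
  have h1 := congrArg (fun g => g (⟨d, x, 𝟙 d⟩ : Σ d' : C, (G.obj d') × (d' ⟶ d)))
    (α.naturality h)
  refine Eq.trans ?_ h1
  change α.app e ⟨d, x, h⟩ = α.app e ⟨d, x, 𝟙 d ≫ h⟩
  rw [Category.id_comp]

/-- The free functor on `elementsCover G`. -/
noncomputable def freeCover (G : C ⥤ ModuleCat.{u} k) : C ⥤ ModuleCat.{u} k :=
  elementsCover G ⋙ ModuleCat.free k

/-- Maps out of `freeCover G` are maps of set-valued functors out of `elementsCover G`. -/
noncomputable def freeCoverEquiv (G X : C ⥤ ModuleCat.{u} k) :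
    (freeCover G ⟶ X) ≃ (elementsCover G ⟶ X ⋙ forget (ModuleCat.{u} k)) :=
  ((ModuleCat.adj k).whiskerRight C).homEquiv (elementsCover G) X

instance (G : C ⥤ ModuleCat.{u} k) : Projective (freeCover G) where
  factors {X Y} f e he := by
    obtain ⟨z, hz⟩ := exists_elementsDesc G Y (freeCoverEquiv G Y f)
    have hsurj : ∀ d, Function.Surjective (X.map (𝟙 d) ≫ e.app d).hom := by
      intro d
      rw [X.map_id, Category.id_comp]
      exact (ModuleCat.epi_iff_surjective _).1 inferInstance
    choose w hw using fun d (x : G.obj d) => hsurj d (z d x)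
    refine ⟨(freeCoverEquiv G X).symm (elementsDesc G X w), ?_⟩
    apply (freeCoverEquiv G Y).injective
    rw [hz]
    have h := ((ModuleCat.adj k).whiskerRight C).homEquiv_naturality_right
      ((freeCoverEquiv G X).symm (elementsDesc G X w)) e
    refine h.trans ?_
    have h2 : ((ModuleCat.adj k).whiskerRight C).homEquiv (elementsCover G) X
      ((freeCoverEquiv G X).symm (elementsDesc G X w)) = elementsDesc G X w :=
      (freeCoverEquiv G X).apply_symm_apply _
    rw [h2]
    ext c v
    obtain ⟨d, x, l⟩ := v
    have h3 := congrArg (fun g => g.hom (w d x)) (e.naturality l)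
    refine Eq.trans h3 ?_
    change (Y.map l).hom ((e.app d).hom (w d x)) = (Y.map l).hom (z d x)
    rw [← hw d x, X.map_id, Category.id_comp]

instance : EnoughProjectives (C ⥤ ModuleCat.{u} k) where
  presentation G := ⟨{
    p := freeCover G
    f := (freeCoverEquiv G G).symm (elementsDesc G G fun _ x => x)
    projective := inferInstance
    epi := by
      rw [NatTrans.epi_iff_epi_app]
      intro d
      rw [ModuleCat.epi_iff_surjective]
      intro x
      have h := (freeCoverEquiv G G).apply_symm_apply (elementsDesc G G fun _ x => x)
      have h1 := congrArg (fun α => α.app d ⟨d, x, 𝟙 d⟩) h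
      have h2 : (elementsDesc G G fun _ x => x).app d ⟨d, x, 𝟙 d⟩ = x :=
        congrArg (fun g => g.hom x) (G.map_id d)
      exact ⟨_, h1.trans h2⟩ }⟩

section TensorOver

variable (F : C ⥤ ModuleCat.{u} k)

noncomputable local instance : DecidableEq C := Classical.decEq _

/-- The relations `G(α)(x) ⊗ y = x ⊗ F(α)(y)` in the direct sum of the `G(c) ⊗ F(c)`. -/
noncomputable def tensorRel (G : Cᵒᵖ ⥤ ModuleCat.{u} k) :
    Submodule k (⨁ c : C, G.obj (Opposite.op c) ⊗[k] F.obj c) :=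
  Submodule.span k {z | ∃ (c c' : C) (α : c ⟶ c') (x : G.obj (Opposite.op c')) (y : F.obj c),
    z = DirectSum.lof k C (fun c => G.obj (Opposite.op c) ⊗[k] F.obj c) c
          ((G.map α.op).hom x ⊗ₜ[k] y) -
        DirectSum.lof k C (fun c => G.obj (Opposite.op c) ⊗[k] F.obj c) c'
          (x ⊗ₜ[k] (F.map α).hom y)}

/-- The map of direct sums induced by a map of right modules. -/
noncomputable def tensorLin {G G' : Cᵒᵖ ⥤ ModuleCat.{u} k} (Θ : G ⟶ G') :
    (⨁ c : C, G.obj (Opposite.op c) ⊗[k] F.obj c) →ₗ[k]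
      (⨁ c : C, G'.obj (Opposite.op c) ⊗[k] F.obj c) :=
  DirectSum.lmap fun c => (Θ.app (Opposite.op c)).hom.rTensor (F.obj c)

theorem tensorLin_lof {G G' : Cᵒᵖ ⥤ ModuleCat.{u} k} (Θ : G ⟶ G') (c : C)
    (x : G.obj (Opposite.op c)) (y : F.obj c) :
    tensorLin F Θ (DirectSum.lof k C (fun c => G.obj (Opposite.op c) ⊗[k] F.obj c) c
        (x ⊗ₜ[k] y)) =
      DirectSum.lof k C (fun c => G'.obj (Opposite.op c) ⊗[k] F.obj c) c
        ((Θ.app (Opposite.op c)).hom x ⊗ₜ[k] y) := by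
  rw [tensorLin, DirectSum.lmap_lof, LinearMap.rTensor_tmul]

theorem tensorRel_le {G G' : Cᵒᵖ ⥤ ModuleCat.{u} k} (Θ : G ⟶ G') :
    tensorRel F G ≤ (tensorRel F G').comap (tensorLin F Θ) := by
  refine Submodule.span_le.2 ?_
  rintro _ ⟨c, c', α, x, y, rfl⟩
  refine Submodule.subset_span ⟨c, c', α, (Θ.app (Opposite.op c')).hom x, y, ?_⟩
  rw [map_sub, tensorLin_lof, tensorLin_lof]
  have h : (Θ.app (Opposite.op c)).hom ((G.map α.op).hom x) =
      (G'.map α.op).hom ((Θ.app (Opposite.op c')).hom x) :=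
    congrArg (fun g => g.hom x) (Θ.naturality α.op)
  rw [h]

theorem tensor_hom_ext {G : Cᵒᵖ ⥤ ModuleCat.{u} k} {N : Type u} [AddCommGroup N] [Module k N]
    {f g : ((⨁ c : C, G.obj (Opposite.op c) ⊗[k] F.obj c) ⧸ tensorRel F G) →ₗ[k] N}
    (h : ∀ (c : C) (x : G.obj (Opposite.op c)) (y : F.obj c),
      f (Submodule.Quotient.mk (DirectSum.lof k C
        (fun c => G.obj (Opposite.op c) ⊗[k] F.obj c) c (x ⊗ₜ[k] y))) =
      g (Submodule.Quotient.mk (DirectSum.lof k C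
        (fun c => G.obj (Opposite.op c) ⊗[k] F.obj c) c (x ⊗ₜ[k] y)))) : f = g :=
  Submodule.linearMap_qext _ (DirectSum.linearMap_ext k fun c =>
    TensorProduct.ext' fun x y => h c x y)

/-- The functor `- ⊗_C F` from right `C`-modules to `k`-modules. -/
noncomputable def tensorOver : (Cᵒᵖ ⥤ ModuleCat.{u} k) ⥤ ModuleCat.{u} k where
  obj G := ModuleCat.of k ((⨁ c : C, G.obj (Opposite.op c) ⊗[k] F.obj c) ⧸ tensorRel F G)
  map Θ := ModuleCat.ofHom (Submodule.mapQ _ _ (tensorLin F Θ) (tensorRel_le F Θ))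
  map_id G := by
    ext1
    refine tensor_hom_ext F fun c x y => ?_
    exact congrArg Submodule.Quotient.mk (tensorLin_lof F (𝟙 G) c x y)
  map_comp {G G' G''} Θ Θ' := by
    ext1
    refine tensor_hom_ext F fun c x y => ?_
    refine (congrArg Submodule.Quotient.mk (tensorLin_lof F (Θ ≫ Θ') c x y)).trans ?_
    exact congrArg Submodule.Quotient.mk ((congrArg (tensorLin F Θ')
      (tensorLin_lof F Θ c x y)).trans (tensorLin_lof F Θ' c _ y)).symm

instance : (tensorOver F).Additive where
  map_add {G G'} {Θ Θ'} := by
    have h : tensorLin F (Θ + Θ') = tensorLin F Θ + tensorLin F Θ' := by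
      refine DirectSum.linearMap_ext k fun c => TensorProduct.ext' fun x y => ?_
      refine (tensorLin_lof F (Θ + Θ') c x y).trans ?_
      refine Eq.trans ?_ (congrArg₂ (· + ·) (tensorLin_lof F Θ c x y)
        (tensorLin_lof F Θ' c x y)).symm
      rw [← map_add, ← TensorProduct.add_tmul]
      rfl
    ext1
    refine Submodule.linearMap_qext _ (LinearMap.ext fun v => ?_)
    exact congrArg (fun g => Submodule.Quotient.mk (p := tensorRel F G') (g v)) h

/-- `Torₙ^C(G, F)`: the value at `G` of the `n`-th left derived functor of `- ⊗_C F`.  (The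
bifunctor `- ⊗_C -` is balanced: deriving the other variable gives the same modules.) -/
noncomputable def torOver (n : ℕ) (G : Cᵒᵖ ⥤ ModuleCat.{u} k) : ModuleCat.{u} k :=
  ((tensorOver F).leftDerived n).obj G

end TensorOver

/-- The based `k`-cochain functor `t = Hom_{Set_*}(-, k)`, a right `Γ`-module. -/
noncomputable def cochains (k : Type u) [CommRing k] : GammaCatᵒᵖ ⥤ ModuleCat.{u} k where
  obj a := ModuleCat.of k (LinearMap.ker (LinearMap.proj (R := k) (φ := fun _ => k)
    (0 : Fin (a.unop.n + 1))))
  map {a b} f := ModuleCat.ofHom ((LinearMap.funLeft k k f.unop.toFun).restrict (by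
    intro v hv
    have h0 : v 0 = 0 := hv
    change v (f.unop.toFun 0) = 0
    rw [f.unop.map_zero, h0]))

/-- The `Γ`-homology `HΓₙ(F) = Torₙ^Γ(t, F)` of a left `Γ`-module. -/
noncomputable def HGammaOf (F : GammaCat ⥤ ModuleCat.{u} k) (n : ℕ) : ModuleCat.{u} k :=
  torOver F n (cochains k)

/-- The `Γ`-homology `HΓₙ(A, M)` of a commutative algebra `A` with coefficients in `M`. -/
noncomputable def HGamma (k A M : Type u) [CommRing k] [CommRing A] [Algebra k A] [AddCommGroup M]
    [Module k M] [Module A M] [IsScalarTower k A M] (n : ℕ) : ModuleCat.{u} k :=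
  HGammaOf (loday k A M) n

end Tor

end GammaSym

/-! Parts 1 and 2 are formal once `Φ ∘ q` is known to be surjective. Every surjection of finite sets
underlies a morphism of `EpiΔS`, since its fibres can be ordered; strings lift arrow by arrow
(`exists_lift`), and `I^{⊗n} ⊗ k` consists of the elements `x ⊗ 1`. The kernel of the Dold-Kan
projector is exactly the submodule of degenerate elements, so the projection onto a normalized
complex is a homotopy equivalence, and the long exact homology sequence can be transported along it.

The substance is part 3, which rests on two constructions.

(a) `H_n(CΓ_*(A, k))` is a `Tor`. For a based set `[m]` take the Robinson-Whitehouse complex of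
`k[Γ([m], -)]`. Letting `m` vary gives a complex of right `Γ`-modules which in degree `n` is the
direct sum, over the strings `s`, of the representables `k[Γ(-, [s₀])]`. Its terms are therefore
projective, and by the Yoneda lemma tensoring it with a left module `F` returns the
Robinson-Whitehouse complex of `F`. It is augmented to `t` by sending `(s, γ)` to the indicator
function of the points not sent to the basepoint by `γ`. What remains is exactness. View `(s, γ)` as
a string of surjections with up to `m` marked points in its first set. On an initial segment of the
string, replace each set `X` by `X ⊔ X ⊔ {marks present}` and move the marks to the third summand.
This is a family of operators over the simplices of the interval, hence a homotopy. At one end it is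
the identity. At the other end it is twice the map forgetting all marks, plus, for each mark
present, a constant one-point string carrying that mark. For `m = 0` this says `id ≃ 2 · id`, so the
complex is acyclic; that is the purpose of the second copy of `X`. For general `m` the forgetful map
factors through `m = 0` and so sends cycles to boundaries. A cycle is thus homologous to a
combination of constant strings with coefficients given by its augmentation, and such strings are
controlled by parity (`exists_boundary_succ`, `exists_boundary_zero`).

(b) `CΓ_*(I, k)` is a simplicial retract of `CΓ_*(A, k)`. From `A = k ⊕ I` one gets `A^{⊗X} = ⨁_S
I^{⊗S}`, over the subsets `S` of `X`. The retraction sends the summand of a nonempty `S ⊆ s₀` to the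
generator on the string of images of `S`, and the summand of the empty set to zero. It commutes with
all simplicial operators because a factor from `I` acts by zero on `k` and a factor `1` projects to
zero in `I` (`retractOp_rwOp`). -/

namespace GammaSym

/-! ### Representable functors and generators of their Robinson-Whitehouse modules -/

section Representable

variable (k : Type u) [CommRing k]

/-- The representable functor `k[Γ([m], -)]`. -/
noncomputable def repr (m : GammaCat) : GammaCat ⥤ ModuleCat.{u} k where
  obj b := ModuleCat.of k ((m ⟶ b) →₀ k)
  map f := ModuleCat.ofHom (Finsupp.lmapDomain k k fun g => g ≫ f)
  map_id b := by
    ext1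
    refine Finsupp.lhom_ext fun g c => ?_
    exact (Finsupp.mapDomain_single).trans (congrArg (Finsupp.single · c) (Category.comp_id g))
  map_comp f f' := by
    ext1
    refine Finsupp.lhom_ext fun g c => ?_
    refine (Finsupp.mapDomain_single).trans ?_
    refine Eq.trans ?_ ((congrArg (Finsupp.mapDomain (fun g => g ≫ f'))
      Finsupp.mapDomain_single).trans Finsupp.mapDomain_single).symm
    exact congrArg (Finsupp.single · c) (Category.assoc g f f').symm

/-- The restriction of `k[Γ([m], -)]` to the surjective based maps. -/
noncomputable abbrev reprSurj (m : GammaCat) : GammaSurj ⥤ ModuleCat.{u} k :=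
  wideSubcategoryInclusion gammaSurj ⋙ repr k m

/-- The generator of the Robinson-Whitehouse module of `k[Γ([m], -)]` given by a string and a based
map from `[m]` to its first object. -/
noncomputable def basisElt {m : GammaCat} {n : ℕ} (s : Str n) (γ : m ⟶ (⟨(s.1.obj 0).card⟩ : GammaCat)) :
    ⨁ s : Str n, (reprSurj k m).obj (addBase.obj (s.1.obj 0)) :=
  DirectSum.lof k (Str n) (fun s => (reprSurj k m).obj (addBase.obj (s.1.obj 0))) s
    (Finsupp.single γ 1)

variable {k}

theorem basis_hom_ext {m : GammaCat} {n : ℕ} {N : Type u} [AddCommGroup N] [Module k N]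
    {f g : (⨁ s : Str n, (reprSurj k m).obj (addBase.obj (s.1.obj 0))) →ₗ[k] N}
    (h : ∀ s γ, f (basisElt k s γ) = g (basisElt k s γ)) : f = g :=
  DirectSum.linearMap_ext k fun s => Finsupp.lhom_ext' fun γ => LinearMap.ext_ring (h s γ)

/-- A based map is determined by the part of its graph that avoids the basepoint of the target.
Based maps are compared below only through such relations. -/
theorem GammaCat.hom_eq_of_succ {m b : GammaCat} {γ γ' : m ⟶ b}
    (h : ∀ (c : Fin m.n) (q : Fin b.n), γ.toFun c.succ = q.succ ↔ γ'.toFun c.succ = q.succ) :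
    γ = γ' := by
  ext1
  funext c
  refine Fin.cases (γ.map_zero.trans γ'.map_zero.symm) (fun c => ?_) c
  rcases Fin.eq_zero_or_eq_succ (γ.toFun c.succ) with h0 | ⟨q, hq⟩
  · rcases Fin.eq_zero_or_eq_succ (γ'.toFun c.succ) with h0' | ⟨q, hq⟩
    · rw [h0, h0']
    · exact ((h c q).2 hq).trans hq.symm
  · exact hq.trans ((h c q).1 hq).symm

/-- Two strings with points, embedded with the same image, define the same generator. -/
theorem basisElt_unique {m : GammaCat} {n : ℕ} {s s' : Str n}
    {Y : Fin (n + 1) → Type} [∀ j, LinearOrder (Y j)]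
    (ψ : ∀ {j j'}, (j ⟶ j') → Y j → Y j')
    (e : ∀ j, Fin (s.1.obj j).card ↪o Y j) (e' : ∀ j, Fin (s'.1.obj j).card ↪o Y j)
    (hr : ∀ j, Set.range (e j) = Set.range (e' j))
    (he : ∀ {j j'} (f : j ⟶ j') p, e j' ((s.1.map f).toFun p) = ψ f (e j p))
    (he' : ∀ {j j'} (f : j ⟶ j') p, e' j' ((s'.1.map f).toFun p) = ψ f (e' j p))
    {γ : m ⟶ (⟨(s.1.obj 0).card⟩ : GammaCat)} {γ' : m ⟶ (⟨(s'.1.obj 0).card⟩ : GammaCat)}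
    (hγ : ∀ (c : Fin m.n) q q', e 0 q = e' 0 q' →
      (γ.toFun c.succ = Fin.succ q ↔ γ'.toFun c.succ = Fin.succ q')) :
    basisElt k s γ = basisElt k s' γ' := by
  obtain ⟨⟨o, mp, hid, hcomp⟩, hs⟩ := s
  obtain ⟨⟨o', mp', hid', hcomp'⟩, hs'⟩ := s'
  -- Equal images force equal cardinalities, hence equal objects of `Ω`. An increasing embedding is
  -- determined by its image, so the embeddings then agree, and they determine the maps and the
  -- based map.
  have ho : o = o' := by
    funext j
    apply Omega.ext
    have h1 := Nat.card_range_of_injective (e j).injective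
    have h2 := Nat.card_range_of_injective (e' j).injective
    rw [hr j] at h1
    simpa using h1.symm.trans h2
  subst ho
  have hee : e = e' := by
    funext j
    exact OrderEmbedding.range_inj.1 (hr j)
  subst hee
  have hmp : @mp = @mp' := by
    funext j j' f
    ext1; funext p
    apply (e j').injective
    exact (he f p).trans (he' f p).symm
  subst hmp
  have h : γ = γ' := GammaCat.hom_eq_of_succ fun c q => hγ c q q rfl
  subst h
  rfl

end Representable

/-! ### Strings of ordered sets with marked points -/

/-- A string of surjections between finite subsets of linearly ordered sets, with `m` marked points
in its first set, each of which may be absent. -/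
structure PStr (m n : ℕ) (Y : Fin (n + 1) → Type) [∀ j, LinearOrder (Y j)] : Type where
  W : ∀ j, Finset (Y j)
  ψ : ∀ {j j'}, j ≤ j' → Y j → Y j'
  g : Fin m → ∀ j, Option (Y j)
  ne : ∀ j, (W j).Nonempty
  maps : ∀ {j j'} (h : j ≤ j') y, y ∈ W j → ψ h y ∈ W j'
  surj : ∀ {j j'} (h : j ≤ j') y', y' ∈ W j' → ∃ y ∈ W j, ψ h y = y'
  ψ_id : ∀ j y, y ∈ W j → ψ (le_refl j) y = y
  ψ_comp : ∀ {j j' j''} (h : j ≤ j') (h' : j' ≤ j'') y, y ∈ W j →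
    ψ h' (ψ h y) = ψ (h.trans h') y
  g_mem : ∀ c j y, g c j = some y → y ∈ W j
  g_map : ∀ c {j j'} (h : j ≤ j'), g c j' = (g c j).map (ψ h)

namespace PStr

variable {m n : ℕ} {Y : Fin (n + 1) → Type} [∀ j, LinearOrder (Y j)]

section Basic

variable (S : PStr m n Y)

/-- The increasing indexing of the `j`-th set of a string. -/
def emb (j : Fin (n + 1)) : Fin (S.W j).card ↪o Y j := (S.W j).orderEmbOfFin rfl

/-- The index of an element of the `j`-th set of a string. -/
def idx (j : Fin (n + 1)) (y : Y j) (h : y ∈ S.W j) : Fin (S.W j).card :=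
  ((S.W j).orderIsoOfFin rfl).symm ⟨y, h⟩

theorem emb_mem (j : Fin (n + 1)) (p : Fin (S.W j).card) : S.emb j p ∈ S.W j :=
  Finset.orderEmbOfFin_mem _ _ _

theorem emb_idx (j : Fin (n + 1)) (y : Y j) (h : y ∈ S.W j) : S.emb j (S.idx j y h) = y := by
  rw [emb, idx, ← Finset.coe_orderIsoOfFin_apply, OrderIso.apply_symm_apply]

theorem idx_eq_iff (j : Fin (n + 1)) (y : Y j) (h : y ∈ S.W j) (p : Fin (S.W j).card) :
    S.idx j y h = p ↔ y = S.emb j p := by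
  rw [← (S.emb j).injective.eq_iff, emb_idx]

theorem range_emb (j : Fin (n + 1)) : Set.range (S.emb j) = S.W j :=
  Finset.range_orderEmbOfFin _ _

/-- The string of `Ω` underlying a string of ordered sets. -/
abbrev str : Fin (n + 1) ⥤ Omega where
  obj j := ⟨(S.W j).card, Finset.card_pos.2 (S.ne j)⟩
  map {j j'} f := ⟨fun p => S.idx j' (S.ψ (leOfHom f) (S.emb j p)) (S.maps _ _ (S.emb_mem j p)), by
    intro q
    obtain ⟨y, hy, h⟩ := S.surj (leOfHom f) _ (S.emb_mem j' q)
    refine ⟨S.idx j y hy, (S.idx_eq_iff _ _ _ _).2 ?_⟩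
    rw [emb_idx, h]⟩
  map_id j := by
    ext1; funext p
    exact (S.idx_eq_iff _ _ _ _).2 (S.ψ_id _ _ (S.emb_mem j p))
  map_comp {j j' j''} f f' := by
    ext1; funext p
    refine (S.idx_eq_iff _ _ _ _).2 ?_
    refine Eq.trans ?_ (S.emb_idx _ _ _).symm
    rw [emb_idx]
    exact (S.ψ_comp _ _ _ (S.emb_mem j p)).symm

theorem emb_map {j j' : Fin (n + 1)} (f : j ⟶ j') (p : Fin (S.W j).card) :
    S.emb j' ((S.str.map f).toFun p) = S.ψ (leOfHom f) (S.emb j p) :=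
  S.emb_idx _ _ _

/-- The based map given by the marked points of a string. -/
def point : (⟨m⟩ : GammaCat) ⟶ (⟨(S.W 0).card⟩ : GammaCat) :=
  ⟨Fin.cases 0 fun c => (S.g c 0).elim 0
    fun y => if h : y ∈ S.W 0 then (S.idx 0 y h).succ else 0, rfl⟩

theorem point_succ (c : Fin m) (q : Fin (S.W 0).card) :
    S.point.toFun c.succ = q.succ ↔ S.g c 0 = some (S.emb 0 q) := by
  have e : S.point.toFun c.succ = (S.g c 0).elim 0
    fun y => if h : y ∈ S.W 0 then (S.idx 0 y h).succ else 0 := rfl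
  rw [e]
  rcases h : S.g c 0 with _ | y
  · simp [(Fin.succ_ne_zero q).symm]
  · have hy := S.g_mem c 0 y h
    rw [Option.elim_some, dif_pos hy, Fin.succ_inj, idx_eq_iff, Option.some_inj]

/-- The string `S ∘ θ`. -/
@[simps] def pull {l : ℕ} (θ : Fin (l + 1) →o Fin (n + 1)) : PStr m l (fun j => Y (θ j)) where
  W j := S.W (θ j)
  ψ h := S.ψ (θ.monotone h)
  g c j := S.g c (θ j)
  ne _ := S.ne _
  maps _ := S.maps _
  surj _ := S.surj _
  ψ_id _ := S.ψ_id _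
  ψ_comp _ _ := S.ψ_comp _ _
  g_mem c _ := S.g_mem c _
  g_map c _ _ _ := S.g_map c _

theorem g_last_of_g (c : Fin m) (j : Fin (n + 1)) (y : Y j) (h : S.g c j = some y) :
    S.g c (Fin.last n) = some (S.ψ (Fin.le_last j) y) := by
  rw [S.g_map c (Fin.le_last j), h, Option.map_some]

/-- The component of a string over an element `i` of its last set. -/
@[simps] def comp (i : Y (Fin.last n)) (hi : i ∈ S.W (Fin.last n)) : PStr m n Y where
  W j := (S.W j).filter fun y => S.ψ (Fin.le_last j) y = i
  ψ h := S.ψ h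
  -- A mark stays in the component over `i` exactly when it is carried to `i`. Testing this in the
  -- last set makes the condition independent of `j`, so compatibility with the maps is inherited.
  g c j := if S.g c (Fin.last n) = some i then S.g c j else none
  ne j := by
    obtain ⟨y, hy, h⟩ := S.surj (Fin.le_last j) i hi
    exact ⟨y, Finset.mem_filter.2 ⟨hy, h⟩⟩
  maps {j j'} h y hy := by
    rw [Finset.mem_filter] at hy ⊢
    exact ⟨S.maps h y hy.1, (S.ψ_comp _ _ _ hy.1).trans hy.2⟩
  surj {j j'} h y' hy' := by
    rw [Finset.mem_filter] at hy'
    obtain ⟨y, hy, e⟩ := S.surj h y' hy'.1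
    refine ⟨y, Finset.mem_filter.2 ⟨hy, ?_⟩, e⟩
    rw [← hy'.2, ← e, S.ψ_comp _ _ _ hy]
  ψ_id j y hy := S.ψ_id j y (Finset.mem_filter.1 hy).1
  ψ_comp h h' y hy := S.ψ_comp h h' y (Finset.mem_filter.1 hy).1
  g_mem c j y h := by
    split_ifs at h with hc
    refine Finset.mem_filter.2 ⟨S.g_mem c j y h, ?_⟩
    rw [S.g_last_of_g c j y h] at hc
    exact Option.some_inj.1 hc
  g_map c {j j'} h := by
    split_ifs
    · exact S.g_map c h
    · rfl

theorem comp_last (i : Y (Fin.last n)) (hi : i ∈ S.W (Fin.last n)) :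
    (S.comp i hi).W (Fin.last n) = {i} := by
  ext y
  rw [comp_W, Finset.mem_filter, Finset.mem_singleton]
  constructor
  · rintro ⟨hy, h⟩
    rwa [S.ψ_id _ _ hy] at h
  · rintro rfl
    exact ⟨hi, S.ψ_id _ _ hi⟩

variable (k : Type u) [CommRing k]

open Classical in
/-- The generator given by a string whose last set has one element. -/
noncomputable def gen : ⨁ s : Str n, (reprSurj k ⟨m⟩).obj (addBase.obj (s.1.obj 0)) :=
  -- The value 0 is a default; components always have a one-element last set.
  if h : (S.W (Fin.last n)).card = 1 then basisElt k ⟨S.str, h⟩ S.point else 0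

/-- The sum of the generators given by the components of a string. -/
noncomputable def total : ⨁ s : Str n, (reprSurj k ⟨m⟩).obj (addBase.obj (s.1.obj 0)) :=
  ∑ i ∈ (S.W (Fin.last n)).attach, (S.comp i.1 i.2).gen k

end Basic

/-- An isomorphism of strings of ordered sets with marked points. -/
structure Equiv {Y' : Fin (n + 1) → Type} [∀ j, LinearOrder (Y' j)] (S : PStr m n Y)
    (S' : PStr m n Y') : Type where
  f : ∀ j, Y j → Y' j
  mono : ∀ j, StrictMonoOn (f j) (S.W j)
  image : ∀ j y', y' ∈ S'.W j ↔ ∃ y ∈ S.W j, f j y = y'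
  ψ : ∀ {j j'} (h : j ≤ j') y, y ∈ S.W j → f j' (S.ψ h y) = S'.ψ h (f j y)
  g : ∀ c, S'.g c 0 = (S.g c 0).map (f 0)

namespace Equiv

variable {Y' : Fin (n + 1) → Type} [∀ j, LinearOrder (Y' j)] {S : PStr m n Y} {S' : PStr m n Y'}

theorem mem (E : Equiv S S') {j : Fin (n + 1)} {y : Y j} (h : y ∈ S.W j) : E.f j y ∈ S'.W j :=
  (E.image j _).2 ⟨y, h, rfl⟩

theorem g_all (E : Equiv S S') (c : Fin m) (j : Fin (n + 1)) :
    S'.g c j = (S.g c j).map (E.f j) := by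
  rw [S'.g_map c (Fin.zero_le j), S.g_map c (Fin.zero_le j), E.g c]
  rcases h : S.g c 0 with _ | y
  · rfl
  · simp only [Option.map_some]
    rw [E.ψ _ _ (S.g_mem c 0 y h)]

theorem card_eq (E : Equiv S S') (j : Fin (n + 1)) : (S'.W j).card = (S.W j).card := by
  have : S'.W j = (S.W j).image (E.f j) := by
    ext y'
    rw [E.image, Finset.mem_image]
  rw [this, Finset.card_image_of_injOn (E.mono j).injOn]

/-- The underlying string in `Ω` is obtained by increasing indexing, which order isomorphisms
respect. Isomorphic strings therefore give equal generators, not merely isomorphic ones; this is why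
the ambient sets are linearly ordered. -/
theorem gen_eq (E : Equiv S S') (k : Type u) [CommRing k] : S.gen k = S'.gen k := by
  unfold gen
  by_cases h : (S.W (Fin.last n)).card = 1
  · have h' : (S'.W (Fin.last n)).card = 1 := (E.card_eq _).trans h
    rw [dif_pos h, dif_pos h']
    refine basisElt_unique (fun f => S'.ψ (leOfHom f))
      (fun j => OrderEmbedding.ofStrictMono (fun p => E.f j (S.emb j p))
        fun p p' hp => E.mono j (S.emb_mem j p) (S.emb_mem j p') ((S.emb j).strictMono hp))
      (fun j => S'.emb j) ?_ ?_ ?_ ?_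
    · intro j
      refine Eq.trans ?_ (S'.range_emb j).symm
      ext y'
      rw [Finset.mem_coe, E.image]
      constructor
      · rintro ⟨p, rfl⟩
        exact ⟨_, S.emb_mem j p, rfl⟩
      · rintro ⟨y, hy, rfl⟩
        exact ⟨S.idx j y hy, congrArg (E.f j) (S.emb_idx j y hy)⟩
    · intro j j' f p
      refine (congrArg (E.f j') (S.emb_map f p)).trans ?_
      exact E.ψ _ _ (S.emb_mem j p)
    · intro j j' f p
      exact S'.emb_map f p
    · intro c q q' hq
      refine (S.point_succ c q).trans (Iff.trans ?_ (S'.point_succ c q').symm)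
      rw [E.g c, ← show E.f 0 (S.emb 0 q) = S'.emb 0 q' from hq]
      rcases h : S.g c 0 with _ | y
      · simp
      · rw [Option.map_some, Option.some_inj, Option.some_inj]
        exact ((E.mono 0).injOn.eq_iff (S.g_mem c 0 y h) (S.emb_mem 0 q)).symm
  · have h' : ¬ (S'.W (Fin.last n)).card = 1 := fun h' => h ((E.card_eq _).symm.trans h')
    rw [dif_neg h, dif_neg h']

/-- The isomorphism of components induced by an isomorphism of strings. -/
def compEquiv (E : Equiv S S') (i : Y (Fin.last n)) (hi : i ∈ S.W (Fin.last n)) :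
    Equiv (S.comp i hi) (S'.comp (E.f _ i) (E.mem hi)) where
  f := E.f
  mono j := (E.mono j).mono (by
    intro y hy
    exact (Finset.mem_filter.1 hy).1)
  image j y' := by
    simp only [comp_W, Finset.mem_filter]
    rw [E.image]
    constructor
    · rintro ⟨⟨y, hy, rfl⟩, h⟩
      rw [← E.ψ _ _ hy] at h
      exact ⟨y, ⟨hy, (E.mono _).injOn (S.maps _ _ hy) hi h⟩, rfl⟩
    · rintro ⟨y, ⟨hy, rfl⟩, rfl⟩
      exact ⟨⟨y, hy, rfl⟩, (E.ψ _ _ hy).symm⟩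
  ψ h y hy := E.ψ h y (Finset.mem_filter.1 hy).1
  g c := by
    simp only [comp_g]
    rw [E.g_all c (Fin.last n), E.g c]
    rcases h : S.g c (Fin.last n) with _ | y
    · simp
    · have e := (E.mono _).injOn.eq_iff (S.g_mem c _ y h) hi
      by_cases hy : y = i
      · simp [hy]
      · simp [hy, e]

theorem total_eq (E : Equiv S S') (k : Type u) [CommRing k] : S.total k = S'.total k := by
  unfold total
  refine Finset.sum_bij (fun i _ => ⟨E.f _ i.1, E.mem i.2⟩) (fun _ _ => Finset.mem_attach _ _)
    ?_ ?_ ?_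
  · intro i _ i' _ h
    exact Subtype.ext ((E.mono _).injOn i.2 i'.2 (congrArg Subtype.val h))
  · rintro ⟨i', hi'⟩ _
    obtain ⟨i, hi, rfl⟩ := (E.image _ _).1 hi'
    exact ⟨⟨i, hi⟩, Finset.mem_attach _ _, rfl⟩
  · intro i _
    exact (E.compEquiv i.1 i.2).gen_eq k

/-- Strings with the same sets, maps and points are isomorphic. -/
def ofEq {S S' : PStr m n Y} (hW : ∀ j y, y ∈ S'.W j ↔ y ∈ S.W j)
    (hψ : ∀ {j j'} (h : j ≤ j') y, y ∈ S.W j → S.ψ h y = S'.ψ h y)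
    (hg : ∀ c, S'.g c 0 = S.g c 0) : Equiv S S' where
  f _ := id
  mono _ := strictMonoOn_id
  image j y := by
    rw [hW]
    exact ⟨fun h => ⟨y, h, rfl⟩, by rintro ⟨_, h, rfl⟩; exact h⟩
  ψ := hψ
  g c := by rw [hg, Option.map_id]; rfl

end Equiv

/-- Over a one-element last set there is only one component, and it contains every element and every
mark that is present. -/
theorem total_eq_gen (S : PStr m n Y) (k : Type u) [CommRing k]
    (h : (S.W (Fin.last n)).card = 1) : S.total k = S.gen k := by
  obtain ⟨i, hi⟩ := Finset.card_eq_one.1 h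
  have hmem : i ∈ S.W (Fin.last n) := by rw [hi]; exact Finset.mem_singleton_self i
  have huniq : ∀ y ∈ S.W (Fin.last n), y = i := fun y hy => by
    rw [hi] at hy; exact Finset.mem_singleton.1 hy
  refine (Finset.sum_eq_single (⟨i, hmem⟩ : {y // y ∈ S.W (Fin.last n)})
    (fun y _ hy => absurd (Subtype.ext (huniq y.1 y.2)) hy)
    fun hn => absurd (Finset.mem_attach _ _) hn).trans ?_
  refine (Equiv.ofEq ?_ ?_ ?_ : Equiv (S.comp i hmem) S).gen_eq k
  · intro j y
    rw [comp_W, Finset.mem_filter]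
    exact ⟨fun hy => ⟨hy, huniq _ (S.maps _ _ hy)⟩, fun hy => hy.1⟩
  · intro j j' _ y _
    rfl
  · intro c
    rw [comp_g]
    split_ifs with hc
    · rfl
    · rcases hg : S.g c 0 with _ | y
      · rfl
      · exact absurd ((S.g_last_of_g c 0 y hg).trans
          (congrArg some (huniq _ (S.maps _ _ (S.g_mem c 0 y hg))))) hc

/-- A sum over the components of the components of a string. -/
theorem sum_total {l : ℕ} {Y' : Fin (l + 1) → Type} [∀ j, LinearOrder (Y' j)]
    (S : PStr m n Y) (T : PStr m l Y') (k : Type u) [CommRing k]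
    (p : Y' (Fin.last l) → Y (Fin.last n))
    (hp : ∀ y ∈ T.W (Fin.last l), p y ∈ S.W (Fin.last n))
    (R : ∀ i, i ∈ S.W (Fin.last n) → PStr m l Y')
    (hW : ∀ i hi y, y ∈ (R i hi).W (Fin.last l) ↔ y ∈ T.W (Fin.last l) ∧ p y = i)
    (hR : ∀ i hi y (hy : y ∈ (R i hi).W (Fin.last l)) (hy' : y ∈ T.W (Fin.last l)),
      Nonempty (Equiv ((R i hi).comp y hy) (T.comp y hy'))) :
    ∑ i ∈ (S.W (Fin.last n)).attach, (R i.1 i.2).total k = T.total k := by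
  unfold total
  rw [Finset.sum_sigma']
  -- A pair of an index `i` and an element `y` of the last set of `R i` is the same as `y` alone,
  -- since `i = p y`.
  refine Finset.sum_bij (fun z _ => ⟨z.2.1, ((hW _ _ _).1 z.2.2).1⟩)
    (fun _ _ => Finset.mem_attach _ _) ?_ ?_ ?_
  · rintro ⟨⟨i, hi⟩, y, hy⟩ _ ⟨⟨i', hi'⟩, y', hy'⟩ _ h
    obtain rfl : y = y' := congrArg Subtype.val h
    obtain rfl : i = i' := ((hW _ _ _).1 hy).2.symm.trans ((hW _ _ _).1 hy').2
    rfl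
  · rintro ⟨y, hy⟩ _
    exact ⟨⟨⟨p y, hp y hy⟩, y, (hW _ _ _).2 ⟨hy, rfl⟩⟩, by simp, rfl⟩
  · rintro ⟨⟨i, hi⟩, y, hy⟩ _
    exact (hR i hi y hy _).some.gen_eq k

end PStr
end GammaSym

namespace GammaSym

namespace PStr

/-! ### Simplicial operators as sums over components of marked strings -/

section OfStr

variable {m n : ℕ}

/-- A string of `Ω` with a based map from `[m]` to its first object, as a string of ordered sets
with marked points. -/
@[simps] def ofStr (s : Fin (n + 1) ⥤ Omega) (γ : (⟨m⟩ : GammaCat) ⟶ (⟨(s.obj 0).card⟩ : GammaCat)) :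
    PStr m n (fun j => Fin (s.obj j).card) where
  W _ := Finset.univ
  ψ h := (s.map (homOfLE h)).toFun
  g c j := (finSuccEquiv _ (γ.toFun c.succ)).map (s.map (homOfLE (Fin.zero_le j))).toFun
  ne j := ⟨⟨0, (s.obj j).pos⟩, Finset.mem_univ _⟩
  maps _ _ _ := Finset.mem_univ _
  surj h y' _ := by
    obtain ⟨y, hy⟩ := (s.map (homOfLE h)).surj y'
    exact ⟨y, Finset.mem_univ _, hy⟩
  ψ_id j y _ := congrArg (fun f => Omega.Hom.toFun f y) (s.map_id j)
  ψ_comp h h' y _ := congrArg (fun f => Omega.Hom.toFun f y)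
    (s.map_comp (homOfLE h) (homOfLE h')).symm
  g_mem _ _ _ _ := Finset.mem_univ _
  g_map c {j j'} h := by
    rw [Option.map_map]
    exact congrArg (fun f => Option.map (Omega.Hom.toFun f) (finSuccEquiv _ (γ.toFun c.succ)))
      (s.map_comp (homOfLE (Fin.zero_le j)) (homOfLE h))

theorem ofStr_g_zero (s : Fin (n + 1) ⥤ Omega)
    (γ : (⟨m⟩ : GammaCat) ⟶ (⟨(s.obj 0).card⟩ : GammaCat)) (c : Fin m) :
    (ofStr s γ).g c 0 = finSuccEquiv _ (γ.toFun c.succ) := by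
  have h : (s.map (homOfLE (Fin.zero_le 0))).toFun = id :=
    congrArg Omega.Hom.toFun (s.map_id 0)
  rw [ofStr_g, h, Option.map_id]
  rfl

/-- The increasing indexing of all of `Fin a` is the identity, so passing to ordered sets and back
loses nothing. -/
theorem ofStr_gen (k : Type u) [CommRing k] (s : Str n)
    (γ : (⟨m⟩ : GammaCat) ⟶ (⟨(s.1.obj 0).card⟩ : GammaCat)) :
    (ofStr s.1 γ).gen k = basisElt k s γ := by
  have h : ((ofStr s.1 γ).W (Fin.last n)).card = 1 := by
    rw [ofStr_W, Finset.card_univ, Fintype.card_fin]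
    exact s.2
  rw [gen, dif_pos h]
  refine basisElt_unique (fun f => (s.1.map f).toFun) (fun j => (ofStr s.1 γ).emb j)
    (fun j => RelEmbedding.refl _) ?_ ?_ ?_ ?_
  · intro j
    refine ((ofStr s.1 γ).range_emb j).trans ?_
    ext p
    exact ⟨fun _ => ⟨p, rfl⟩, fun _ => Finset.mem_coe.2 (Finset.mem_univ p)⟩
  · intro j j' f p
    exact (ofStr s.1 γ).emb_map f p
  · intro j j' f p
    rfl
  · intro c q q' hq
    refine ((ofStr s.1 γ).point_succ c q).trans ?_
    rw [hq, ofStr_g_zero]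
    change _ = some q' ↔ _
    rw [← finSuccEquiv_succ, (finSuccEquiv _).injective.eq_iff]

theorem ofStr_total (k : Type u) [CommRing k] (s : Str n)
    (γ : (⟨m⟩ : GammaCat) ⟶ (⟨(s.1.obj 0).card⟩ : GammaCat)) :
    (ofStr s.1 γ).total k = basisElt k s γ := by
  rw [← ofStr_gen]
  refine total_eq_gen _ k ?_
  rw [ofStr_W, Finset.card_univ, Fintype.card_fin]
  exact s.2

/-- Both notions of component index the same preimages in increasing order, so the two strings sit
inside `t` with the same image. -/
theorem basisElt_component (k : Type u) [CommRing k] {l : ℕ} (t : Fin (l + 1) ⥤ Omega)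
    (i : Fin (t.obj (Fin.last l)).card)
    (T : PStr m l fun j => Fin (t.obj j).card)
    (hW : ∀ j p, p ∈ T.W j ↔ (toLast t j).toFun p = i)
    (hψ : ∀ {j j'} (h : j ≤ j') p, T.ψ h p = (t.map (homOfLE h)).toFun p)
    (γ : (⟨m⟩ : GammaCat) ⟶ (⟨(fib t i 0).card⟩ : GammaCat))
    (hγ : ∀ c q, γ.toFun c.succ = Fin.succ q ↔ T.g c 0 = some (fibEmb t i 0 q)) :
    basisElt k (componentStr t i) γ = T.gen k := by
  have hlast : ∀ p, p ∈ T.W (Fin.last l) ↔ p = i := by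
    intro p
    rw [hW, show toLast t (Fin.last l) = 𝟙 _ from t.map_id _]
    rfl
  have hc : (T.W (Fin.last l)).card = 1 := by
    rw [Finset.card_eq_one]
    refine ⟨i, ?_⟩
    ext p
    rw [hlast, Finset.mem_singleton]
  rw [gen, dif_pos hc]
  refine basisElt_unique (s := componentStr t i) (s' := ⟨T.str, hc⟩)
    (fun f => (t.map f).toFun) (fun j => fibEmb t i j) (fun j => T.emb j) ?_ ?_ ?_ ?_
  · intro j
    refine (range_fibEmb t i j).trans (Eq.trans ?_ (T.range_emb j).symm)
    ext p
    exact (hW j p).symm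
  · intro j j' f p
    exact fibEmb_compMap _ i f p
  · intro j j' f p
    exact (T.emb_map f p).trans (hψ _ _)
  · intro c q q' hq
    refine Iff.trans ?_ (T.point_succ c q').symm
    rw [← hq]
    exact hγ c q

theorem collapse_point {l : ℕ} (t : Fin (l + 1) ⥤ Omega) {a : Omega} (f : a ⟶ t.obj 0)
    (i : Fin (t.obj (Fin.last l)).card)
    (γ : (⟨m⟩ : GammaCat) ⟶ (⟨a.card⟩ : GammaCat)) (c : Fin m) (q : Fin (fib t i 0).card) :
    GammaCat.Hom.toFun (γ ≫ (addBase.map f ≫ collapse t i).hom) c.succ = q.succ ↔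
      ∃ p, γ.toFun c.succ = Fin.succ p ∧ f.toFun p = fibEmb t i 0 q := by
  have hx : GammaCat.Hom.toFun (γ ≫ (addBase.map f ≫ collapse t i).hom) c.succ =
      collapseFun t i ((addBase.map f).hom.toFun (γ.toFun c.succ)) := rfl
  rw [hx]
  rcases Fin.eq_zero_or_eq_succ (γ.toFun c.succ) with h0 | ⟨p, hp⟩
  · rw [h0]
    exact ⟨fun h => absurd h.symm (Fin.succ_ne_zero _),
      fun ⟨p, h, _⟩ => absurd h.symm (Fin.succ_ne_zero p)⟩
  · rw [hp]
    refine (collapseFun_iff t i (f.toFun p) q).trans ?_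
    constructor
    · intro h
      exact ⟨p, rfl, h.symm⟩
    · rintro ⟨p', hp', h⟩
      rw [← h, Fin.succ_injective _ hp']

theorem rwTerm_basisElt (k : Type u) [CommRing k] {l n : SimplexCategory} (θ : l ⟶ n)
    (s : Str n.len) (γ : (⟨m⟩ : GammaCat) ⟶ (⟨(s.1.obj 0).card⟩ : GammaCat))
    (i : Fin (s.1.obj (θ.toOrderHom (Fin.last l.len))).card)
    (hi : i ∈ ((ofStr s.1 γ).pull θ.toOrderHom).W (Fin.last l.len)) :
    rwTerm (reprSurj k ⟨m⟩) θ s i (Finsupp.single γ 1) =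
      (((ofStr s.1 γ).pull θ.toOrderHom).comp i hi).gen k := by
  have e : rwTerm (reprSurj k ⟨m⟩) θ s i (Finsupp.single γ 1) =
      basisElt k (componentStr (GammaSym.pull θ s.1) i)
        (γ ≫ (addBase.map (toStart θ s.1) ≫ collapse (GammaSym.pull θ s.1) i).hom) :=
    congrArg (DirectSum.lof k (Str l.len)
      (fun s => (reprSurj k ⟨m⟩).obj (addBase.obj (s.1.obj 0))) _) Finsupp.mapDomain_single
  have hg : ∀ c q, ((ofStr s.1 γ).pull θ.toOrderHom).g c 0 = some q ↔
      ∃ p, γ.toFun c.succ = Fin.succ p ∧ (toStart θ s.1).toFun p = q := by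
    intro c q
    refine Option.map_eq_some_iff.trans (exists_congr fun p => and_congr_left fun _ => ?_)
    rw [← finSuccEquiv_succ, (finSuccEquiv _).injective.eq_iff]
  refine e.trans (basisElt_component k (GammaSym.pull θ s.1) i
    (((ofStr s.1 γ).pull θ.toOrderHom).comp i hi) ?_ (fun _ _ => rfl) _ ?_)
  · intro j p
    exact Finset.mem_filter.trans ⟨fun h => h.2, fun h => ⟨Finset.mem_univ _, h⟩⟩
  · intro c q
    refine (collapse_point (GammaSym.pull θ s.1) (toStart θ s.1) i γ c q).trans ?_
    refine (hg c (fibEmb (GammaSym.pull θ s.1) i 0 q)).symm.trans ?_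
    rw [comp_g]
    constructor
    · intro h
      have hl := ((ofStr s.1 γ).pull θ.toOrderHom).g_last_of_g c 0 _ h
      rw [if_pos (hl.trans (congrArg some (fibEmb_mem (GammaSym.pull θ s.1) i 0 q)))]
      exact h
    · intro h
      split_ifs at h with h'
      exact h

/-- The dictionary between the two languages: the sum over `i` that defines the operator is the sum
over the components of the pulled back string. -/
theorem rwOp_basisElt (k : Type u) [CommRing k] {l n : SimplexCategory} (θ : l ⟶ n)
    (s : Str n.len) (γ : (⟨m⟩ : GammaCat) ⟶ (⟨(s.1.obj 0).card⟩ : GammaCat)) :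
    rwOp (reprSurj k ⟨m⟩) θ (basisElt k s γ) =
      ((ofStr s.1 γ).pull θ.toOrderHom).total k := by
  refine (rwOp_lof (reprSurj k ⟨m⟩) θ s _).trans ?_
  refine (Finset.sum_congr rfl fun i _ =>
    rwTerm_basisElt k θ s γ i (Finset.mem_univ i)).trans ?_
  exact (Finset.sum_attach Finset.univ fun i =>
    (((ofStr s.1 γ).pull θ.toOrderHom).comp i (Finset.mem_univ i)).gen k).symm

end OfStr

section Pull

variable {m n : ℕ} {Y : Fin (n + 1) → Type} [∀ j, LinearOrder (Y j)]

/-- A string of ordered sets is isomorphic to the underlying string of `Ω`. -/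
def strEquiv (S : PStr m n Y) : Equiv (ofStr S.str S.point) S where
  f j := S.emb j
  mono j := (S.emb j).strictMono.strictMonoOn _
  image j y' := by
    constructor
    · intro h
      exact ⟨S.idx j y' h, Finset.mem_univ _, S.emb_idx j y' h⟩
    · rintro ⟨p, -, rfl⟩
      exact S.emb_mem j p
  ψ h y _ := S.emb_map (homOfLE h) y
  g c := by
    rw [ofStr_g_zero]
    rcases Fin.eq_zero_or_eq_succ (S.point.toFun c.succ) with h0 | ⟨q, hq⟩
    · rw [h0, finSuccEquiv_zero]
      rcases h : S.g c 0 with _ | y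
      · rfl
      · have := (S.point_succ c (S.idx 0 y (S.g_mem c 0 y h))).2 (by rw [h, emb_idx])
        rw [h0] at this
        exact absurd this.symm (Fin.succ_ne_zero _)
    · rw [hq, finSuccEquiv_succ]
      exact (S.point_succ c q).1 hq

/-- The isomorphism of the composites with a monotone map. -/
def Equiv.pullEquiv {Y' : Fin (n + 1) → Type} [∀ j, LinearOrder (Y' j)] {S : PStr m n Y}
    {S' : PStr m n Y'} (E : Equiv S S') {l : ℕ} (θ : Fin (l + 1) →o Fin (n + 1)) :
    Equiv (S.pull θ) (S'.pull θ) where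
  f j := E.f (θ j)
  mono j := E.mono (θ j)
  image j := E.image (θ j)
  ψ h := E.ψ (θ.monotone h)
  g c := E.g_all c (θ 0)

theorem basisElt_str (S : PStr m n Y) (k : Type u) [CommRing k]
    (h : (S.W (Fin.last n)).card = 1) : S.gen k = basisElt k ⟨S.str, h⟩ S.point := by
  rw [gen, dif_pos h]

theorem rwOp_gen (k : Type u) [CommRing k] {l n : SimplexCategory} (θ : l ⟶ n)
    {Y : Fin (n.len + 1) → Type} [∀ j, LinearOrder (Y j)] (S : PStr m n.len Y)
    (h : (S.W (Fin.last n.len)).card = 1) :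
    rwOp (reprSurj k ⟨m⟩) θ (S.gen k) = (S.pull θ.toOrderHom).total k := by
  rw [S.basisElt_str k h, rwOp_basisElt]
  exact (S.strEquiv.pullEquiv θ.toOrderHom).total_eq k

/-- Components of the composite with a monotone map. -/
theorem comp_pull_comp (S : PStr m n Y) {l : ℕ} (θ : Fin (l + 1) →o Fin (n + 1))
    (i : Y (Fin.last n)) (hi : i ∈ S.W (Fin.last n)) (y : Y (θ (Fin.last l)))
    (hy : y ∈ ((S.comp i hi).pull θ).W (Fin.last l)) (hy' : y ∈ (S.pull θ).W (Fin.last l)) :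
    Nonempty (Equiv (((S.comp i hi).pull θ).comp y hy) ((S.pull θ).comp y hy')) := by
  have hyi : S.ψ (Fin.le_last _) y = i := (Finset.mem_filter.1 hy).2
  refine ⟨Equiv.ofEq ?_ (fun _ _ _ => rfl) ?_⟩
  · intro j z
    simp only [comp_W, pull_W, pull_ψ, comp_ψ, Finset.mem_filter]
    constructor
    · rintro ⟨hz, h⟩
      refine ⟨⟨hz, ?_⟩, h⟩
      rw [← hyi, ← h]
      exact (S.ψ_comp _ _ _ hz).symm
    · rintro ⟨⟨hz, -⟩, h⟩
      exact ⟨hz, h⟩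
  · intro c
    simp only [comp_g, pull_g]
    rcases hg : S.g c (θ (Fin.last l)) with _ | z
    · simp
    · by_cases hz : z = y
      · subst hz
        rw [S.g_last_of_g c _ z hg, hyi]
        simp
      · split_ifs with h1 h2 <;> simp_all

/-- The components of `S ∘ θ` are grouped by the element of the last set of `S` that they lie over,
and each group consists of the components of (component of `S`) `∘ θ`. With sums over components in
place of generators, the operators become plain composition with `θ`. -/
theorem rwOp_total (k : Type u) [CommRing k] {l n : SimplexCategory} (θ : l ⟶ n)
    {Y : Fin (n.len + 1) → Type} [∀ j, LinearOrder (Y j)] (S : PStr m n.len Y) :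
    rwOp (reprSurj k ⟨m⟩) θ (S.total k) = (S.pull θ.toOrderHom).total k := by
  rw [total, map_sum]
  rw [Finset.sum_congr rfl fun i _ => rwOp_gen k θ (S.comp i.1 i.2)
    (by rw [comp_last, Finset.card_singleton])]
  refine sum_total S (S.pull θ.toOrderHom) k (S.ψ (Fin.le_last _)) ?_
    (fun i hi => (S.comp i hi).pull θ.toOrderHom) ?_ ?_
  · intro y hy
    exact S.maps _ _ hy
  · intro i hi y
    exact Finset.mem_filter
  · intro i hi y hy hy'
    exact S.comp_pull_comp θ.toOrderHom i hi y hy hy'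

end Pull

end PStr
end GammaSym

namespace GammaSym

/-- The linear map with given values on the generators. -/
noncomputable def basisLift {k : Type u} [CommRing k] {m : GammaCat} {n : ℕ} {N : Type u}
    [AddCommGroup N] [Module k N]
    (v : ∀ s : Str n, (m ⟶ (⟨(s.1.obj 0).card⟩ : GammaCat)) → N) :
    (⨁ s : Str n, (reprSurj k m).obj (addBase.obj (s.1.obj 0))) →ₗ[k] N :=
  DirectSum.toModule k _ _ fun s =>
    (Finsupp.lsum k fun γ => LinearMap.toSpanSingleton k N (v s γ) :
      ((m ⟶ (⟨(s.1.obj 0).card⟩ : GammaCat)) →₀ k) →ₗ[k] N)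

theorem basisLift_basisElt {k : Type u} [CommRing k] {m : GammaCat} {n : ℕ} {N : Type u}
    [AddCommGroup N] [Module k N]
    (v : ∀ s : Str n, (m ⟶ (⟨(s.1.obj 0).card⟩ : GammaCat)) → N) (s : Str n)
    (γ : m ⟶ (⟨(s.1.obj 0).card⟩ : GammaCat)) : basisLift v (basisElt k s γ) = v s γ := by
  refine (DirectSum.toModule_lof k s _).trans ?_
  refine (Finsupp.lsum_single k _ γ 1).trans ?_
  exact one_smul k _

namespace PStr

/-! ### Cylinder operators attached to the simplices of the interval -/

section Cylinder

variable {m n : ℕ} {Y : Fin (n + 1) → Type} [∀ j, LinearOrder (Y j)]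

/-- The labels of the copies of an element `y` of the `j`-th set of a string in its cylinder. -/
def IsLabel (S : PStr m n Y) (θ : Fin (n + 1) →o Fin 2) (j : Fin (n + 1)) (y : Y j) (κ : ℕ) : Prop :=
  κ = 0 ∨ (θ j = 0 ∧ (κ = 1 ∨ ∃ c : Fin m, κ = c + 2 ∧ S.g c j = some y))

theorem IsLabel.lt {S : PStr m n Y} {θ : Fin (n + 1) →o Fin 2} {j : Fin (n + 1)} {y : Y j} {κ : ℕ}
    (h : S.IsLabel θ j y κ) : κ < m + 2 := by
  rcases h with rfl | ⟨-, rfl | ⟨c, rfl, -⟩⟩ <;> omega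

open Classical in
/-- The cylinder of a string: in the places where `θ` vanishes, each set `X` is replaced by the
disjoint union of two copies of `X` and the set of the marked points that are present, and the
marked points are moved to the latter. -/
noncomputable def cyl (S : PStr m n Y) (θ : Fin (n + 1) →o Fin 2) :
    PStr m n (fun j => Y j ×ₗ ℕ) where
  W j := ((S.W j ×ˢ Finset.range (m + 2)).filter fun z => S.IsLabel θ j z.1 z.2).map
    toLex.toEmbedding
  -- Labels 0 and 1 are the two copies of the set and label `c + 2` belongs to the mark `c`. A label
  -- is kept while `θ` vanishes; afterwards only label 0 exists and everything is projected to it.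
  ψ {j j'} h z := toLex (S.ψ h (ofLex z).1, if θ j' = 0 then (ofLex z).2 else 0)
  g c j := (S.g c j).map fun y => toLex (y, if θ j = 0 then (c : ℕ) + 2 else 0)
  ne j := by
    obtain ⟨y, hy⟩ := S.ne j
    refine ⟨toLex (y, 0), ?_⟩
    rw [Finset.mem_map_equiv, Finset.mem_filter, Finset.mem_product, Finset.mem_range]
    exact ⟨⟨hy, by simp⟩, Or.inl rfl⟩
  maps {j j'} h z hz := by
    rw [Finset.mem_map_equiv, Finset.mem_filter, Finset.mem_product, Finset.mem_range] at hz ⊢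
    obtain ⟨⟨hy, hκ⟩, hl⟩ := hz
    have hl' : S.IsLabel θ j' (S.ψ h (ofLex z).1) (if θ j' = 0 then (ofLex z).2 else 0) := by
      split_ifs with h0
      · rcases hl with hl | ⟨h1, hl | ⟨c, hl, hc⟩⟩
        · exact Or.inl hl
        · exact Or.inr ⟨h0, Or.inl hl⟩
        · refine Or.inr ⟨h0, Or.inr ⟨c, hl, ?_⟩⟩
          rw [S.g_map c h, hc]
          rfl
      · exact Or.inl rfl
    exact ⟨⟨S.maps h _ hy, hl'.lt⟩, hl'⟩
  surj {j j'} h z' hz' := by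
    rw [Finset.mem_map_equiv, Finset.mem_filter, Finset.mem_product, Finset.mem_range] at hz'
    obtain ⟨⟨hy, hκ⟩, hl⟩ := hz'
    -- Every element lifts with its own label. For labels 0 and 1 surjectivity of the string
    -- suffices; for label `c + 2` the lift is the earlier position of the mark `c`. The places
    -- where `θ` vanishes form an initial segment, so the label is available at `j` as well.
    have key : ∃ y ∈ S.W j, S.ψ h y = (ofLex z').1 ∧ S.IsLabel θ j y (ofLex z').2 ∧
        (if θ j' = 0 then (ofLex z').2 else 0) = (ofLex z').2 := by
      obtain ⟨y, hy', e⟩ := S.surj h _ hy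
      rcases hl with hl | ⟨h1, hl⟩
      · exact ⟨y, hy', e, Or.inl hl, by
          rw [show (ofLex z').2 = 0 from hl, ite_self]⟩
      · have h0 : θ j = 0 := le_antisymm ((θ.monotone h).trans h1.le) (Fin.zero_le _)
        rcases hl with hl | ⟨c, hl, hc⟩
        · exact ⟨y, hy', e, Or.inr ⟨h0, Or.inl hl⟩, if_pos h1⟩
        · rw [S.g_map c h, Option.map_eq_some_iff] at hc
          obtain ⟨y₁, hy₁, e₁⟩ := hc
          exact ⟨y₁, S.g_mem c j y₁ hy₁, e₁, Or.inr ⟨h0, Or.inr ⟨c, hl, hy₁⟩⟩, if_pos h1⟩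
    obtain ⟨y, hy', e, hl', hi⟩ := key
    refine ⟨toLex (y, (ofLex z').2), ?_, ?_⟩
    · rw [Finset.mem_map_equiv, Finset.mem_filter, Finset.mem_product, Finset.mem_range]
      exact ⟨⟨hy', hl'.lt⟩, hl'⟩
    · change toLex (S.ψ h y, if θ j' = 0 then (ofLex z').2 else 0) = z'
      rw [e, hi]
      rfl
  ψ_id j z hz := by
    rw [Finset.mem_map_equiv, Finset.mem_filter, Finset.mem_product, Finset.mem_range] at hz
    obtain ⟨⟨hy, hκ⟩, hl⟩ := hz
    have h0 : (if θ j = 0 then (ofLex z).2 else 0) = (ofLex z).2 := by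
      rcases hl with hl | ⟨h1, -⟩
      · rw [show (ofLex z).2 = 0 from hl, ite_self]
      · exact if_pos h1
    rw [h0]
    exact congrArg toLex (Prod.ext (S.ψ_id j _ hy) rfl)
  ψ_comp {j j' j''} h h' z hz := by
    rw [Finset.mem_map_equiv, Finset.mem_filter, Finset.mem_product, Finset.mem_range] at hz
    obtain ⟨⟨hy, hκ⟩, hl⟩ := hz
    refine congrArg toLex (Prod.ext (S.ψ_comp h h' _ hy) ?_)
    change (if θ j'' = 0 then (if θ j' = 0 then (ofLex z).2 else 0) else 0) =
      if θ j'' = 0 then (ofLex z).2 else 0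
    by_cases h1 : θ j'' = 0
    · rw [if_pos h1, if_pos h1, if_pos]
      exact le_antisymm ((θ.monotone h').trans h1.le) (Fin.zero_le _)
    · rw [if_neg h1, if_neg h1]
  g_mem c j z h := by
    obtain ⟨y, hy, rfl⟩ := Option.map_eq_some_iff.1 h
    rw [Finset.mem_map_equiv, Finset.mem_filter, Finset.mem_product, Finset.mem_range]
    have hl : S.IsLabel θ j y (if θ j = 0 then (c : ℕ) + 2 else 0) := by
      split_ifs with h0
      · exact Or.inr ⟨h0, Or.inr ⟨c, rfl, hy⟩⟩
      · exact Or.inl rfl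
    exact ⟨⟨S.g_mem c j y hy, hl.lt⟩, hl⟩
  g_map c {j j'} h := by
    rw [S.g_map c h, Option.map_map, Option.map_map]
    refine congrArg (fun f => Option.map f (S.g c j)) (funext fun y => ?_)
    refine congrArg toLex (Prod.ext rfl ?_)
    change (if θ j' = 0 then (c : ℕ) + 2 else 0) =
      if θ j' = 0 then (if θ j = 0 then (c : ℕ) + 2 else 0) else 0
    by_cases h1 : θ j' = 0
    · rw [if_pos h1, if_pos h1, if_pos]
      exact le_antisymm ((θ.monotone h).trans h1.le) (Fin.zero_le _)
    · rw [if_neg h1, if_neg h1]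

theorem mem_cyl (S : PStr m n Y) (θ : Fin (n + 1) →o Fin 2) (j : Fin (n + 1)) (z : Y j ×ₗ ℕ) :
    z ∈ (S.cyl θ).W j ↔ (ofLex z).1 ∈ S.W j ∧ S.IsLabel θ j (ofLex z).1 (ofLex z).2 := by
  classical
  change z ∈ ((S.W j ×ˢ Finset.range (m + 2)).filter fun z => S.IsLabel θ j z.1 z.2).map
    toLex.toEmbedding ↔ _
  rw [Finset.mem_map_equiv, Finset.mem_filter, Finset.mem_product, Finset.mem_range]
  exact ⟨fun h => ⟨h.1.1, h.2⟩, fun h => ⟨⟨h.1, h.2.lt⟩, h.2⟩⟩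

theorem cyl_ψ (S : PStr m n Y) (θ : Fin (n + 1) →o Fin 2) {j j' : Fin (n + 1)} (h : j ≤ j')
    (z : Y j ×ₗ ℕ) : (S.cyl θ).ψ h z =
      toLex (S.ψ h (ofLex z).1, if θ j' = 0 then (ofLex z).2 else 0) := rfl

theorem cyl_g (S : PStr m n Y) (θ : Fin (n + 1) →o Fin 2) (c : Fin m) (j : Fin (n + 1)) :
    (S.cyl θ).g c j = (S.g c j).map fun y => toLex (y, if θ j = 0 then (c : ℕ) + 2 else 0) := rfl

/-- The isomorphism of cylinders induced by an isomorphism of strings. -/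
noncomputable def Equiv.cylEquiv {Y' : Fin (n + 1) → Type} [∀ j, LinearOrder (Y' j)]
    {S : PStr m n Y} {S' : PStr m n Y'} (E : Equiv S S') (θ : Fin (n + 1) →o Fin 2) :
    Equiv (S.cyl θ) (S'.cyl θ) where
  f j z := toLex (E.f j (ofLex z).1, (ofLex z).2)
  mono j := by
    intro z hz z' hz' h
    rw [Finset.mem_coe, mem_cyl] at hz hz'
    rw [Prod.Lex.lt_iff] at h ⊢
    rcases h with h | ⟨h, h'⟩
    · exact Or.inl (E.mono j hz.1 hz'.1 h)
    · exact Or.inr ⟨congrArg (E.f j) h, h'⟩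
  image j z' := by
    have hl : ∀ y ∈ S.W j, ∀ κ, S'.IsLabel θ j (E.f j y) κ ↔ S.IsLabel θ j y κ := by
      intro y hy κ
      refine or_congr Iff.rfl (and_congr Iff.rfl (or_congr Iff.rfl
        (exists_congr fun c => and_congr Iff.rfl ?_)))
      rw [E.g_all c j]
      rcases h : S.g c j with _ | y₁
      · simp
      · rw [Option.map_some, Option.some_inj, Option.some_inj]
        exact (E.mono j).injOn.eq_iff (S.g_mem c j y₁ h) hy
    rw [mem_cyl, E.image]
    constructor
    · rintro ⟨⟨y, hy, e⟩, h⟩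
      rw [← e, hl y hy] at h
      refine ⟨toLex (y, (ofLex z').2), (mem_cyl _ _ _ _).2 ⟨hy, h⟩, ?_⟩
      exact congrArg toLex (Prod.ext e rfl)
    · rintro ⟨z, hz, rfl⟩
      rw [mem_cyl] at hz
      exact ⟨⟨_, hz.1, rfl⟩, (hl _ hz.1 _).2 hz.2⟩
  ψ h z hz := by
    rw [mem_cyl] at hz
    exact congrArg toLex (Prod.ext (E.ψ h _ hz.1) rfl)
  g c := by
    rw [cyl_g, cyl_g, E.g c, Option.map_map, Option.map_map]
    rfl

/-- Components of the cylinder of a component. -/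
theorem comp_cyl_comp (S : PStr m n Y) (θ : Fin (n + 1) →o Fin 2)
    (i : Y (Fin.last n)) (hi : i ∈ S.W (Fin.last n)) (z : Y (Fin.last n) ×ₗ ℕ)
    (hz : z ∈ ((S.comp i hi).cyl θ).W (Fin.last n)) (hz' : z ∈ (S.cyl θ).W (Fin.last n)) :
    Nonempty (Equiv (((S.comp i hi).cyl θ).comp z hz) ((S.cyl θ).comp z hz')) := by
  have hzi : (ofLex z).1 = i := by
    rw [mem_cyl, comp_last, Finset.mem_singleton] at hz
    exact hz.1
  have hlab : ∀ j y, S.ψ (Fin.le_last j) y = i → ∀ κ,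
      (S.comp i hi).IsLabel θ j y κ ↔ S.IsLabel θ j y κ := by
    intro j y hy κ
    refine or_congr Iff.rfl (and_congr Iff.rfl (or_congr Iff.rfl
      (exists_congr fun c => and_congr Iff.rfl ?_)))
    rw [comp_g]
    constructor
    · intro h
      split_ifs at h
      exact h
    · intro h
      rw [if_pos, h]
      rw [S.g_last_of_g c j y h, hy]
  refine ⟨Equiv.ofEq ?_ (fun _ _ _ => rfl) ?_⟩
  · intro j y
    rw [comp_W, comp_W, Finset.mem_filter, Finset.mem_filter, mem_cyl, mem_cyl, comp_W,
      Finset.mem_filter]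
    change (_ ∧ (S.cyl θ).ψ _ y = z) ↔ (_ ∧ (S.cyl θ).ψ _ y = z)
    have h1 : (S.cyl θ).ψ (Fin.le_last j) y = z → S.ψ (Fin.le_last j) (ofLex y).1 = i := by
      rintro rfl
      exact hzi
    constructor
    · rintro ⟨⟨hy, hl⟩, h⟩
      exact ⟨⟨⟨hy, h1 h⟩, (hlab _ _ (h1 h) _).2 hl⟩, h⟩
    · rintro ⟨⟨hy, hl⟩, h⟩
      exact ⟨⟨hy.1, (hlab _ _ (h1 h) _).1 hl⟩, h⟩
  · intro c
    rw [comp_g, comp_g, cyl_g, cyl_g, cyl_g, cyl_g, comp_g, comp_g]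
    rcases hg : S.g c (Fin.last n) with _ | y
    · simp
    · by_cases hy : y = i
      · subst hy
        simp
      · have : (toLex (y, if θ (Fin.last n) = 0 then (c : ℕ) + 2 else 0) :
            Y (Fin.last n) ×ₗ ℕ) ≠ z := by
          rintro rfl
          exact hy hzi
        simp [this, hy]

variable (k : Type u) [CommRing k]

/-- A component of the cylinder lies over a labelled element of the last set; forgetting the label
tells which component of `S` it belongs to. -/
theorem sum_cyl (S : PStr m n Y) (θ : Fin (n + 1) →o Fin 2) :
    ∑ i ∈ (S.W (Fin.last n)).attach, ((S.comp i.1 i.2).cyl θ).total k = (S.cyl θ).total k := by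
  refine sum_total S (S.cyl θ) k (fun z => (ofLex z).1) ?_
    (fun i hi => (S.comp i hi).cyl θ) ?_ ?_
  · intro y hy
    exact ((mem_cyl _ _ _ _).1 hy).1
  · intro i hi z
    rw [mem_cyl, mem_cyl, comp_last, Finset.mem_singleton]
    have hl : (ofLex z).1 = i → ((S.comp i hi).IsLabel θ (Fin.last n) (ofLex z).1 (ofLex z).2 ↔
        S.IsLabel θ (Fin.last n) (ofLex z).1 (ofLex z).2) := by
      intro h
      refine or_congr Iff.rfl (and_congr Iff.rfl (or_congr Iff.rfl
        (exists_congr fun c => and_congr Iff.rfl ?_)))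
      rw [comp_g, h]
      split_ifs with h1
      · rfl
      · exact ⟨fun h => by simp at h, fun h => absurd h h1⟩
    constructor
    · rintro ⟨h, h'⟩
      refine ⟨⟨?_, (hl h).1 h'⟩, h⟩
      rw [h]
      exact hi
    · rintro ⟨⟨-, h'⟩, h⟩
      exact ⟨h, (hl h).2 h'⟩
  · intro i hi y hy hy'
    exact S.comp_cyl_comp θ i hi y hy hy'

/-- The operator given by cylinders. -/
noncomputable def cylOp (m n : ℕ) (θ : Fin (n + 1) →o Fin 2) :
    (⨁ s : Str n, (reprSurj k ⟨m⟩).obj (addBase.obj (s.1.obj 0))) →ₗ[k]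
      (⨁ s : Str n, (reprSurj k ⟨m⟩).obj (addBase.obj (s.1.obj 0))) :=
  basisLift fun s γ => ((ofStr s.1 γ).cyl θ).total k

theorem cylOp_basisElt (θ : Fin (n + 1) →o Fin 2) (s : Str n)
    (γ : (⟨m⟩ : GammaCat) ⟶ (⟨(s.1.obj 0).card⟩ : GammaCat)) :
    cylOp k m n θ (basisElt k s γ) = ((ofStr s.1 γ).cyl θ).total k :=
  basisLift_basisElt _ s γ

/-- The operator is prescribed only on generators, that is, for a one-element last set; since
cylinders decompose along components, the same formula holds for every string. -/
theorem cylOp_total (θ : Fin (n + 1) →o Fin 2) (S : PStr m n Y) :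
    cylOp k m n θ (S.total k) = (S.cyl θ).total k := by
  rw [← sum_cyl, total, map_sum]
  refine Finset.sum_congr rfl fun i _ => ?_
  rw [basisElt_str _ k (by rw [comp_last, Finset.card_singleton]), cylOp_basisElt]
  exact ((strEquiv _).cylEquiv θ).total_eq k

theorem cylOp_naturality {l n : SimplexCategory} (η : l ⟶ n)
    (θ : Fin (n.len + 1) →o Fin 2) :
    rwOp (reprSurj k ⟨m⟩) η ∘ₗ cylOp k m n.len θ =
      cylOp k m l.len (θ.comp η.toOrderHom) ∘ₗ rwOp (reprSurj k ⟨m⟩) η := by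
  refine basis_hom_ext fun s γ => ?_
  rw [LinearMap.comp_apply, LinearMap.comp_apply, cylOp_basisElt, rwOp_total, rwOp_basisElt,
    cylOp_total]
  -- The cylinder is formed place by place, so composition with `η` commutes with it definitionally.
  rfl

/-- Where `θ` is 1 only the label 0 occurs, so the cylinder is the original string. -/
theorem cylOp_one (θ : Fin (n + 1) →o Fin 2) (hθ : ∀ j, θ j = 1) :
    cylOp k m n θ = LinearMap.id := by
  refine basis_hom_ext fun s γ => ?_
  rw [cylOp_basisElt, LinearMap.id_apply, ← ofStr_total]
  symm
  refine Equiv.total_eq (⟨fun j y => toLex (y, 0), ?_, ?_, ?_, ?_⟩ : Equiv _ _) k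
  · intro j y _ y' _ h
    exact Prod.Lex.lt_iff.2 (Or.inl h)
  · intro j z
    rw [mem_cyl]
    constructor
    · rintro ⟨h, h' | ⟨h', -⟩⟩
      · exact ⟨_, h, congrArg toLex (Prod.ext rfl h'.symm)⟩
      · rw [hθ j] at h'
        exact absurd h' one_ne_zero
    · rintro ⟨y, hy, rfl⟩
      exact ⟨hy, Or.inl rfl⟩
  · intro j j' h y _
    rw [cyl_ψ]
    exact congrArg toLex (Prod.ext rfl (ite_self _).symm)
  · intro c
    rw [cyl_g, hθ 0, if_neg one_ne_zero]

end Cylinder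

end PStr
end GammaSym

namespace GammaSym

/-! ### The cylinder at the end 0 of the interval -/

/-- The constant string at the one-element set. -/
abbrev constStr (n : ℕ) : Str n := ⟨(Functor.const _).obj ⟨1, one_pos⟩, rfl⟩

/-- The based map `[m] → [b]` which sends everything to the basepoint. -/
def GammaCat.zeroHom (a b : GammaCat) : a ⟶ b := ⟨fun _ => 0, rfl⟩

theorem GammaCat.zeroHom_comp (a : GammaCat) {b b' : GammaCat} (f : b ⟶ b') :
    GammaCat.zeroHom a b ≫ f = GammaCat.zeroHom a b' := by
  ext1
  funext _
  exact f.map_zero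

/-- The based map `[m] → [1]` which sends everything but `c` to the basepoint. -/
def pointAt {m : ℕ} (c : Fin m) : (⟨m⟩ : GammaCat) ⟶ (⟨1⟩ : GammaCat) :=
  ⟨Fin.cases 0 fun d => if d = c then 1 else 0, rfl⟩

theorem pointAt_succ {m : ℕ} (c d : Fin m) :
    (pointAt c).toFun d.succ = if d = c then 1 else 0 := rfl

theorem finSuccEquiv_eq_none_iff {a : ℕ} (x : Fin (a + 1)) : finSuccEquiv a x = none ↔ x = 0 := by
  rw [← finSuccEquiv_zero, (finSuccEquiv a).injective.eq_iff]

namespace PStr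

variable {m n : ℕ} {Y : Fin (n + 1) → Type} [∀ j, LinearOrder (Y j)]

theorem last_ne_none (S : PStr m n Y) (c : Fin m) :
    S.g c (Fin.last n) = none ↔ S.g c 0 = none := by
  rw [S.g_map c (Fin.zero_le (Fin.last n)), Option.map_eq_none_iff]

/-- When `θ` vanishes everywhere no labels are collapsed, so the part with label 0 or 1 is a full
copy of `S`. The marks carry labels at least 2 and are lost from it. -/
theorem cyl_zero_comp_unmarked (S : PStr m n Y) (θ : Fin (n + 1) →o Fin 2) (hθ : ∀ j, θ j = 0)
    (y₀ : Y (Fin.last n)) (hy₀ : ∀ y ∈ S.W (Fin.last n), y = y₀) (κ : ℕ) (hκ : κ = 0 ∨ κ = 1)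
    (hz : toLex (y₀, κ) ∈ (S.cyl θ).W (Fin.last n)) :
    Nonempty (Equiv (ofStr S.str (GammaCat.zeroHom ⟨m⟩ _))
      ((S.cyl θ).comp (toLex (y₀, κ)) hz)) := by
  refine ⟨⟨fun j p => toLex (S.emb j p, κ), ?_, ?_, ?_, ?_⟩⟩
  · intro j p _ p' _ h
    exact Prod.Lex.lt_iff.2 (Or.inl ((S.emb j).strictMono h))
  · intro j z
    rw [comp_W, Finset.mem_filter, mem_cyl, cyl_ψ, if_pos (hθ _)]
    constructor
    · rintro ⟨⟨h, -⟩, h'⟩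
      refine ⟨S.idx j _ h, Finset.mem_univ _, ?_⟩
      rw [S.emb_idx]
      exact congrArg toLex (Prod.ext rfl (congrArg (fun w => (ofLex w).2) h').symm)
    · rintro ⟨p, -, rfl⟩
      refine ⟨⟨S.emb_mem j p, ?_⟩, ?_⟩
      · rcases hκ with h | h
        · exact Or.inl h
        · exact Or.inr ⟨hθ j, Or.inl h⟩
      · exact congrArg toLex (Prod.ext (hy₀ _ (S.maps _ _ (S.emb_mem j p))) rfl)
  · intro j j' h p _
    refine congrArg toLex (Prod.ext (S.emb_map (homOfLE h) p) ?_)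
    exact (if_pos (hθ j')).symm
  · intro c
    rw [ofStr_g_zero, show (GammaCat.zeroHom ⟨m⟩ ⟨(S.W 0).card⟩).toFun c.succ = 0 from rfl,
      finSuccEquiv_zero, Option.map_none, comp_g, if_neg]
    rw [cyl_g]
    rcases S.g c (Fin.last n) with _ | y
    · simp
    · rw [Option.map_some, Option.some_inj, if_pos (hθ _)]
      intro h
      have : (c : ℕ) + 2 = κ := congrArg (fun w => (ofLex w).2) h
      omega

/-- The label `c + 2` is attached at each place to a single element, the current position of the
mark `c`. The component is thus a string of one-element sets marked by `c` alone, even if other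
marks sit at the same element of `S`. -/
theorem cyl_zero_comp_marked (S : PStr m n Y) (θ : Fin (n + 1) →o Fin 2) (hθ : ∀ j, θ j = 0)
    (y₀ : Y (Fin.last n)) (c : Fin m)
    (hz : toLex (y₀, (c : ℕ) + 2) ∈ (S.cyl θ).W (Fin.last n))
    (hc : S.g c (Fin.last n) = some y₀) :
    Nonempty (Equiv (ofStr (constStr n).1 (pointAt c))
      ((S.cyl θ).comp (toLex (y₀, (c : ℕ) + 2)) hz)) := by
  have hs : ∀ j, ∃ y, S.g c j = some y := by
    intro j
    refine Option.ne_none_iff_exists'.1 fun h => ?_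
    rw [S.g_map c (Fin.le_last j), h] at hc
    simp at hc
  choose v hv using hs
  have hvm : ∀ {j j'} (h : j ≤ j'), S.ψ h (v j) = v j' := by
    intro j j' h
    have := S.g_map c h
    rw [hv, hv] at this
    exact (Option.some_inj.1 this).symm
  have hvl : v (Fin.last n) = y₀ := Option.some_inj.1 ((hv _).symm.trans hc)
  refine ⟨⟨fun j _ => toLex (v j, (c : ℕ) + 2), ?_, ?_, ?_, ?_⟩⟩
  · intro j p _ p' _ h
    exact absurd h (by rw [show p = p' from Subsingleton.elim (α := Fin 1) p p']; exact lt_irrefl _)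
  · intro j z
    rw [comp_W, Finset.mem_filter, mem_cyl, cyl_ψ, if_pos (hθ _)]
    constructor
    · rintro ⟨⟨h, hl⟩, h'⟩
      have h2 : (ofLex z).2 = (c : ℕ) + 2 := congrArg (fun w => (ofLex w).2) h'
      refine ⟨(0 : Fin 1), Finset.mem_univ _, ?_⟩
      refine congrArg toLex (Prod.ext ?_ h2.symm)
      rcases hl with hl | ⟨-, hl | ⟨d, hd, hd'⟩⟩
      · omega
      · omega
      · obtain rfl : d = c := Fin.ext (by omega)
        rw [hv] at hd'
        exact Option.some_inj.1 hd'
    · rintro ⟨p, -, rfl⟩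
      refine ⟨⟨S.g_mem c j _ (hv j), Or.inr ⟨hθ j, Or.inr ⟨c, rfl, hv j⟩⟩⟩, ?_⟩
      exact congrArg toLex (Prod.ext ((hvm _).trans hvl) rfl)
  · intro j j' h p _
    refine congrArg toLex (Prod.ext (hvm h).symm ?_)
    exact (if_pos (hθ j')).symm
  · intro d
    rw [ofStr_g_zero, show (pointAt c).toFun d.succ = if d = c then 1 else 0 from rfl, comp_g,
      cyl_g, cyl_g]
    by_cases hd : d = c
    · subst hd
      rw [hv, hv, if_pos rfl, Option.map_some, Option.map_some, hvl, if_pos (hθ _),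
        if_pos (hθ _), if_pos rfl]
      rfl
    · rw [if_neg hd, if_neg]
      · rfl
      · rcases S.g d (Fin.last n) with _ | y
        · simp
        · rw [Option.map_some, Option.some_inj, if_pos (hθ _)]
          intro h
          have : (d : ℕ) + 2 = c + 2 := congrArg (fun w => (ofLex w).2) h
          exact hd (Fin.ext (by omega))

theorem cyl_zero_total (k : Type u) [CommRing k] (S : PStr m n Y) (θ : Fin (n + 1) →o Fin 2)
    (hθ : ∀ j, θ j = 0) (h : (S.W (Fin.last n)).card = 1) :
    (S.cyl θ).total k =
      (2 : k) • basisElt k ⟨S.str, h⟩ (GammaCat.zeroHom ⟨m⟩ _) +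
        ∑ c : Fin m, if S.g c 0 = none then 0 else basisElt k (constStr n) (pointAt c) := by
  classical
  obtain ⟨y₀, hy⟩ := Finset.card_eq_one.1 h
  have hmem : y₀ ∈ S.W (Fin.last n) := by rw [hy]; exact Finset.mem_singleton_self _
  have huniq : ∀ y ∈ S.W (Fin.last n), y = y₀ := fun y hy' => by
    rw [hy] at hy'; exact Finset.mem_singleton.1 hy'
  -- The last set of `S` is a point, so the components of the cylinder are indexed by labels. The
  -- contribution of an absent label is set to 0, which allows summing over all labels below `m +
  -- 2`.
  let G : ℕ → ⨁ s : Str n, (reprSurj k ⟨m⟩).obj (addBase.obj (s.1.obj 0)) := fun κ =>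
    if hz : toLex (y₀, κ) ∈ (S.cyl θ).W (Fin.last n) then
      ((S.cyl θ).comp (toLex (y₀, κ)) hz).gen k else 0
  have hG : (S.cyl θ).total k = ∑ κ ∈ Finset.range (m + 2), G κ := by
    unfold total
    refine Finset.sum_bij_ne_zero (fun z _ _ => (ofLex z.1).2) ?_ ?_ ?_ ?_
    · intro z _ _
      exact Finset.mem_range.2 ((mem_cyl _ _ _ _).1 z.2).2.lt
    · intro z _ _ z' _ _ hzz
      refine Subtype.ext (congrArg toLex (Prod.ext ?_ hzz))
      exact (huniq _ ((mem_cyl _ _ _ _).1 z.2).1).trans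
        (huniq _ ((mem_cyl _ _ _ _).1 z'.2).1).symm
    · intro κ _ hκ
      have hz : toLex (y₀, κ) ∈ (S.cyl θ).W (Fin.last n) := by
        by_contra hz
        exact hκ (dif_neg hz)
      refine ⟨⟨_, hz⟩, Finset.mem_attach _ _, ?_, rfl⟩
      intro h0
      exact hκ ((dif_pos hz).trans h0)
    · rintro ⟨z, hz⟩ _ _
      have e : z = toLex (y₀, (ofLex z).2) :=
        congrArg toLex (Prod.ext (huniq _ ((mem_cyl _ _ _ _).1 hz).1) rfl)
      have hz' : toLex (y₀, (ofLex z).2) ∈ (S.cyl θ).W (Fin.last n) := e ▸ hz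
      refine Eq.trans ?_ (dif_pos hz').symm
      congr 2
  have hunm : ∀ κ, κ = 0 ∨ κ = 1 → G κ = basisElt k ⟨S.str, h⟩ (GammaCat.zeroHom ⟨m⟩ _) := by
    intro κ hκ
    have hz : toLex (y₀, κ) ∈ (S.cyl θ).W (Fin.last n) := by
      rw [mem_cyl]
      refine ⟨hmem, ?_⟩
      rcases hκ with h | h
      · exact Or.inl h
      · exact Or.inr ⟨hθ _, Or.inl h⟩
    refine (dif_pos hz).trans ?_
    rw [← (S.cyl_zero_comp_unmarked θ hθ y₀ huniq κ hκ hz).some.gen_eq k]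
    exact ofStr_gen k ⟨S.str, h⟩ _
  have hmk : ∀ c : Fin m, G ((c : ℕ) + 2) =
      if S.g c 0 = none then 0 else basisElt k (constStr n) (pointAt c) := by
    intro c
    split_ifs with hc
    · refine dif_neg fun hz => ?_
      rw [mem_cyl] at hz
      rcases hz.2 with h' | ⟨-, h' | ⟨d, hd, hd'⟩⟩
      · exact absurd h' (Nat.succ_ne_zero _)
      · exact absurd (Nat.succ.inj h') (Nat.succ_ne_zero _)
      · have hd2 : (c : ℕ) + 2 = d + 2 := hd
        obtain rfl : d = c := Fin.ext (by omega)
        rw [(S.last_ne_none d).2 hc] at hd'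
        exact absurd hd' (by simp)
    · have hc' : S.g c (Fin.last n) = some y₀ := by
        rcases h' : S.g c (Fin.last n) with _ | y
        · exact absurd ((S.last_ne_none c).1 h') hc
        · rw [huniq y (S.g_mem _ _ _ h')]
      have hz : toLex (y₀, (c : ℕ) + 2) ∈ (S.cyl θ).W (Fin.last n) := by
        rw [mem_cyl]
        exact ⟨hmem, Or.inr ⟨hθ _, Or.inr ⟨c, rfl, hc'⟩⟩⟩
      refine (dif_pos hz).trans ?_
      rw [← (S.cyl_zero_comp_marked θ hθ y₀ c hz hc').some.gen_eq k]
      exact ofStr_gen k (constStr n) _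
  -- Peeling off labels 0 and 1 gives the two unmarked copies; the remaining labels are `c + 2` with
  -- `c < m`.
  rw [hG, Finset.sum_range_succ', Finset.sum_range_succ', hunm 0 (Or.inl rfl),
    show G (0 + 1) = _ from hunm 1 (Or.inr rfl), two_smul, Finset.sum_range, add_assoc]
  refine (add_comm _ _).trans ?_
  exact congrArg _ (Finset.sum_congr rfl fun c _ => hmk c)

/-- This end of the homotopy sees `γ` only through the set of marks that are present, that is,
through the augmentation; the rest factors through forgetting all marks. -/
theorem cylOp_zero (k : Type u) [CommRing k] (θ : Fin (n + 1) →o Fin 2) (hθ : ∀ j, θ j = 0)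
    (s : Str n) (γ : (⟨m⟩ : GammaCat) ⟶ (⟨(s.1.obj 0).card⟩ : GammaCat)) :
    cylOp k m n θ (basisElt k s γ) =
      (2 : k) • basisElt k s (GammaCat.zeroHom ⟨m⟩ _) +
        ∑ c : Fin m, if γ.toFun c.succ = 0 then 0 else basisElt k (constStr n) (pointAt c) := by
  have h : ((ofStr s.1 γ).W (Fin.last n)).card = 1 := by
    rw [ofStr_W, Finset.card_univ, Fintype.card_fin]
    exact s.2
  rw [cylOp_basisElt, cyl_zero_total k _ θ hθ h]
  refine congrArg₂ (· + ·) (congrArg _ ?_) (Finset.sum_congr rfl fun c _ => ?_)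
  · have e : basisElt k s (GammaCat.zeroHom ⟨m⟩ _) =
        (ofStr s.1 (GammaCat.zeroHom ⟨m⟩ _)).gen k := (ofStr_gen k s _).symm
    rw [e, ← ofStr_gen k (⟨(ofStr s.1 γ).str, h⟩ : Str n)]
    refine Equiv.gen_eq ⟨fun j p => (ofStr s.1 γ).emb j p, ?_, ?_, ?_, ?_⟩ k
    · intro j
      exact ((ofStr s.1 γ).emb j).strictMono.strictMonoOn _
    · intro j y'
      refine ⟨fun _ => ⟨(ofStr s.1 γ).idx j y' (Finset.mem_univ _), Finset.mem_univ _,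
        (ofStr s.1 γ).emb_idx j y' _⟩, fun _ => Finset.mem_univ _⟩
    · intro j j' h p _
      exact (ofStr s.1 γ).emb_map (homOfLE h) p
    · intro c
      rw [ofStr_g_zero, ofStr_g_zero]
      rfl
  · rw [ofStr_g_zero]
    exact if_congr (finSuccEquiv_eq_none_iff _) rfl rfl

end PStr
end GammaSym

namespace GammaSym

/-! ### Simplicial homotopies from operators indexed by the interval -/

section Homotopy

/-- The monotone map `[n] → [1]` which vanishes exactly on the elements `≤ i`. -/
def cut (n i : ℕ) : Fin (n + 1) →o Fin 2 where
  toFun p := if (p : ℕ) ≤ i then 0 else 1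
  monotone' p p' h := by
    dsimp only
    have h' : (p : ℕ) ≤ p' := h
    split_ifs with h1 h2
    · exact le_rfl
    · exact Fin.zero_le _
    · omega
    · exact le_rfl

theorem cut_comp {l n : ℕ} (i i' : ℕ) (η : Fin (l + 1) →o Fin (n + 1))
    (h : ∀ p, (η p : ℕ) ≤ i ↔ (p : ℕ) ≤ i') : (cut n i).comp η = cut l i' := by
  ext p : 2
  exact if_congr (h p) rfl rfl

theorem coe_succAbove {n : ℕ} (i : Fin (n + 2)) (p : Fin (n + 1)) :
    (i.succAbove p : ℕ) = if (p : ℕ) < i then (p : ℕ) else p + 1 := by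
  unfold Fin.succAbove
  split_ifs <;> simp_all [Fin.lt_def]

theorem coe_predAbove {n : ℕ} (i : Fin n) (p : Fin (n + 1)) :
    (i.predAbove p : ℕ) = if (i : ℕ) < p then (p : ℕ) - 1 else p := by
  unfold Fin.predAbove
  split_ifs with h h' h' <;> rw [Fin.lt_def, Fin.val_castSucc] at h <;> simp <;> omega

variable {C : Type*} [Category* C]

open SimplexCategory Simplicial Opposite in
/-- A simplicial homotopy between the two ends of a natural family of operators indexed by the
simplices of the interval. -/
def homotopyOfInterval (X : SimplicialObject C)
    (H : ∀ (n : ℕ), (Fin (n + 1) →o Fin 2) → (X _⦋n⦌ ⟶ X _⦋n⦌))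
    (hH : ∀ {l n : ℕ} (η : ⦋l⦌ ⟶ ⦋n⦌) (θ : Fin (n + 1) →o Fin 2),
      H n θ ≫ X.map η.op = X.map η.op ≫ H l (θ.comp η.toOrderHom))
    (f g : X ⟶ X) (hf : ∀ n θ, (∀ j, θ j = 0) → f.app (op ⦋n⦌) = H n θ)
    (hg : ∀ n θ, (∀ j, θ j = 1) → g.app (op ⦋n⦌) = H n θ) :
    SimplicialObject.Homotopy f g where
  -- The degeneracy `σ i` together with the cut after `i` is the `i`-th top simplex of the
  -- triangulated prism. Naturality of `H` splits each homotopy identity into a simplicial identity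
  -- of `X` and a comparison of cuts.
  h {n} i := X.σ i ≫ H (n + 1) (cut (n + 1) i)
  h_zero_comp_δ_zero n := by
    rw [Category.assoc, SimplicialObject.δ, hH, ← Category.assoc]
    have := X.δ_comp_σ_self (n := n) (i := 0)
    rw [Fin.castSucc_zero, SimplicialObject.δ] at this
    rw [this, Category.id_comp]
    refine (hg n _ fun j => ?_).symm
    have h : ¬ (((0 : Fin (n + 2)).succAbove j : ℕ) ≤ 0) := by
      rw [coe_succAbove]
      simp
    exact (if_neg h : (if (((0 : Fin (n + 2)).succAbove j : ℕ) ≤ 0) then (0 : Fin 2) else 1) = 1)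
  h_last_comp_δ_last n := by
    rw [Category.assoc, SimplicialObject.δ, hH, ← Category.assoc]
    have := X.δ_comp_σ_succ (n := n) (i := Fin.last n)
    rw [Fin.succ_last, SimplicialObject.δ] at this
    rw [this, Category.id_comp]
    refine (hf n _ fun j => ?_).symm
    have h : (((Fin.last (n + 1)).succAbove j : ℕ) ≤ n) := by
      rw [Fin.succAbove_last]
      exact Nat.lt_succ_iff.1 j.2
    exact if_pos h
  h_succ_comp_δ_castSucc_of_lt {n} i j hij := by
    rw [Category.assoc, SimplicialObject.δ, hH, ← Category.assoc]
    have := X.δ_comp_σ_of_le (n := n) hij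
    rw [SimplicialObject.δ] at this
    rw [this, Category.assoc]
    congr 3
    refine cut_comp _ _ _ fun p => ?_
    change (i.castSucc.succAbove p : ℕ) ≤ _ ↔ _
    rw [coe_succAbove]
    rw [Fin.le_def] at hij
    simp only [Fin.val_castSucc, Fin.val_succ] at hij ⊢
    split_ifs <;> omega
  h_succ_comp_δ_castSucc_succ {n} j := by
    rw [Category.assoc, Category.assoc, SimplicialObject.δ, hH, hH, ← Category.assoc,
      ← Category.assoc]
    have h1 := X.δ_comp_σ_self (n := n + 1) (i := j.succ)
    have h2 := X.δ_comp_σ_succ (n := n + 1) (i := j.castSucc)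
    rw [SimplicialObject.δ] at h1 h2
    rw [Fin.succ_castSucc] at h2 ⊢
    rw [h1, h2]
    congr 2
    -- The cuts after `j` and after `j + 1` differ only at the place `j + 1`, which is the one that
    -- this face omits.
    ext p : 2
    refine if_congr ?_ rfl rfl
    change (j.succ.castSucc.succAbove p : ℕ) ≤ _ ↔ (j.succ.castSucc.succAbove p : ℕ) ≤ _
    rw [coe_succAbove]
    simp only [Fin.val_castSucc, Fin.val_succ]
    split_ifs <;> omega
  h_castSucc_comp_δ_succ_of_lt {n} i j hji := by
    rw [Category.assoc, SimplicialObject.δ, hH, ← Category.assoc]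
    have := X.δ_comp_σ_of_gt (n := n) hji
    rw [SimplicialObject.δ] at this
    rw [this, Category.assoc]
    congr 3
    refine cut_comp _ _ _ fun p => ?_
    change (i.succ.succAbove p : ℕ) ≤ _ ↔ _
    rw [coe_succAbove]
    rw [Fin.lt_def] at hji
    simp only [Fin.val_castSucc, Fin.val_succ] at hji ⊢
    split_ifs <;> omega
  h_comp_σ_castSucc_of_le {n} i j hij := by
    rw [Category.assoc, SimplicialObject.σ, SimplicialObject.σ, hH, ← Category.assoc]
    have := X.σ_comp_σ (n := n) hij
    rw [SimplicialObject.σ, SimplicialObject.σ] at this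
    rw [this, Category.assoc]
    congr 3
    refine cut_comp _ _ _ fun p => ?_
    change (i.castSucc.predAbove p : ℕ) ≤ _ ↔ _
    rw [coe_predAbove]
    rw [Fin.le_def] at hij
    simp only [Fin.val_castSucc, Fin.val_succ] at hij ⊢
    split_ifs <;> omega
  h_comp_σ_succ_of_lt {n} i j hji := by
    rw [Category.assoc, SimplicialObject.σ, SimplicialObject.σ, hH, ← Category.assoc]
    have := X.σ_comp_σ (n := n) hji
    rw [SimplicialObject.σ, SimplicialObject.σ, SimplicialObject.σ, SimplicialObject.σ] at this
    rw [← this, Category.assoc]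
    rw [SimplicialObject.σ, SimplicialObject.σ]
    congr 3
    refine cut_comp _ _ _ fun p => ?_
    change (i.succ.predAbove p : ℕ) ≤ _ ↔ _
    rw [coe_predAbove]
    rw [Fin.le_def] at hji
    simp only [Fin.val_castSucc, Fin.val_succ] at hji ⊢
    split_ifs <;> omega

end Homotopy
end GammaSym

namespace GammaSym

/-! ### Exactness of the augmented complex of a representable functor -/

section Acyclic

variable (k : Type u) [CommRing k]

/-- Precomposition with a based map. -/
noncomputable def reprMap {m m' : GammaCat} (f : m' ⟶ m) : repr k m ⟶ repr k m' where
  app b := ModuleCat.ofHom (Finsupp.lmapDomain k k fun g => f ≫ g)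
  naturality {b b'} g := by
    ext1
    refine Finsupp.lhom_ext fun γ c => ?_
    refine (congrArg (Finsupp.mapDomain (fun g => f ≫ g)) Finsupp.mapDomain_single).trans ?_
    refine Finsupp.mapDomain_single.trans ?_
    refine Eq.trans ?_ ((congrArg (Finsupp.mapDomain (fun γ => γ ≫ g))
      Finsupp.mapDomain_single).trans Finsupp.mapDomain_single).symm
    exact congrArg (Finsupp.single · c) (Category.assoc f γ g).symm

/-- The Robinson-Whitehouse simplicial module of `k[Γ([m], -)]`. -/
noncomputable abbrev rwRepr (m : GammaCat) : SimplicialObject (ModuleCat.{u} k) :=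
  rwComplex (reprSurj k m)

/-- The map of Robinson-Whitehouse simplicial modules given by precomposition. -/
noncomputable def rwReprMap {m m' : GammaCat} (f : m' ⟶ m) : rwRepr k m ⟶ rwRepr k m' :=
  rwComplexMap (Functor.whiskerLeft (wideSubcategoryInclusion gammaSurj) (reprMap k f))

theorem rwReprMap_basisElt {m m' : GammaCat} (f : m' ⟶ m) (Δ : SimplexCategoryᵒᵖ)
    (s : Str Δ.unop.len) (γ : m ⟶ (⟨(s.1.obj 0).card⟩ : GammaCat)) :
    ((rwReprMap k f).app Δ).hom (basisElt k s γ) = basisElt k s (f ≫ γ) := by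
  refine (DirectSum.lmap_lof _ _ _).trans ?_
  exact congrArg (DirectSum.lof k (Str Δ.unop.len)
    (fun s => (reprSurj k m').obj (addBase.obj (s.1.obj 0))) s) Finsupp.mapDomain_single

/-- The simplicial endomorphism given by the cylinders at the end `0` of the interval. -/
noncomputable def cylEnd (m : ℕ) : rwRepr k ⟨m⟩ ⟶ rwRepr k ⟨m⟩ where
  app Δ := ModuleCat.ofHom (PStr.cylOp k m Δ.unop.len (OrderHom.const _ 0))
  naturality {Δ Δ'} η := by
    ext1
    exact (PStr.cylOp_naturality k η.unop (OrderHom.const _ 0)).symm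

/-- The homotopy from `cylEnd` to the identity. -/
noncomputable def cylHomotopy (m : ℕ) :
    SimplicialObject.Homotopy (cylEnd k m) (𝟙 (rwRepr k ⟨m⟩)) :=
  homotopyOfInterval _ (fun n θ => ModuleCat.ofHom (PStr.cylOp k m n θ))
    (fun {l n} η θ => by
      ext1
      exact PStr.cylOp_naturality k η θ) _ _
    (fun n θ hθ => by
      have : θ = OrderHom.const _ 0 := by
        ext j : 2
        exact hθ j
      rw [this]
      rfl)
    (fun n θ hθ => by
      rw [PStr.cylOp_one k θ hθ]
      rfl)

/-- The indicator function of the set of points which a based map does not send to the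
basepoint. -/
def indicator {m b : GammaCat} (γ : m ⟶ b) : (cochains k).obj (Opposite.op m) :=
  ⟨fun j => if γ.toFun j = 0 then 0 else 1, by
    change (if γ.toFun 0 = 0 then (0 : k) else 1) = 0
    rw [if_pos γ.map_zero]⟩

/-- The augmentation of the Robinson-Whitehouse module of `k[Γ([m], -)]`. -/
noncomputable def aug (m : GammaCat) (n : ℕ) :
    (⨁ s : Str n, (reprSurj k m).obj (addBase.obj (s.1.obj 0))) →ₗ[k]
      (cochains k).obj (Opposite.op m) :=
  basisLift fun _ γ => indicator k γ

theorem aug_basisElt {m : GammaCat} {n : ℕ} (s : Str n)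
    (γ : m ⟶ (⟨(s.1.obj 0).card⟩ : GammaCat)) : aug k m n (basisElt k s γ) = indicator k γ :=
  basisLift_basisElt _ s γ

theorem cochains_ext {m : GammaCat} {v w : (cochains k).obj (Opposite.op m)}
    (h : ∀ c : Fin m.n, v.1 c.succ = w.1 c.succ) : v = w := by
  refine Subtype.ext (funext fun j => ?_)
  refine Fin.cases ?_ h j
  exact (show v.1 0 = 0 from v.2).trans (show w.1 0 = 0 from w.2).symm

/-- The evaluation of a cochain at a point. -/
def evalAt (m : GammaCat) (j : Fin (m.n + 1)) : (cochains k).obj (Opposite.op m) →ₗ[k] k :=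
  (LinearMap.proj j).comp (Submodule.subtype _)

theorem evalAt_aug_gen {m n : ℕ} {Y : Fin (n + 1) → Type} [∀ j, LinearOrder (Y j)]
    (S : PStr m n Y) (h : (S.W (Fin.last n)).card = 1) (c : Fin m) :
    evalAt k ⟨m⟩ c.succ (aug k ⟨m⟩ n (S.gen k)) = if S.g c 0 = none then 0 else 1 := by
  rw [S.basisElt_str k h, aug_basisElt]
  change (if S.point.toFun c.succ = 0 then (0 : k) else 1) = _
  refine if_congr ?_ rfl rfl
  rcases Fin.eq_zero_or_eq_succ (S.point.toFun c.succ) with h0 | ⟨q, hq⟩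
  · refine ⟨fun _ => ?_, fun _ => h0⟩
    rcases hg : S.g c 0 with _ | y
    · rfl
    · have := (S.point_succ c (S.idx 0 y (S.g_mem c 0 y hg))).2 (by rw [hg, S.emb_idx])
      rw [h0] at this
      exact absurd this.symm (Fin.succ_ne_zero _)
  · rw [hq, (S.point_succ c q).1 hq]
    exact ⟨fun h => absurd h (Fin.succ_ne_zero _), fun h => absurd h (by simp)⟩

/-- A mark that is present lies in exactly one component, so it is counted once however the string
falls apart. -/
theorem evalAt_aug_total {m n : ℕ} {Y : Fin (n + 1) → Type} [∀ j, LinearOrder (Y j)]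
    (S : PStr m n Y) (c : Fin m) :
    evalAt k ⟨m⟩ c.succ (aug k ⟨m⟩ n (S.total k)) = if S.g c 0 = none then 0 else 1 := by
  unfold PStr.total
  rw [map_sum, map_sum]
  rw [Finset.sum_congr rfl fun i _ => evalAt_aug_gen k (S.comp i.1 i.2)
    (by rw [PStr.comp_last, Finset.card_singleton]) c]
  simp only [PStr.comp_g]
  rcases hg : S.g c 0 with _ | y
  · simp
  · have hl := S.g_last_of_g c 0 y hg
    have hm := S.g_mem c _ _ hl
    rw [Finset.sum_eq_single (⟨_, hm⟩ : {y // y ∈ S.W (Fin.last n)})]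
    · simp [hl]
    · rintro ⟨i, hi⟩ _ hne
      have : ¬ (S.g c (Fin.last n) = some i) := by
        rw [hl, Option.some_inj]
        exact fun h => hne (Subtype.ext h.symm)
      simp [this]
    · exact fun h => absurd (Finset.mem_attach _ _) h

/-- Marks are pushed forward along the string and neither appear nor disappear, so every simplicial
operator preserves the set of marks present. The augmentation is thus a map to a constant simplicial
module. -/
theorem aug_rwOp {m : GammaCat} {l n : SimplexCategory} (θ : l ⟶ n) :
    aug k m l.len ∘ₗ rwOp (reprSurj k m) θ = aug k m n.len := by
  refine basis_hom_ext fun s γ => cochains_ext k fun c => ?_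
  have h1 : evalAt k m c.succ (aug k m l.len (rwOp (reprSurj k m) θ (basisElt k s γ))) =
      if ((PStr.ofStr s.1 γ).pull θ.toOrderHom).g c 0 = none then 0 else 1 :=
    (congrArg (fun x => evalAt k m c.succ (aug k m l.len x))
      (PStr.rwOp_basisElt k θ s γ)).trans (evalAt_aug_total k _ c)
  have h2 : evalAt k m c.succ (aug k m n.len (basisElt k s γ)) =
      if (PStr.ofStr s.1 γ).g c 0 = none then 0 else 1 :=
    (congrArg (fun x => evalAt k m c.succ (aug k m n.len x))
      (PStr.ofStr_total k s γ).symm).trans (evalAt_aug_total k _ c)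
  refine h1.trans (Eq.trans ?_ h2.symm)
  refine if_congr ?_ rfl rfl
  have e := (PStr.ofStr s.1 γ).g_map c (Fin.zero_le (θ.toOrderHom 0))
  change (PStr.ofStr s.1 γ).g c (θ.toOrderHom 0) = none ↔ _
  rw [e, Option.map_eq_none_iff]

theorem rwOp_constStr {m : ℕ} {l n : SimplexCategory} (θ : l ⟶ n) (c : Fin m) :
    rwOp (reprSurj k ⟨m⟩) θ (basisElt k (constStr n.len) (pointAt c)) =
      basisElt k (constStr l.len) (pointAt c) := by
  refine (PStr.rwOp_basisElt k θ (constStr n.len) (pointAt c)).trans ?_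
  rw [← PStr.ofStr_total]
  exact PStr.Equiv.total_eq (PStr.Equiv.ofEq (fun _ _ => Iff.rfl) (fun _ _ _ => rfl)
    fun _ => rfl) k

/-- The operator of the Robinson-Whitehouse module given by precomposition. -/
noncomputable def rwReprOp {m m' : GammaCat} (f : m' ⟶ m) (n : ℕ) :
    (⨁ s : Str n, (reprSurj k m).obj (addBase.obj (s.1.obj 0))) →ₗ[k]
      (⨁ s : Str n, (reprSurj k m').obj (addBase.obj (s.1.obj 0))) :=
  ((rwReprMap k f).app (Opposite.op (SimplexCategory.mk n))).hom

theorem rwReprOp_basisElt {m m' : GammaCat} (f : m' ⟶ m) {n : ℕ}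
    (s : Str n) (γ : m ⟶ (⟨(s.1.obj 0).card⟩ : GammaCat)) :
    rwReprOp k f n (basisElt k s γ) = basisElt k s (f ≫ γ) :=
  rwReprMap_basisElt k f (Opposite.op (SimplexCategory.mk n)) s γ

/-- Linear form of `cylOp_zero`: the coefficients of the constant strings are the coordinates of the
augmentation, which is what allows the parity argument for cycles below. -/
theorem cylOp_zero_apply {m n : ℕ}
    (x : ⨁ s : Str n, (reprSurj k ⟨m⟩).obj (addBase.obj (s.1.obj 0))) :
    PStr.cylOp k m n (OrderHom.const _ 0) x =
      (2 : k) • rwReprOp k (GammaCat.zeroHom ⟨m⟩ ⟨m⟩) n x +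
      ∑ c : Fin m, evalAt k ⟨m⟩ c.succ (aug k ⟨m⟩ n x) •
        basisElt k (constStr n) (pointAt c) := by
  have h : PStr.cylOp k m n (OrderHom.const _ 0) =
      (2 : k) • rwReprOp k (GammaCat.zeroHom ⟨m⟩ ⟨m⟩) n +
        ∑ c : Fin m, (evalAt k ⟨m⟩ c.succ ∘ₗ aug k ⟨m⟩ n).smulRight
        (basisElt k (constStr n) (pointAt c)) := by
    refine basis_hom_ext fun s γ => ?_
    rw [PStr.cylOp_zero k _ (fun _ => rfl), LinearMap.add_apply, LinearMap.smul_apply,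
      LinearMap.sum_apply, rwReprOp_basisElt]
    refine congrArg₂ (· + ·) (congrArg _ ?_) (Finset.sum_congr rfl fun c _ => ?_)
    · exact congrArg (basisElt k s) (GammaCat.zeroHom_comp _ γ).symm
    · rw [LinearMap.smulRight_apply, LinearMap.comp_apply, aug_basisElt]
      change _ = (if γ.toFun c.succ = 0 then (0 : k) else 1) • _
      split_ifs
      · rw [zero_smul]
      · rw [one_smul]
  rw [h, LinearMap.add_apply, LinearMap.smul_apply, LinearMap.sum_apply]
  rfl

theorem chains_d_apply (X : SimplicialObject (ModuleCat.{u} k)) (n : ℕ)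
    (x : (chains X).X (n + 1)) :
    ((chains X).d (n + 1) n).hom x = ∑ i : Fin (n + 2), (-1 : ℤ) ^ (i : ℕ) • (X.δ i).hom x := by
  rw [AlgebraicTopology.alternatingFaceMapComplex_obj_d,
    AlgebraicTopology.AlternatingFaceMapComplex.objD, ModuleCat.hom_sum, LinearMap.sum_apply]
  refine Finset.sum_congr rfl fun i _ => ?_
  rw [ModuleCat.hom_zsmul]
  rfl

/-- The boundary map of the Robinson-Whitehouse complex. -/
noncomputable def rwD (F : GammaSurj ⥤ ModuleCat.{u} k) (n : ℕ) :
    (⨁ s : Str (n + 1), F.obj (addBase.obj (s.1.obj 0))) →ₗ[k]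
      (⨁ s : Str n, F.obj (addBase.obj (s.1.obj 0))) :=
  ((chains (rwComplex F)).d (n + 1) n).hom

theorem rwD_apply (F : GammaSurj ⥤ ModuleCat.{u} k) (n : ℕ)
    (x : ⨁ s : Str (n + 1), F.obj (addBase.obj (s.1.obj 0))) :
    rwD k F n x = ∑ i : Fin (n + 2), (-1 : ℤ) ^ (i : ℕ) • rwOp F (SimplexCategory.δ i) x :=
  chains_d_apply k (rwComplex F) n x

theorem sum_neg_one_zsmul {N : Type*} [AddCommGroup N] (n : ℕ) (x : N) :
    ∑ i : Fin n, (-1 : ℤ) ^ (i : ℕ) • x = if Even n then 0 else x := by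
  rw [← Finset.sum_smul, Fin.sum_neg_one_pow]
  split_ifs
  · exact zero_smul ℤ x
  · exact one_smul ℤ x

/-- Each of the `n + 2` faces preserves the augmentation, so only the alternating sum of `n + 2`
signs matters. -/
theorem aug_rwD {m : GammaCat} (n : ℕ)
    (x : ⨁ s : Str (n + 1), (reprSurj k m).obj (addBase.obj (s.1.obj 0))) :
    aug k m n (rwD k (reprSurj k m) n x) = if Even n then 0 else aug k m (n + 1) x := by
  rw [rwD_apply, map_sum]
  have h : ∀ i : Fin (n + 2), aug k m n ((-1 : ℤ) ^ (i : ℕ) •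
      rwOp (reprSurj k m) (SimplexCategory.δ i) x) = (-1 : ℤ) ^ (i : ℕ) • aug k m (n + 1) x := by
    intro i
    rw [map_zsmul]
    exact congrArg _ (congrArg (fun f => f x) (aug_rwOp k (SimplexCategory.δ i)))
  rw [Finset.sum_congr rfl fun i _ => h i, sum_neg_one_zsmul]
  simp [Nat.even_add]

/-- All faces of a constant string are constant strings with the same mark, so the boundary
alternates between zero and an identification. -/
theorem rwD_constStr {m : ℕ} (n : ℕ) (c : Fin m) :
    rwD k (reprSurj k ⟨m⟩) n (basisElt k (constStr (n + 1)) (pointAt c)) =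
      if Even n then 0 else basisElt k (constStr n) (pointAt c) := by
  rw [rwD_apply]
  rw [Finset.sum_congr rfl fun i _ => congrArg _ (rwOp_constStr k (SimplexCategory.δ i) c)]
  rw [sum_neg_one_zsmul]
  simp [Nat.even_add]

theorem rwReprOp_rwD {m m' : GammaCat} (f : m' ⟶ m) (n : ℕ)
    (x : ⨁ s : Str (n + 1), (reprSurj k m).obj (addBase.obj (s.1.obj 0))) :
    rwReprOp k f n (rwD k (reprSurj k m) n x) =
      rwD k (reprSurj k m') n (rwReprOp k f (n + 1) x) :=
  congrArg (fun g => g.hom x) (((AlgebraicTopology.alternatingFaceMapComplex _).map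
    (rwReprMap k f)).comm (n + 1) n).symm

theorem exists_cyl_zero {m : ℕ}
    (x : ⨁ s : Str 0, (reprSurj k ⟨m⟩).obj (addBase.obj (s.1.obj 0))) :
    ∃ y, PStr.cylOp k m 0 (OrderHom.const _ 0) x = rwD k (reprSurj k ⟨m⟩) 0 y + x := by
  have h := congrArg (fun g => g.hom x) ((cylHomotopy k m).toChainHomotopy.comm 0)
  rw [Homotopy.dNext_zero_chainComplex, Homotopy.prevD_chainComplex, zero_add] at h
  exact ⟨_, h⟩

/-- The homotopy formula applied to a cycle: the term which first takes the boundary drops out. -/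
theorem exists_cyl_succ {m : ℕ} (n : ℕ)
    (x : ⨁ s : Str (n + 1), (reprSurj k ⟨m⟩).obj (addBase.obj (s.1.obj 0)))
    (hx : rwD k (reprSurj k ⟨m⟩) n x = 0) :
    ∃ y, PStr.cylOp k m (n + 1) (OrderHom.const _ 0) x =
      rwD k (reprSurj k ⟨m⟩) (n + 1) y + x := by
  have h := congrArg (fun g => g.hom x) ((cylHomotopy k m).toChainHomotopy.comm (n + 1))
  rw [Homotopy.dNext_succ_chainComplex, Homotopy.prevD_chainComplex] at h
  refine ⟨((cylHomotopy k m).toChainHomotopy.hom (n + 1) (n + 2)).hom x, h.trans ?_⟩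
  have h0 : ((cylHomotopy k m).toChainHomotopy.hom n (n + 1)).hom
      (rwD k (reprSurj k ⟨m⟩) n x) = 0 := by
    rw [hx]
    exact map_zero _
  refine (congrArg (fun v => v + _ + _) h0).trans ?_
  rw [zero_add]
  rfl

/-- Forgetting all marks factors through the complex for `[0]`, so its effect on homology is
governed by that complex. -/
theorem rwReprOp_zeroHom {m n : ℕ}
    (x : ⨁ s : Str n, (reprSurj k ⟨m⟩).obj (addBase.obj (s.1.obj 0))) :
    rwReprOp k (GammaCat.zeroHom ⟨m⟩ ⟨m⟩) n x =
      rwReprOp k (GammaCat.zeroHom ⟨m⟩ ⟨0⟩) n (rwReprOp k (GammaCat.zeroHom ⟨0⟩ ⟨m⟩) n x) := by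
  have h : rwReprOp k (GammaCat.zeroHom ⟨m⟩ ⟨m⟩) n =
      rwReprOp k (GammaCat.zeroHom ⟨m⟩ ⟨0⟩) n ∘ₗ rwReprOp k (GammaCat.zeroHom ⟨0⟩ ⟨m⟩) n := by
    refine basis_hom_ext fun s γ => ?_
    rw [LinearMap.comp_apply, rwReprOp_basisElt, rwReprOp_basisElt, rwReprOp_basisElt,
      GammaCat.zeroHom_comp, GammaCat.zeroHom_comp]
  rw [h]
  rfl

theorem rwReprOp_zeroHom_zero {n : ℕ}
    (x : ⨁ s : Str n, (reprSurj k ⟨0⟩).obj (addBase.obj (s.1.obj 0))) :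
    rwReprOp k (GammaCat.zeroHom ⟨0⟩ ⟨0⟩) n x = x := by
  have h : rwReprOp k (GammaCat.zeroHom ⟨0⟩ ⟨0⟩) n = LinearMap.id := by
    refine basis_hom_ext fun s γ => ?_
    rw [rwReprOp_basisElt, LinearMap.id_apply]
    exact congrArg _ (GammaCat.hom_eq_of_succ fun c => c.elim0)
  rw [h]
  rfl

/-- With no marks there is nothing to forget and there are no constant terms, so the homotopy
formula reads `2x = dy + x` and `x` is the boundary of `y`. A single copy in the cylinder would only
give `x = dy + x`. -/
theorem exists_boundary_of_zero {n : ℕ}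
    (x : ⨁ s : Str n, (reprSurj k ⟨0⟩).obj (addBase.obj (s.1.obj 0)))
    (h : ∃ y, PStr.cylOp k 0 n (OrderHom.const _ 0) x = rwD k (reprSurj k ⟨0⟩) n y + x) :
    ∃ y, rwD k (reprSurj k ⟨0⟩) n y = x := by
  obtain ⟨y, hy⟩ := h
  rw [cylOp_zero_apply, rwReprOp_zeroHom_zero, Finset.univ_eq_empty, Finset.sum_empty, add_zero,
    two_smul, add_left_inj] at hy
  exact ⟨y, hy.symm⟩

theorem exists_boundary_unmarked {m n : ℕ}
    (x : ⨁ s : Str n, (reprSurj k ⟨m⟩).obj (addBase.obj (s.1.obj 0)))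
    (h : ∃ y, rwD k (reprSurj k ⟨0⟩) n y = rwReprOp k (GammaCat.zeroHom ⟨0⟩ ⟨m⟩) n x) :
    ∃ y, rwD k (reprSurj k ⟨m⟩) n y = rwReprOp k (GammaCat.zeroHom ⟨m⟩ ⟨m⟩) n x := by
  obtain ⟨y, hy⟩ := h
  refine ⟨rwReprOp k (GammaCat.zeroHom ⟨m⟩ ⟨0⟩) (n + 1) y, ?_⟩
  rw [← rwReprOp_rwD, hy, ← rwReprOp_zeroHom]

/-- The Robinson-Whitehouse complex of `k[Γ([m], -)]` is exact in positive degrees. -/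
theorem exists_boundary_succ (m n : ℕ)
    (x : ⨁ s : Str (n + 1), (reprSurj k ⟨m⟩).obj (addBase.obj (s.1.obj 0)))
    (hx : rwD k (reprSurj k ⟨m⟩) n x = 0) : ∃ y, rwD k (reprSurj k ⟨m⟩) (n + 1) y = x := by
  obtain ⟨y, hy⟩ := exists_cyl_succ k n x hx
  have hz : rwD k (reprSurj k ⟨0⟩) n (rwReprOp k (GammaCat.zeroHom ⟨0⟩ ⟨m⟩) (n + 1) x) = 0 := by
    rw [← rwReprOp_rwD, hx, map_zero]
  obtain ⟨z, hz'⟩ := exists_boundary_unmarked k x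
    (exists_boundary_of_zero k _ (exists_cyl_succ k n _ hz))
  have hc : ∃ w, rwD k (reprSurj k ⟨m⟩) (n + 1) w =
      ∑ c : Fin m, evalAt k ⟨m⟩ c.succ (aug k ⟨m⟩ (n + 1) x) •
        basisElt k (constStr (n + 1)) (pointAt c) := by
    -- The constant strings have degree `n + 1`. If this is odd they are boundaries of constant
    -- strings of degree `n + 2`; if it is even, all faces but one cancel in the augmentation of
    -- `dx`, so `dx = 0` forces the coefficients to vanish.
    by_cases hn : Even n
    · refine ⟨∑ c : Fin m, evalAt k ⟨m⟩ c.succ (aug k ⟨m⟩ (n + 1) x) •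
        basisElt k (constStr (n + 2)) (pointAt c), ?_⟩
      rw [map_sum]
      refine Finset.sum_congr rfl fun c _ => ?_
      rw [map_smul, rwD_constStr, if_neg (by simp [Nat.even_add_one, hn])]
    · have h0 : aug k ⟨m⟩ (n + 1) x = 0 := by
        have := aug_rwD k n x
        rw [hx, map_zero, if_neg hn] at this
        exact this.symm
      refine ⟨0, ?_⟩
      rw [h0, map_zero]
      refine (Finset.sum_eq_zero fun c _ => ?_).symm
      rw [map_zero, zero_smul]
  obtain ⟨w, hw⟩ := hc
  rw [cylOp_zero_apply, ← hz', ← hw] at hy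
  -- The homotopy formula now reads `2 dz + dw = dy + x`.
  refine ⟨(2 : k) • z + w - y, ?_⟩
  rw [map_sub, map_add, map_smul, hy, add_sub_cancel_left]

/-- The kernel of the augmentation of the Robinson-Whitehouse complex of `k[Γ([m], -)]`. -/
theorem exists_boundary_zero (m : ℕ)
    (x : ⨁ s : Str 0, (reprSurj k ⟨m⟩).obj (addBase.obj (s.1.obj 0)))
    (hx : aug k ⟨m⟩ 0 x = 0) : ∃ y, rwD k (reprSurj k ⟨m⟩) 0 y = x := by
  obtain ⟨y, hy⟩ := exists_cyl_zero k x
  obtain ⟨z, hz'⟩ := exists_boundary_unmarked k x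
    (exists_boundary_of_zero k _ (exists_cyl_zero k _))
  rw [cylOp_zero_apply, ← hz', hx, Finset.sum_eq_zero (fun c _ => by rw [map_zero, zero_smul]),
    add_zero] at hy
  refine ⟨(2 : k) • z - y, ?_⟩
  rw [map_sub, map_smul, hy, add_sub_cancel_left]

/-- The one-point string marked by `c` alone maps to the basis vector of `t([m])` at `c`. -/
theorem aug_surjective (m : ℕ) : Function.Surjective (aug k ⟨m⟩ 0) := by
  intro v
  refine ⟨∑ c : Fin m, evalAt k ⟨m⟩ c.succ v • basisElt k (constStr 0) (pointAt c), ?_⟩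
  refine cochains_ext k fun d => ?_
  change evalAt k ⟨m⟩ d.succ _ = evalAt k ⟨m⟩ d.succ v
  rw [map_sum, map_sum]
  refine (Finset.sum_eq_single d ?_ fun h => absurd (Finset.mem_univ _) h).trans ?_
  · intro c _ hc
    rw [map_smul, map_smul, aug_basisElt]
    change _ • (if (pointAt c).toFun d.succ = 0 then (0 : k) else 1) = 0
    rw [pointAt_succ, if_neg hc.symm, if_pos rfl, smul_zero]
  · rw [map_smul, map_smul, aug_basisElt]
    change _ • (if (pointAt d).toFun d.succ = 0 then (0 : k) else 1) = _
    rw [pointAt_succ, if_pos rfl, if_neg one_ne_zero, smul_eq_mul, mul_one]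

end Acyclic
end GammaSym

namespace GammaSym

/-! ### A projective resolution of the cochain functor `t` -/

section Resolution

/-- Homology in a functor category is computed pointwise, so exactness for each `[m]` is enough. -/
theorem exact_of_evaluation {C D : Type*} [Category C] [Category D] [Abelian D]
    (S : ShortComplex (C ⥤ D)) (h : ∀ c, (S.map ((evaluation C D).obj c)).Exact) : S.Exact := by
  rw [ShortComplex.exact_iff_isZero_homology, Functor.isZero_iff]
  intro c
  exact ((ShortComplex.exact_iff_isZero_homology _).1 (h c)).of_iso
    (S.mapHomologyIso ((evaluation C D).obj c)).symm

variable (k : Type u) [CommRing k]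

/-- The Robinson-Whitehouse simplicial modules of the functors `k[Γ([m], -)]`, as a simplicial
right `Γ`-module. -/
noncomputable def resolutionSimplicial : SimplicialObject (GammaCatᵒᵖ ⥤ ModuleCat.{u} k) where
  obj Δ :=
    { obj := fun m => (rwRepr k m.unop).obj Δ
      map := fun f => (rwReprMap k f.unop).app Δ
      map_id := fun m => by
        ext1
        refine basis_hom_ext fun s γ => ?_
        refine (rwReprMap_basisElt k _ Δ s γ).trans ?_
        exact congrArg (basisElt k s) (Category.id_comp γ)
      map_comp := fun {m m' m''} f g => by
        ext1
        refine basis_hom_ext fun s γ => ?_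
        refine (rwReprMap_basisElt k _ Δ s γ).trans ?_
        refine Eq.trans ?_ ((congrArg ((rwReprMap k g.unop).app Δ).hom
          (rwReprMap_basisElt k f.unop Δ s γ)).trans (rwReprMap_basisElt k g.unop Δ s _)).symm
        exact congrArg (basisElt k s) (Category.assoc _ _ γ) }
  map θ :=
    { app := fun m => (rwRepr k m.unop).map θ
      naturality := fun m m' f => ((rwReprMap k f.unop).naturality θ).symm }
  map_id Δ := by
    ext m : 2
    exact (rwRepr k m.unop).map_id Δ
  map_comp θ η := by
    ext m : 2
    exact (rwRepr k m.unop).map_comp θ η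

/-- In degree `n`, and as a functor of `[m]`, this is the direct sum over the strings `s` of the
free representables `k[Γ(-, [s₀])]`. -/
noncomputable def resolutionComplex : ChainComplex (GammaCatᵒᵖ ⥤ ModuleCat.{u} k) ℕ :=
  (AlgebraicTopology.alternatingFaceMapComplex _).obj (resolutionSimplicial k)

theorem resolutionComplex_d_app (n : ℕ) (m : GammaCatᵒᵖ)
    (x : ⨁ s : Str (n + 1), (reprSurj k m.unop).obj (addBase.obj (s.1.obj 0))) :
    (((resolutionComplex k).d (n + 1) n).app m).hom x = rwD k (reprSurj k m.unop) n x := by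
  have h : ((resolutionComplex k).d (n + 1) n).app m =
      (chains (rwRepr k m.unop)).d (n + 1) n := by
    refine (congrArg (fun f : (resolutionComplex k).X (n + 1) ⟶ (resolutionComplex k).X n =>
      f.app m) (AlgebraicTopology.alternatingFaceMapComplex_obj_d _ n)).trans ?_
    rw [AlgebraicTopology.alternatingFaceMapComplex_obj_d]
    exact NatTrans.app_sum _ _ _
  exact congrArg (fun f => f.hom x) h

noncomputable def resolutionAug :
    (resolutionComplex k).X 0 ⟶ cochains k where
  app m := ModuleCat.ofHom (aug k m.unop 0)
  naturality {m m'} f := by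
    ext1
    refine basis_hom_ext fun s γ => ?_
    refine (congrArg (aug k m'.unop 0) (rwReprMap_basisElt k f.unop _ s γ)).trans ?_
    refine (aug_basisElt k s _).trans ?_
    refine Eq.trans ?_ (congrArg ((cochains k).map f).hom (aug_basisElt k s γ)).symm
    rfl

theorem resolution_d_aug : (resolutionComplex k).d 1 0 ≫ resolutionAug k = 0 := by
  ext m : 3
  refine LinearMap.ext fun x => ?_
  refine (congrArg (aug k m.unop 0) (resolutionComplex_d_app k 0 m x)).trans ?_
  exact (aug_rwD k 0 x).trans (if_pos Even.zero)

theorem resolution_exactAt_succ (n : ℕ) : (resolutionComplex k).ExactAt (n + 1) := by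
  rw [HomologicalComplex.exactAt_iff' _ (n + 1 + 1) (n + 1) n (by simp) (by simp)]
  refine exact_of_evaluation _ fun m => ?_
  rw [ShortComplex.moduleCat_exact_iff]
  intro x hx
  obtain ⟨y, hy⟩ := exists_boundary_succ k m.unop.n n x
    ((resolutionComplex_d_app k n m x).symm.trans hx)
  exact ⟨y, (resolutionComplex_d_app k (n + 1) m y).trans hy⟩

theorem resolution_exact_zero :
    (ShortComplex.mk _ _ (resolution_d_aug k)).Exact := by
  refine exact_of_evaluation _ fun m => ?_
  rw [ShortComplex.moduleCat_exact_iff]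
  intro x hx
  obtain ⟨y, hy⟩ := exists_boundary_zero k m.unop.n x hx
  exact ⟨y, (resolutionComplex_d_app k 0 m y).trans hy⟩

instance : Epi (resolutionAug k) := by
  rw [NatTrans.epi_iff_epi_app]
  intro m
  rw [ModuleCat.epi_iff_surjective]
  exact aug_surjective k m.unop.n

/-- Yoneda lemma: every generator `(s, γ)` is the restriction along `γ` of the universal one `(s,
1)`. -/
theorem resolution_hom_ext {n : ℕ} {X : GammaCatᵒᵖ ⥤ ModuleCat.{u} k}
    {f g : (resolutionComplex k).X n ⟶ X}
    (h : ∀ s : Str n,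
      (f.app (Opposite.op ⟨(s.1.obj 0).card⟩)).hom (basisElt k s (𝟙 _)) =
        (g.app (Opposite.op ⟨(s.1.obj 0).card⟩)).hom (basisElt k s (𝟙 _))) : f = g := by
  ext m : 3
  refine basis_hom_ext fun s γ => ?_
  have e : (((resolutionComplex k).X n).map γ.op).hom (basisElt k s (𝟙 _)) = basisElt k s γ :=
    (rwReprMap_basisElt k γ (Opposite.op (SimplexCategory.mk n)) s (𝟙 _)).trans
      (congrArg (basisElt k s) (Category.comp_id γ))
  rw [← e]
  refine (congrArg (fun a => a.hom (basisElt k s (𝟙 _))) (f.naturality γ.op)).trans ?_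
  refine Eq.trans ?_ (congrArg (fun a => a.hom (basisElt k s (𝟙 _))) (g.naturality γ.op)).symm
  exact congrArg (X.map γ.op).hom (h s)

/-- The other half of the Yoneda lemma: the images of the universal generators can be prescribed
freely. Projectivity follows by lifting these images through a pointwise surjection. -/
noncomputable def resolutionLift {n : ℕ} {X : GammaCatᵒᵖ ⥤ ModuleCat.{u} k}
    (z : ∀ s : Str n, X.obj (Opposite.op ⟨(s.1.obj 0).card⟩)) :
    (resolutionComplex k).X n ⟶ X where
  app m := ModuleCat.ofHom (basisLift fun s (γ : m.unop ⟶ _) => (X.map γ.op).hom (z s))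
  naturality {m m'} f := by
    ext1
    refine basis_hom_ext fun s γ => ?_
    refine (congrArg (basisLift fun s (γ : m'.unop ⟶ _) => (X.map γ.op).hom (z s))
      (rwReprMap_basisElt k f.unop _ s γ)).trans ?_
    refine (basisLift_basisElt _ s _).trans ?_
    refine Eq.trans ?_ (congrArg (X.map f).hom (basisLift_basisElt _ s γ)).symm
    exact congrArg (fun g => g.hom (z s)) (X.map_comp γ.op f)

theorem resolutionLift_basisElt {n : ℕ} {X : GammaCatᵒᵖ ⥤ ModuleCat.{u} k}
    (z : ∀ s : Str n, X.obj (Opposite.op ⟨(s.1.obj 0).card⟩)) (s : Str n) :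
    ((resolutionLift k z).app (Opposite.op ⟨(s.1.obj 0).card⟩)).hom (basisElt k s (𝟙 _)) = z s :=
  (basisLift_basisElt _ s (𝟙 _)).trans (congrArg (fun g => g.hom (z s)) (X.map_id _))

instance (n : ℕ) : Projective ((resolutionComplex k).X n) where
  factors {X Y} f e he := by
    have hsurj : ∀ d, Function.Surjective (e.app d).hom := fun d =>
      (ModuleCat.epi_iff_surjective _).1 inferInstance
    choose z hz using fun s : Str n => hsurj (Opposite.op ⟨(s.1.obj 0).card⟩)
      ((f.app (Opposite.op ⟨(s.1.obj 0).card⟩)).hom (basisElt k s (𝟙 _)))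
    refine ⟨resolutionLift k z, resolution_hom_ext k fun s => ?_⟩
    refine Eq.trans ?_ (hz s)
    exact congrArg (e.app _).hom (resolutionLift_basisElt k z s)

noncomputable def cochainsResolution : ProjectiveResolution (cochains k) where
  complex := resolutionComplex k
  projective n := inferInstance
  π := (ChainComplex.toSingle₀Equiv _ _).symm ⟨resolutionAug k, resolution_d_aug k⟩
  quasiIso := ⟨fun n => by
    cases n
    -- In degree 0 the condition is that the augmentation is an epimorphism whose kernel is the
    -- image of the differential; in positive degrees it is exactness of the complex.
    · rw [ChainComplex.quasiIsoAt₀_iff, ShortComplex.quasiIso_iff_of_zeros']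
      · refine (ShortComplex.exact_and_epi_g_iff_of_iso ?_).2
          ⟨resolution_exact_zero k, by dsimp; infer_instance⟩
        exact ShortComplex.isoMk (Iso.refl _) (Iso.refl _) (Iso.refl _)
          (by simp; exact (Category.id_comp _).trans (Category.comp_id _).symm)
          (by simp; exact (Category.id_comp _).trans (Category.comp_id _).symm)
      all_goals rfl
    · rw [quasiIsoAt_iff_exactAt']
      · apply resolution_exactAt_succ
      · apply ChainComplex.exactAt_succ_single_obj⟩

end Resolution
end GammaSym

namespace GammaSym

/-! ### Tensoring the resolution with a left `Γ`-module -/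

section TensorComparison

variable {k : Type u} [CommRing k]

theorem rwTerm_basisElt {m : GammaCat} {l n : SimplexCategory} (θ : l ⟶ n) (s : Str n.len)
    (γ : m ⟶ (⟨(s.1.obj 0).card⟩ : GammaCat))
    (i : Fin (s.1.obj (θ.toOrderHom (Fin.last l.len))).card) :
    rwTerm (reprSurj k m) θ s i (Finsupp.single γ 1) =
      basisElt k (componentStr (pull θ s.1) i)
        (γ ≫ (addBase.map (toStart θ s.1) ≫ collapse (pull θ s.1) i).hom) :=
  congrArg (DirectSum.lof k (Str l.len)
    (fun s => (reprSurj k m).obj (addBase.obj (s.1.obj 0))) _) Finsupp.mapDomain_single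

theorem basisLift_rwOp {m : GammaCat} {l n : SimplexCategory} {N : Type u} [AddCommGroup N]
    [Module k N] (v : ∀ s : Str l.len, (m ⟶ (⟨(s.1.obj 0).card⟩ : GammaCat)) → N)
    (θ : l ⟶ n) (s : Str n.len) (γ : m ⟶ (⟨(s.1.obj 0).card⟩ : GammaCat)) :
    basisLift v (rwOp (reprSurj k m) θ (basisElt k s γ)) =
      ∑ i : Fin (s.1.obj (θ.toOrderHom (Fin.last l.len))).card,
        v (componentStr (pull θ s.1) i)
          (γ ≫ (addBase.map (toStart θ s.1) ≫ collapse (pull θ s.1) i).hom) := by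
  refine (congrArg (basisLift v) (rwOp_lof (reprSurj k m) θ s _)).trans ?_
  rw [map_sum]
  refine Finset.sum_congr rfl fun i _ => ?_
  exact (congrArg (basisLift v) (rwTerm_basisElt θ s γ i)).trans (basisLift_basisElt v _ _)

variable (F : GammaCat ⥤ ModuleCat.{u} k)

/-- The restriction of a left `Γ`-module to the surjective based maps. -/
noncomputable abbrev restrictSurj : GammaSurj ⥤ ModuleCat.{u} k :=
  wideSubcategoryInclusion gammaSurj ⋙ F

noncomputable local instance : DecidableEq GammaCat := Classical.decEq _

/-- `(s, γ) ⊗ y ↦ (s, F(γ)(y))`. -/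
noncomputable def contract (n : ℕ) (c : GammaCat) :
    (⨁ s : Str n, (reprSurj k c).obj (addBase.obj (s.1.obj 0))) →ₗ[k] F.obj c →ₗ[k]
      (⨁ s : Str n, (restrictSurj F).obj (addBase.obj (s.1.obj 0))) :=
  basisLift fun s γ => DirectSum.lof k (Str n)
    (fun s => (restrictSurj F).obj (addBase.obj (s.1.obj 0))) s ∘ₗ (F.map γ).hom

theorem contract_basisElt {n : ℕ} {c : GammaCat} (s : Str n)
    (γ : c ⟶ (⟨(s.1.obj 0).card⟩ : GammaCat)) (y : F.obj c) :
    contract F n c (basisElt k s γ) y = DirectSum.lof k (Str n)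
      (fun s => (restrictSurj F).obj (addBase.obj (s.1.obj 0))) s ((F.map γ).hom y) :=
  congrArg (fun f : F.obj c →ₗ[k] _ => f y) (basisLift_basisElt _ s γ)

/-- Contraction is balanced over `Γ`, since `F(α ≫ γ)` is `F(α)` followed by `F(γ)`; it therefore
descends to the tensor product. -/
theorem contract_map {n : ℕ} {c c' : GammaCat} (α : c ⟶ c')
    (x : ⨁ s : Str n, (reprSurj k c').obj (addBase.obj (s.1.obj 0))) (y : F.obj c) :
    contract F n c (rwReprOp k α n x) y = contract F n c' x ((F.map α).hom y) := by
  have h : contract F n c ∘ₗ rwReprOp k α n =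
      ((F.map α).hom.lcomp k _) ∘ₗ contract F n c' := by
    refine basis_hom_ext fun s γ => LinearMap.ext fun y => ?_
    refine (congrArg (fun z => contract F n c z y) (rwReprOp_basisElt k α s γ)).trans ?_
    refine (contract_basisElt F s _ y).trans ?_
    refine Eq.trans ?_ (contract_basisElt F s γ ((F.map α).hom y)).symm
    refine congrArg _ ?_
    exact congrArg (fun g => g.hom y) (F.map_comp α γ)
  exact congrArg (fun f : _ →ₗ[k] _ →ₗ[k] _ => f x y) h

/-- An operator changes `γ` by composition with a based map which depends only on `s` and `i`.
Functoriality of `F` turns this into the operator of `F`. -/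
theorem contract_rwOp {l n : SimplexCategory} (θ : l ⟶ n) {c : GammaCat}
    (x : ⨁ s : Str n.len, (reprSurj k c).obj (addBase.obj (s.1.obj 0))) (y : F.obj c) :
    contract F l.len c (rwOp (reprSurj k c) θ x) y =
      rwOp (restrictSurj F) θ (contract F n.len c x y) := by
  have h : contract F l.len c ∘ₗ rwOp (reprSurj k c) θ =
      (rwOp (restrictSurj F) θ).compRight k ∘ₗ contract F n.len c := by
    refine basis_hom_ext fun s γ => LinearMap.ext fun y => ?_
    refine (congrArg (fun f : F.obj c →ₗ[k] _ => f y) (basisLift_rwOp _ θ s γ)).trans ?_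
    rw [LinearMap.sum_apply]
    refine Eq.trans ?_ (congrArg (rwOp (restrictSurj F) θ) (contract_basisElt F s γ y)).symm
    refine Eq.trans ?_ (rwOp_lof (restrictSurj F) θ s ((F.map γ).hom y)).symm
    refine Finset.sum_congr rfl fun i _ => ?_
    refine congrArg (DirectSum.lof k (Str l.len)
      (fun s => (restrictSurj F).obj (addBase.obj (s.1.obj 0))) _) ?_
    have e := F.map_comp γ (addBase.map (toStart θ s.1) ≫ collapse (pull θ s.1) i).hom
    exact congrArg (fun g => g.hom y) e
  exact congrArg (fun f : _ →ₗ[k] _ →ₗ[k] _ => f x y) h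

/-- The module of the `n`-simplices of the resolution. -/
noncomputable abbrev resolutionObj (k : Type u) [CommRing k] (Δ : SimplexCategoryᵒᵖ) :
    GammaCatᵒᵖ ⥤ ModuleCat.{u} k := (resolutionSimplicial k).obj Δ

/-- The class of `x ⊗ y` in the tensor product with the `n`-simplices of the resolution. -/
noncomputable def tensorMk (Δ : SimplexCategoryᵒᵖ) (c : GammaCat) :
    (⨁ s : Str Δ.unop.len, (reprSurj k c).obj (addBase.obj (s.1.obj 0))) →ₗ[k] F.obj c →ₗ[k]
      (tensorOver F).obj (resolutionObj k Δ) :=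
  (TensorProduct.mk k ((resolutionObj k Δ).obj (Opposite.op c)) (F.obj c)).compr₂
    (Submodule.mkQ (tensorRel F (resolutionObj k Δ)) ∘ₗ DirectSum.lof k GammaCat
      (fun c => (resolutionObj k Δ).obj (Opposite.op c) ⊗[k] F.obj c) c)

theorem tensorMk_map (Δ : SimplexCategoryᵒᵖ) {c c' : GammaCat} (α : c ⟶ c')
    (x : ⨁ s : Str Δ.unop.len, (reprSurj k c').obj (addBase.obj (s.1.obj 0))) (y : F.obj c) :
    tensorMk F Δ c (rwReprOp k α Δ.unop.len x) y = tensorMk F Δ c' x ((F.map α).hom y) := by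
  refine (Submodule.Quotient.eq _).2 (Submodule.subset_span ⟨c, c', α, x, y, ?_⟩)
  rfl

/-- The quotient, the direct sum, the tensor product and the free modules all have extensionality
principles; together they reduce equality of maps to the classes `(s, γ) ⊗ y`. -/
theorem tensorMk_hom_ext {Δ : SimplexCategoryᵒᵖ} {N : Type u} [AddCommGroup N] [Module k N]
    {f g : (tensorOver F).obj (resolutionObj k Δ) →ₗ[k] N}
    (h : ∀ (c : GammaCat) (s : Str Δ.unop.len) (γ : c ⟶ (⟨(s.1.obj 0).card⟩ : GammaCat))
      (y : F.obj c), f (tensorMk F Δ c (basisElt k s γ) y) =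
        g (tensorMk F Δ c (basisElt k s γ) y)) : f = g := by
  refine tensor_hom_ext F fun c x y => ?_
  have e : (tensorMk F Δ c).compr₂ f = (tensorMk F Δ c).compr₂ g :=
    basis_hom_ext fun s γ => LinearMap.ext fun y => h c s γ y
  exact congrArg (fun l : _ →ₗ[k] _ →ₗ[k] _ => l x y) e

/-- The map `(s, γ) ⊗ y ↦ (s, F(γ)(y))`. -/
noncomputable def tensorContract (Δ : SimplexCategoryᵒᵖ) :
    (tensorOver F).obj (resolutionObj k Δ) →ₗ[k]
      (⨁ s : Str Δ.unop.len, (restrictSurj F).obj (addBase.obj (s.1.obj 0))) :=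
  Submodule.liftQ (tensorRel F (resolutionObj k Δ)) (DirectSum.toModule k GammaCat _ fun c =>
    TensorProduct.lift (contract F Δ.unop.len c)) <| by
    refine Submodule.span_le.2 ?_
    rintro _ ⟨c, c', α, x, y, rfl⟩
    rw [SetLike.mem_coe, LinearMap.mem_ker, map_sub, DirectSum.toModule_lof,
      DirectSum.toModule_lof]
    refine sub_eq_zero.2 ?_
    exact contract_map F α x y

theorem tensorContract_mk (Δ : SimplexCategoryᵒᵖ) (c : GammaCat)
    (x : ⨁ s : Str Δ.unop.len, (reprSurj k c).obj (addBase.obj (s.1.obj 0))) (y : F.obj c) :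
    tensorContract F Δ (tensorMk F Δ c x y) = contract F Δ.unop.len c x y := by
  refine (Submodule.liftQ_apply _ _ _).trans ?_
  refine (DirectSum.toModule_lof k (M := fun c =>
    (resolutionObj k Δ).obj (Opposite.op c) ⊗[k] F.obj c) c (x ⊗ₜ[k] y)).trans ?_
  exact TensorProduct.lift.tmul x y

/-- The map `(s, y) ↦ (s, 1) ⊗ y`. -/
noncomputable def tensorExpand (Δ : SimplexCategoryᵒᵖ) :
    (⨁ s : Str Δ.unop.len, (restrictSurj F).obj (addBase.obj (s.1.obj 0))) →ₗ[k]
    (tensorOver F).obj (resolutionObj k Δ) :=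
  DirectSum.toModule k _ _ fun s => (tensorMk F Δ ⟨(s.1.obj 0).card⟩ (basisElt k s (𝟙 _)) :
    (restrictSurj F).obj (addBase.obj (s.1.obj 0)) →ₗ[k] _)

theorem tensorExpand_lof (Δ : SimplexCategoryᵒᵖ) (s : Str Δ.unop.len)
    (y : (restrictSurj F).obj (addBase.obj (s.1.obj 0))) :
    tensorExpand F Δ (DirectSum.lof k (Str Δ.unop.len)
      (fun s => (restrictSurj F).obj (addBase.obj (s.1.obj 0))) s y) =
    tensorMk F Δ ⟨(s.1.obj 0).card⟩ (basisElt k s (𝟙 _)) y :=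
  DirectSum.toModule_lof k (M := fun s : Str Δ.unop.len =>
    (restrictSurj F).obj (addBase.obj (s.1.obj 0))) (φ := fun s =>
    (tensorMk F Δ ⟨(s.1.obj 0).card⟩ (basisElt k s (𝟙 _)) :
      (restrictSurj F).obj (addBase.obj (s.1.obj 0)) →ₗ[k] _)) s y

theorem tensorContract_expand (Δ : SimplexCategoryᵒᵖ) :
    tensorContract F Δ ∘ₗ tensorExpand F Δ = LinearMap.id := by
  refine DirectSum.linearMap_ext k fun s => LinearMap.ext fun y => ?_
  refine (congrArg (tensorContract F Δ) (tensorExpand_lof F Δ s y)).trans ?_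
  refine (tensorContract_mk F Δ _ _ y).trans ?_
  refine (contract_basisElt F s (𝟙 _) y).trans ?_
  exact congrArg (fun g : F.obj ⟨(s.1.obj 0).card⟩ ⟶ F.obj ⟨(s.1.obj 0).card⟩ =>
    DirectSum.lof k (Str Δ.unop.len)
      (fun s => (restrictSurj F).obj (addBase.obj (s.1.obj 0))) s (g.hom y)) (F.map_id _)

theorem tensorExpand_contract (Δ : SimplexCategoryᵒᵖ) :
    tensorExpand F Δ ∘ₗ tensorContract F Δ = LinearMap.id := by
  refine tensorMk_hom_ext F fun c s γ y => ?_
  refine (congrArg (tensorExpand F Δ) ((tensorContract_mk F Δ c _ y).trans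
    (contract_basisElt F s γ y))).trans ?_
  refine (tensorExpand_lof F Δ s _).trans ?_
  -- The defining relation moves `γ` across the tensor sign: `(s, 1) ⊗ F(γ)(y) = (s, γ) ⊗ y`.
  refine (tensorMk_map F Δ γ _ y).symm.trans ?_
  refine congrArg (fun x => tensorMk F Δ c x y) ?_
  exact (rwReprOp_basisElt k γ s (𝟙 _)).trans (congrArg (basisElt k s) (Category.comp_id γ))

/-- Tensoring the resolution with `F` gives the Robinson-Whitehouse module of `F`. -/
noncomputable def tensorResolutionIso :
    ((SimplicialObject.whiskering _ _).obj (tensorOver F)).obj (resolutionSimplicial k) ≅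
      rwComplex (restrictSurj F) :=
  NatIso.ofComponents (fun Δ =>
    { hom := ModuleCat.ofHom (tensorContract F Δ)
      inv := ModuleCat.ofHom (tensorExpand F Δ)
      hom_inv_id := by
        ext1
        exact tensorExpand_contract F Δ
      inv_hom_id := by
        ext1
        exact tensorContract_expand F Δ }) fun {Δ Δ'} θ => by
    ext1
    refine tensorMk_hom_ext F fun c s γ y => ?_
    have h : (((tensorOver F).map ((resolutionSimplicial k).map θ)).hom
        (tensorMk F Δ c (basisElt k s γ) y)) =
        tensorMk F Δ' c (rwOp (reprSurj k c) θ.unop (basisElt k s γ)) y :=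
      congrArg Submodule.Quotient.mk (tensorLin_lof F ((resolutionSimplicial k).map θ) c
        (basisElt k s γ) y)
    refine (congrArg (tensorContract F Δ') h).trans ?_
    refine (tensorContract_mk F Δ' c _ y).trans ?_
    refine (contract_rwOp F θ.unop (basisElt k s γ) y).trans ?_
    exact congrArg (rwOp (restrictSurj F) θ.unop) (tensorContract_mk F Δ c _ y).symm

/-- The homology of the Robinson-Whitehouse module of `F` is the `Γ`-homology of `F`. -/
noncomputable def homologyIsoHGammaOf (n : ℕ) :
    (chains (rwComplex (restrictSurj F))).homology n ≅ HGammaOf F n :=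
  ((HomologicalComplex.homologyFunctor _ _ n).mapIso
    (((AlgebraicTopology.alternatingFaceMapComplex _).mapIso (tensorResolutionIso F)).symm ≪≫
      -- Being additive, the tensor functor commutes with alternating sums of faces. The resulting
      -- complex is the tensor product with a projective resolution of `t`, and so computes the
      -- derived functor.
      eqToIso (congrArg (fun G => G.obj (resolutionSimplicial k))
        (AlgebraicTopology.map_alternatingFaceMapComplex (tensorOver F))).symm)) ≪≫
    ((cochainsResolution k).isoLeftDerivedObj (tensorOver F) n).symm

end TensorComparison
end GammaSym

namespace GammaSym

/-! ### The splitting `A = k ⊕ I` and the retraction of `CΓ_*(A, k)` -/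

section Retraction

variable {k A : Type u} [CommRing k] [CommRing A] [Algebra k A] (ε : A →ₐ[k] k)

/-- The projection of an augmented algebra onto its augmentation ideal. -/
def augProj : A →ₗ[k] augIdeal ε where
  toFun a := ⟨a - algebraMap k A (ε a), by
    rw [RingHom.mem_ker, map_sub]
    exact sub_eq_zero.2 (ε.commutes (ε a)).symm⟩
  map_add' a b := by
    ext
    change a + b - algebraMap k A (ε (a + b)) =
      (a - algebraMap k A (ε a)) + (b - algebraMap k A (ε b))
    rw [map_add, map_add]
    ring
  map_smul' c a := by
    ext
    change c • a - algebraMap k A (ε (c • a)) = c • (a - algebraMap k A (ε a))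
    rw [map_smul, smul_eq_mul, map_mul, smul_sub, Algebra.smul_def, Algebra.smul_def]

theorem augProj_coe (a : A) : (augProj ε a : A) = a - algebraMap k A (ε a) := rfl

theorem augProj_of_mem (a : augIdeal ε) : augProj ε (a : A) = a := by
  ext
  rw [augProj_coe, show ε (a : A) = 0 from a.2, map_zero, sub_zero]

theorem augProj_one : augProj ε 1 = 0 := by
  ext
  rw [augProj_coe, map_one, map_one, sub_self]
  rfl

/-- The projection `A^{⊗n} ⊗ M → I^{⊗n} ⊗ M`. -/
noncomputable def idealProj (M : Type u) [AddCommGroup M] [Module k M] (n : ℕ) :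
    ((⨂[k] _ : Fin n, A) ⊗[k] M) →ₗ[k] ((⨂[k] _ : Fin n, augIdeal ε) ⊗[k] M) :=
  TensorProduct.map (PiTensorProduct.map fun _ : Fin n => augProj ε) LinearMap.id

theorem idealProj_tmul (M : Type u) [AddCommGroup M] [Module k M] (n : ℕ) (y : Fin n → A)
    (m : M) : idealProj ε M n (PiTensorProduct.tprod k y ⊗ₜ m) =
      PiTensorProduct.tprod k (fun i => augProj ε (y i)) ⊗ₜ[k] m := by
  rw [idealProj, TensorProduct.map_tmul, PiTensorProduct.map_tprod]
  rfl

theorem idealProj_idealIncl (M : Type u) [AddCommGroup M] [Module k M] (n : ℕ)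
    (z : (⨂[k] _ : Fin n, augIdeal ε) ⊗[k] M) : idealProj ε M n (idealIncl ε M n z) = z := by
  have h : idealProj ε M n ∘ₗ idealIncl ε M n = LinearMap.id := by
    refine tensor_ext (N := (⨂[k] _ : Fin n, augIdeal ε) ⊗[k] M) fun y m => ?_
    rw [LinearMap.comp_apply, idealIncl_tmul, idealProj_tmul, LinearMap.id_apply]
    simp only [augProj_of_mem]
  exact LinearMap.congr_fun h z

/-- Along a surjective based map the products of elements of `I` stay in `I`, so the projection does
nothing to them. -/
theorem idealProj_lodayMap_idealIncl {a b : GammaSurj} (f : a ⟶ b)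
    (z : (⨂[k] _ : Fin a.obj.n, augIdeal ε) ⊗[k] Triv ε) :
    idealProj ε (Triv ε) b.obj.n (lodayMap k A (Triv ε) f.hom (idealIncl ε _ _ z)) =
      lodayIdealMap ε (Triv ε) f z := by
  have h := congrArg (fun g => g.hom z) ((lodayIncl ε (Triv ε)).naturality f)
  exact (congrArg (idealProj ε (Triv ε) b.obj.n) h.symm).trans (idealProj_idealIncl ε _ _ _)

/-- A missed point `j` receives the empty product 1, whose component in `I` is zero. -/
theorem idealProj_lodayMap_eq_zero {a b : GammaCat} (f : a ⟶ b) (j : Fin b.n)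
    (hj : ∀ i : Fin a.n, f.toFun i.succ ≠ j.succ) (x : (⨂[k] _ : Fin a.n, A) ⊗[k] Triv ε) :
    idealProj ε (Triv ε) b.n (lodayMap k A (Triv ε) f x) = 0 := by
  have h : idealProj ε (Triv ε) b.n ∘ₗ lodayMap k A (Triv ε) f = 0 := by
    refine tensor_ext (N := (⨂[k] _ : Fin b.n, augIdeal ε) ⊗[k] Triv ε) fun y m => ?_
    rw [LinearMap.comp_apply, lodayMap_tmul, idealProj_tmul,
      (PiTensorProduct.tprod k).map_coord_zero j, TensorProduct.zero_tmul, LinearMap.zero_apply]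
    rw [fibProd, Finset.filter_false_of_mem fun i _ => hj i, Finset.prod_empty, augProj_one]
  exact LinearMap.congr_fun h x

/-- A factor from `I` sent to the basepoint acts on `k` through the augmentation, that is, by zero.
-/
theorem lodayMap_idealIncl_eq_zero {a b : GammaCat} (f : a ⟶ b) (i : Fin a.n)
    (hi : f.toFun i.succ = 0) (z : (⨂[k] _ : Fin a.n, augIdeal ε) ⊗[k] Triv ε) :
    lodayMap k A (Triv ε) f (idealIncl ε _ _ z) = 0 := by
  have h : lodayMap k A (Triv ε) f ∘ₗ idealIncl ε (Triv ε) a.n = 0 := by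
    refine tensor_ext fun y m => ?_
    rw [LinearMap.comp_apply, idealIncl_tmul, lodayMap_tmul, LinearMap.zero_apply, Triv.smul_def,
      (RingHom.mem_ker).1 (fibProd_mem ε (fun i : Fin a.n => f.toFun i.succ) 0 ⟨i, hi⟩ y)]
    exact (congrArg _ (zero_smul k m)).trans (TensorProduct.tmul_zero _ _)
  exact LinearMap.congr_fun h z

theorem lodayMap_comp {a b c : GammaCat} (f : a ⟶ b) (g : b ⟶ c)
    (x : (⨂[k] _ : Fin a.n, A) ⊗[k] Triv ε) :
    lodayMap k A (Triv ε) g (lodayMap k A (Triv ε) f x) = lodayMap k A (Triv ε) (f ≫ g) x :=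
  (congrArg (fun h => h.hom x) ((loday k A (Triv ε)).map_comp f g)).symm

/-- The based map given by an injection. -/
def embBase {a b : ℕ} (e : Fin b ↪o Fin a) : (⟨b⟩ : GammaCat) ⟶ (⟨a⟩ : GammaCat) :=
  ⟨Fin.cases 0 fun p => (e p).succ, rfl⟩

theorem embBase_succ {a b : ℕ} (e : Fin b ↪o Fin a) (p : Fin b) :
    (embBase e).toFun p.succ = (e p).succ := rfl

/-- An injection of based sets fills the places outside its image with 1; this realizes `I^{⊗S}`
inside `A^{⊗a}`. -/
theorem lodayMap_embBase_tmul {a b : ℕ} (e : Fin b ↪o Fin a) (y : Fin a → A) (m : Triv ε)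
    (hy : ∀ i, i ∉ Set.range e → y i = 1) :
    lodayMap k A (Triv ε) (embBase e) (PiTensorProduct.tprod k (fun i => y (e i)) ⊗ₜ m) =
      PiTensorProduct.tprod k y ⊗ₜ[k] m := by
  rw [lodayMap_tmul]
  have h0 : fibProd (fun i : Fin b => (embBase e).toFun i.succ) 0 (fun i => y (e i)) = 1 := by
    refine Finset.prod_eq_one fun i hi => ?_
    exact absurd (Finset.mem_filter.1 hi).2 (Fin.succ_ne_zero _)
  have h1 : (fun j : Fin a => fibProd (fun i : Fin b => (embBase e).toFun i.succ) j.succ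
      (fun i => y (e i))) = y := by
    funext j
    by_cases hj : j ∈ Set.range e
    · obtain ⟨i, rfl⟩ := hj
      rw [fibProd, Finset.prod_eq_single_of_mem i (by simp [embBase_succ])]
      intro i' hi' hne
      rw [Finset.mem_filter, embBase_succ, Fin.succ_inj] at hi'
      exact absurd (e.injective hi'.2) hne
    · rw [hy j hj, fibProd, Finset.filter_false_of_mem fun i _ => ?_, Finset.prod_empty]
      rw [embBase_succ, Fin.succ_inj]
      exact fun h => hj ⟨i, h⟩
  exact congrArg₂ (fun u v => PiTensorProduct.tprod k u ⊗ₜ[k] v) h1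
    ((congrArg (· • m) h0).trans (one_smul A m))

/-- A linear map out of `A^{⊗a} ⊗ k` is determined by its values on the tensors in `I^{⊗S}`, for
the subsets `S` of `{1, …, a}`. -/
theorem loday_hom_ext {a : ℕ} {N : Type u} [AddCommGroup N] [Module k N]
    {f g : ((⨂[k] _ : Fin a, A) ⊗[k] Triv ε) →ₗ[k] N}
    (h : ∀ S : Finset (Fin a), ∃ (b : ℕ) (e : Fin b ↪o Fin a), Set.range e = S ∧
      ∀ z, f (lodayMap k A (Triv ε) (embBase e) (idealIncl ε _ b z)) =
        g (lodayMap k A (Triv ε) (embBase e) (idealIncl ε _ b z))) : f = g := by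
  refine tensor_ext fun y m => ?_
  let φ (f : ((⨂[k] _ : Fin a, A) ⊗[k] Triv ε) →ₗ[k] N) : MultilinearMap k (fun _ : Fin a => A) N :=
    ((f ∘ₗ (TensorProduct.mk k _ _).flip m)).compMultilinearMap (PiTensorProduct.tprod k)
  change φ f y = φ g y
  -- Expanding the tensor multilinearly along `A = I ⊕ k` gives one term for each subset `S` of
  -- places where the component in `I` is chosen.
  have hy : y = (fun i => (augProj ε (y i) : A)) + fun i => ε (y i) • (1 : A) := by
    funext i
    rw [Pi.add_apply, augProj_coe, Algebra.smul_def, mul_one, sub_add_cancel]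
  rw [hy, MultilinearMap.map_add_univ, MultilinearMap.map_add_univ]
  refine Finset.sum_congr rfl fun S _ => ?_
  set y₁ : Fin a → A := S.piecewise (fun i => (augProj ε (y i) : A)) 1 with hy₁
  -- The scalars outside `S` are pulled out, leaving a tensor with entries in `I` on `S` and 1
  -- elsewhere.
  have hS : S.piecewise (fun i => (augProj ε (y i) : A)) (fun i => ε (y i) • (1 : A)) =
      Sᶜ.piecewise (fun i => ε (y i) • y₁ i) y₁ := by
    funext i
    by_cases hi : i ∈ S
    · simp [hi, hy₁]
    · simp [hi, hy₁]
  rw [hS, MultilinearMap.map_piecewise_smul, MultilinearMap.map_piecewise_smul]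
  refine congrArg _ ?_
  obtain ⟨b, e, he, hz⟩ := h S
  have hz' := hz (PiTensorProduct.tprod k (fun i => augProj ε (y (e i))) ⊗ₜ m)
  have hmem : ∀ i, e i ∈ S := fun i => by
    rw [← Finset.mem_coe, ← he]
    exact ⟨i, rfl⟩
  have hx : (fun i => (augProj ε (y (e i)) : A)) = fun i => y₁ (e i) := by
    funext i
    rw [hy₁, Finset.piecewise_eq_of_mem _ _ _ (hmem i)]
  rw [idealIncl_tmul, hx, lodayMap_embBase_tmul] at hz'
  · exact hz'
  · intro i hi
    rw [he, Finset.mem_coe] at hi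
    rw [hy₁, Finset.piecewise_eq_of_notMem _ _ _ hi]
    rfl

/-- The image of a nonempty subset of the first set of a string. -/
@[simps] def imageStr {n : ℕ} (s : Fin (n + 1) ⥤ Omega) (S : Finset (Fin (s.obj 0).card))
    (hS : S.Nonempty) : PStr (s.obj 0).card n (fun j => Fin (s.obj j).card) where
  W j := S.image (s.map (homOfLE (Fin.zero_le j))).toFun
  ψ h := (s.map (homOfLE h)).toFun
  g c j := if c ∈ S then some ((s.map (homOfLE (Fin.zero_le j))).toFun c) else none
  ne j := hS.image _
  maps {j j'} h y hy := by
    obtain ⟨p, hp, rfl⟩ := Finset.mem_image.1 hy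
    refine Finset.mem_image.2 ⟨p, hp, ?_⟩
    exact congrArg (fun f => Omega.Hom.toFun f p)
      (s.map_comp (homOfLE (Fin.zero_le j)) (homOfLE h))
  surj {j j'} h y' hy' := by
    obtain ⟨p, hp, rfl⟩ := Finset.mem_image.1 hy'
    refine ⟨_, Finset.mem_image_of_mem _ hp, ?_⟩
    exact congrArg (fun f => Omega.Hom.toFun f p)
      (s.map_comp (homOfLE (Fin.zero_le j)) (homOfLE h)).symm
  ψ_id j y _ := congrArg (fun f => Omega.Hom.toFun f y) (s.map_id j)
  ψ_comp h h' y _ := congrArg (fun f => Omega.Hom.toFun f y)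
    (s.map_comp (homOfLE h) (homOfLE h')).symm
  g_mem c j y h := by
    split_ifs at h with hc
    rw [← Option.some_inj.1 h]
    exact Finset.mem_image_of_mem _ hc
  g_map c {j j'} h := by
    split_ifs
    · exact congrArg (fun f => some (Omega.Hom.toFun f c))
        (s.map_comp (homOfLE (Fin.zero_le j)) (homOfLE h))
    · rfl

theorem map_zero_toFun {n : ℕ} (s : Fin (n + 1) ⥤ Omega) (p : Fin (s.obj 0).card) :
    (s.map (homOfLE (Fin.zero_le 0))).toFun p = p :=
  congrArg (fun f => Omega.Hom.toFun f p) (s.map_id 0)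

theorem mem_imageStr_zero {n : ℕ} (s : Fin (n + 1) ⥤ Omega) (S : Finset (Fin (s.obj 0).card))
    (hS : S.Nonempty) (p : Fin (s.obj 0).card) : p ∈ (imageStr s S hS).W 0 ↔ p ∈ S := by
  rw [imageStr_W, Finset.mem_image]
  constructor
  · rintro ⟨q, hq, rfl⟩
    rwa [map_zero_toFun]
  · exact fun h => ⟨p, h, map_zero_toFun s p⟩

/-- The map `point` is the based projection from the first set of `s` onto `S`. Under the Loday
functor it keeps the factors in `S` and lets the others act on `k`. -/
theorem imageStr_point {n : ℕ} (s : Fin (n + 1) ⥤ Omega) (S : Finset (Fin (s.obj 0).card))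
    (hS : S.Nonempty) (c : Fin (s.obj 0).card) (q : Fin ((imageStr s S hS).W 0).card) :
    (imageStr s S hS).point.toFun c.succ = q.succ ↔ (imageStr s S hS).emb 0 q = c := by
  refine ((imageStr s S hS).point_succ c q).trans ?_
  rw [imageStr_g, map_zero_toFun]
  have hq := (mem_imageStr_zero s S hS _).1 ((imageStr s S hS).emb_mem 0 q)
  constructor
  · intro h
    split_ifs at h
    exact (Option.some_inj.1 h).symm
  · rintro rfl
    rw [if_pos hq]

theorem imageStr_point_zero {n : ℕ} (s : Fin (n + 1) ⥤ Omega) (S : Finset (Fin (s.obj 0).card))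
    (hS : S.Nonempty) (c : Fin (s.obj 0).card) (hc : c ∉ S) :
    (imageStr s S hS).point.toFun c.succ = 0 := by
  rcases Fin.eq_zero_or_eq_succ ((imageStr s S hS).point.toFun c.succ) with h | ⟨q, h⟩
  · exact h
  · rw [imageStr_point] at h
    rw [← h, ← mem_imageStr_zero s S hS] at hc
    exact absurd ((imageStr s S hS).emb_mem 0 q) hc

theorem imageStr_last {n : ℕ} (s : Str n) (S : Finset (Fin (s.1.obj 0).card)) (hS : S.Nonempty) :
    ((imageStr s.1 S hS).W (Fin.last n)).card = 1 := by
  refine le_antisymm ?_ (Finset.card_pos.2 ((imageStr s.1 S hS).ne _))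
  refine (Finset.card_le_univ _).trans ?_
  rw [Fintype.card_fin]
  exact s.2.le

/-- The retraction of `A^{⊗s₀} ⊗ k` onto the sum of the `I^{⊗S} ⊗ k`, where `S` indexes the
image of `S` in the string `s`. -/
noncomputable def retractOp (n : ℕ) :
    (⨁ s : Str n, (restrictSurj (loday k A (Triv ε))).obj (addBase.obj (s.1.obj 0))) →ₗ[k]
      (⨁ s : Str n, (lodayIdeal ε (Triv ε)).obj (addBase.obj (s.1.obj 0))) :=
  DirectSum.toModule k _ _ fun s => ∑ S : {S : Finset (Fin (s.1.obj 0).card) // S.Nonempty},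
    DirectSum.lof k (Str n) (fun s => (lodayIdeal ε (Triv ε)).obj (addBase.obj (s.1.obj 0)))
      ⟨(imageStr s.1 S.1 S.2).str, imageStr_last s S.1 S.2⟩ ∘ₗ
    (idealProj ε (Triv ε) ((imageStr s.1 S.1 S.2).W 0).card ∘ₗ
      lodayMap k A (Triv ε) (imageStr s.1 S.1 S.2).point)

theorem retractOp_lof {n : ℕ} (s : Str n)
    (x : (⨂[k] _ : Fin (s.1.obj 0).card, A) ⊗[k] Triv ε) :
    retractOp ε n (DirectSum.lof k (Str n)
      (fun s => (restrictSurj (loday k A (Triv ε))).obj (addBase.obj (s.1.obj 0))) s x) =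
    ∑ S : {S : Finset (Fin (s.1.obj 0).card) // S.Nonempty},
      DirectSum.lof k (Str n) (fun s => (lodayIdeal ε (Triv ε)).obj (addBase.obj (s.1.obj 0)))
        ⟨(imageStr s.1 S.1 S.2).str, imageStr_last s S.1 S.2⟩
        (idealProj ε (Triv ε) ((imageStr s.1 S.1 S.2).W 0).card
          (lodayMap k A (Triv ε) (imageStr s.1 S.1 S.2).point x)) := by
  rw [retractOp]
  refine (DirectSum.toModule_lof k (M := fun s : Str n =>
    (restrictSurj (loday k A (Triv ε))).obj (addBase.obj (s.1.obj 0))) s x).trans ?_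
  exact LinearMap.sum_apply _ _ _

end Retraction
end GammaSym

namespace GammaSym

/-! ### The retraction on the summands indexed by subsets -/

section Retraction

variable {k A : Type u} [CommRing k] [CommRing A] [Algebra k A] (ε : A →ₐ[k] k)

/-- The generator of `CΓ_n(A, k)` given by a string and an element of `A^{⊗s₀} ⊗ k`. -/
noncomputable abbrev algLof {n : ℕ} (s : Str n) :
    ((⨂[k] _ : Fin (s.1.obj 0).card, A) ⊗[k] Triv ε) →ₗ[k]
      (⨁ s : Str n, (restrictSurj (loday k A (Triv ε))).obj (addBase.obj (s.1.obj 0))) :=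
  DirectSum.lof k (Str n)
    (fun s => (restrictSurj (loday k A (Triv ε))).obj (addBase.obj (s.1.obj 0))) s

/-- The generator of `CΓ_n(I, k)` given by a string and an element of `I^{⊗s₀} ⊗ k`. -/
noncomputable abbrev idealLof {n : ℕ} (s : Str n) :
    ((⨂[k] _ : Fin (s.1.obj 0).card, augIdeal ε) ⊗[k] Triv ε) →ₗ[k]
      (⨁ s : Str n, (lodayIdeal ε (Triv ε)).obj (addBase.obj (s.1.obj 0))) :=
  DirectSum.lof k (Str n) (fun s => (lodayIdeal ε (Triv ε)).obj (addBase.obj (s.1.obj 0))) s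

/-- When nothing reaches a non-base point, all tensor factors become 1. Only nonempty subsets `S`
enter the retraction, and on each of them a factor 1 projects to zero. -/
theorem retractOp_zero {n b : ℕ} (s : Str n)
    (f : (⟨b⟩ : GammaCat) ⟶ (⟨(s.1.obj 0).card⟩ : GammaCat)) (hf : ∀ i, f.toFun i = 0)
    (z : (⨂[k] _ : Fin b, augIdeal ε) ⊗[k] Triv ε) :
    retractOp ε n (algLof ε s (lodayMap k A (Triv ε) f (idealIncl ε _ _ z))) = 0 := by
  refine (retractOp_lof ε s _).trans (Finset.sum_eq_zero fun S _ => ?_)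
  have h : idealProj ε (Triv ε) ((imageStr s.1 S.1 S.2).W 0).card
      (lodayMap k A (Triv ε) (imageStr s.1 S.1 S.2).point
        (lodayMap k A (Triv ε) f (idealIncl ε _ _ z))) = 0 := by
    rw [lodayMap_comp]
    refine idealProj_lodayMap_eq_zero ε (f ≫ (imageStr s.1 S.1 S.2).point)
      ⟨0, Finset.card_pos.2 ((imageStr s.1 S.1 S.2).ne 0)⟩ (fun i hi => ?_) _
    rw [GammaCat.comp_toFun, Function.comp_apply, hf, GammaCat.Hom.map_zero] at hi
    exact absurd hi.symm (Fin.succ_ne_zero _)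
  exact (congrArg (idealLof ε ⟨(imageStr s.1 S.1 S.2).str, imageStr_last s S.1 S.2⟩) h).trans
    (map_zero _)

/-- A string `s'` embedded in `s` has as its sets the images of its first set `T ⊆ s₀`. Of the sum
over `S` only the term `S = T` survives on `I^{⊗T}`, and it returns the generator on `s'`. -/
theorem retractOp_emb {n : ℕ} (s s' : Str n)
    (m : ∀ j, Fin (s'.1.obj j).card ↪o Fin (s.1.obj j).card)
    (hm : ∀ {j j'} (f : j ⟶ j') p, m j' ((s'.1.map f).toFun p) = (s.1.map f).toFun (m j p))
    (z : (⨂[k] _ : Fin (s'.1.obj 0).card, augIdeal ε) ⊗[k] Triv ε) :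
    retractOp ε n (algLof ε s (lodayMap k A (Triv ε) (embBase (m 0)) (idealIncl ε _ _ z))) =
      idealLof ε s' z := by
  have hne : (Finset.univ.map (m 0).toEmbedding).Nonempty :=
    ⟨_, Finset.mem_map_of_mem _ (Finset.mem_univ ⟨0, (s'.1.obj 0).pos⟩)⟩
  have hmem : ∀ p, p ∈ Finset.univ.map (m 0).toEmbedding ↔ ∃ c, m 0 c = p := by
    intro p
    simp
  refine (retractOp_lof ε s _).trans ?_
  refine (Fintype.sum_eq_single ⟨Finset.univ.map (m 0).toEmbedding, hne⟩ ?_).trans ?_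
  · rintro ⟨S, hS⟩ hne'
    have h : idealProj ε (Triv ε) ((imageStr s.1 S hS).W 0).card
        (lodayMap k A (Triv ε) (imageStr s.1 S hS).point
          (lodayMap k A (Triv ε) (embBase (m 0)) (idealIncl ε _ _ z))) = 0 := by
      rw [lodayMap_comp]
      -- If `T ⊆ S` but `S ≠ T`, a place of `S` carries the factor 1 and is killed by the projection
      -- to `I`. If `T ⊄ S`, a factor from `I` acts on `k` and is zero.
      by_cases hsub : ∀ c, m 0 c ∈ S
      · have hex : ∃ p ∈ S, ¬ ∃ c, m 0 c = p := by
          by_contra hcon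
          push Not at hcon
          refine hne' (Subtype.ext (Finset.ext fun p => ?_))
          rw [hmem]
          exact ⟨fun hp => hcon p hp, by rintro ⟨c, rfl⟩; exact hsub c⟩
        obtain ⟨p, hp, hp'⟩ := hex
        have hpW := (mem_imageStr_zero s.1 S hS p).2 hp
        refine idealProj_lodayMap_eq_zero ε (embBase (m 0) ≫ (imageStr s.1 S hS).point)
          ((imageStr s.1 S hS).idx 0 p hpW) (fun i hi => hp' ⟨i, ?_⟩) _
        have := (imageStr_point s.1 S hS (m 0 i) _).1 hi
        rw [PStr.emb_idx] at this
        exact this.symm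
      · push Not at hsub
        obtain ⟨c, hc⟩ := hsub
        rw [lodayMap_idealIncl_eq_zero ε (embBase (m 0) ≫ (imageStr s.1 S hS).point) c
          (imageStr_point_zero s.1 S hS (m 0 c) hc), map_zero]
    exact (congrArg (idealLof ε ⟨(imageStr s.1 S hS).str, imageStr_last s S hS⟩) h).trans
      (map_zero _)
  · set S := Finset.univ.map (m 0).toEmbedding with hSdef
    let f : (⟨(s'.1.obj 0).card⟩ : GammaCat) ⟶ (⟨((imageStr s.1 S hne).W 0).card⟩ : GammaCat) :=
      embBase (m 0) ≫ (imageStr s.1 S hne).point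
    have hf : ∀ p q, f.toFun p.succ = Fin.succ q ↔ (imageStr s.1 S hne).emb 0 q = m 0 p :=
      fun p q => imageStr_point s.1 S hne (m 0 p) q
    -- For `S = T` the composite is a surjective based map compatible with both embeddings into `s`,
    -- so `lof_unique` identifies the generators.
    let w : addBase.obj (s'.1.obj 0) ⟶ addBase.obj ((imageStr s.1 S hne).str.obj 0) :=
      ⟨f, by
        intro q
        refine Fin.cases ⟨0, f.map_zero⟩ (fun q => ?_) q
        obtain ⟨c, hc⟩ := (hmem _).1 ((mem_imageStr_zero s.1 S hne _).1
          ((imageStr s.1 S hne).emb_mem 0 q))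
        exact ⟨c.succ, (hf c q).2 hc.symm⟩⟩
    have h : idealProj ε (Triv ε) ((imageStr s.1 S hne).W 0).card
        (lodayMap k A (Triv ε) (imageStr s.1 S hne).point
          (lodayMap k A (Triv ε) (embBase (m 0)) (idealIncl ε _ _ z))) =
        lodayIdealMap ε (Triv ε) w z := by
      rw [lodayMap_comp]
      exact idealProj_lodayMap_idealIncl ε w z
    refine (congrArg (idealLof ε ⟨(imageStr s.1 S hne).str, imageStr_last s S hne⟩) h).trans ?_
    refine (lof_unique (lodayIdeal ε (Triv ε)) (t := s.1)
      (s := ⟨(imageStr s.1 S hne).str, imageStr_last s S hne⟩) (s' := s')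
      (fun j => (imageStr s.1 S hne).emb j) m ?_ ?_ hm w (𝟙 _) (m 0) hf ?_ z).trans ?_
    · intro j
      refine ((imageStr s.1 S hne).range_emb j).trans ?_
      ext p
      rw [imageStr_W, Finset.mem_coe, Finset.mem_image]
      constructor
      · rintro ⟨q, hq, rfl⟩
        obtain ⟨c, rfl⟩ := (hmem q).1 hq
        exact ⟨_, hm (homOfLE (Fin.zero_le j)) c⟩
      · rintro ⟨q, rfl⟩
        obtain ⟨c, rfl⟩ := (s'.1.map (homOfLE (Fin.zero_le j))).surj q
        exact ⟨m 0 c, (hmem _).2 ⟨c, rfl⟩, (hm _ c).symm⟩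
    · intro j j' g p
      exact (imageStr s.1 S hne).emb_map g p
    · intro p q
      exact (Fin.succ_injective _).eq_iff.trans (eq_comm.trans (m 0).injective.eq_iff.symm)
    · exact congrArg (idealLof ε s') (LinearMap.congr_fun (congrArg ModuleCat.Hom.hom
        ((lodayIdeal ε (Triv ε)).map_id (addBase.obj (s'.1.obj 0)))) z)

section Component

variable {l : ℕ} {t t' : Fin (l + 1) ⥤ Omega}
  (m : ∀ j, Fin (t'.obj j).card ↪o Fin (t.obj j).card)
  (hm : ∀ {j j'} (f : j ⟶ j') p, m j' ((t'.map f).toFun p) = (t.map f).toFun (m j p))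

theorem mem_fib_map
    (hm : ∀ {j j'} (f : j ⟶ j') p, m j' ((t'.map f).toFun p) = (t.map f).toFun (m j p)) {i : Fin (t'.obj (Fin.last l)).card} {j : Fin (l + 1)}
    {p : Fin (t'.obj j).card} : m j p ∈ fib t (m _ i) j ↔ p ∈ fib t' i j := by
  rw [mem_fib, mem_fib, ← hm, (m _).injective.eq_iff]

/-- The embedding of the components of strings induced by an embedding of strings. -/
def componentEmb (i : Fin (t'.obj (Fin.last l)).card) (j : Fin (l + 1)) :
    Fin (fib t' i j).card ↪o Fin (fib t (m _ i) j).card :=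
  OrderEmbedding.ofStrictMono (fun q => (fibIso t (m _ i) j).symm
    ⟨m j (fibEmb t' i j q), (mem_fib_map m hm).2 (mem_fib.2 (fibEmb_mem t' i j q))⟩)
    fun _ _ h => (OrderIso.lt_iff_lt _).2 ((m j).strictMono ((fibEmb t' i j).strictMono h))

theorem fibEmb_componentEmb (i : Fin (t'.obj (Fin.last l)).card) (j : Fin (l + 1))
    (q : Fin (fib t' i j).card) :
    fibEmb t (m _ i) j (componentEmb m hm i j q) = m j (fibEmb t' i j q) :=
  fibEmb_symm t (m _ i) j _

theorem componentEmb_map (i : Fin (t'.obj (Fin.last l)).card) {j j' : Fin (l + 1)} (f : j ⟶ j')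
    (q : Fin (fib t' i j).card) :
    componentEmb m hm i j' (compMap t' i f q) = compMap t (m _ i) f (componentEmb m hm i j q) := by
  apply (fibEmb t (m _ i) j').injective
  rw [fibEmb_componentEmb, fibEmb_compMap, fibEmb_compMap, fibEmb_componentEmb, hm]

/-- Collapsing to the component over an element of the smaller string can be done before or after
embedding: a point of the smaller string lies over `i` exactly when its image lies over the image of
`i`. -/
theorem embBase_collapse (i : Fin (t'.obj (Fin.last l)).card) {a a' : Omega} (f : a ⟶ t.obj 0)
    (f' : a' ⟶ t'.obj 0) (e : Fin a'.card ↪o Fin a.card)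
    (hf : ∀ c, f.toFun (e c) = m 0 (f'.toFun c)) :
    embBase e ≫ (addBase.map f ≫ collapse t (m _ i)).hom =
      (addBase.map f' ≫ collapse t' i).hom ≫ embBase (componentEmb m hm i 0) := by
  refine GammaCat.hom_eq_of_succ fun c q => ?_
  refine (PStr.collapse_point t f (m _ i) (embBase e) c q).trans ?_
  have h1 : (∃ p, (embBase e).toFun c.succ = Fin.succ p ∧
      f.toFun p = fibEmb t (m _ i) 0 q) ↔ m 0 (f'.toFun c) = fibEmb t (m _ i) 0 q := by
    rw [← hf]
    constructor
    · rintro ⟨p, hp, h⟩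
      rw [embBase_succ, Fin.succ_inj] at hp
      rwa [hp]
    · exact fun h => ⟨_, rfl, h⟩
  refine h1.trans ?_
  have hx : GammaCat.Hom.toFun ((addBase.map f' ≫ collapse t' i).hom ≫
      embBase (componentEmb m hm i 0)) c.succ =
      (embBase (componentEmb m hm i 0)).toFun (collapseFun t' i (f'.toFun c).succ) := rfl
  rw [hx]
  constructor
  · intro h
    have hmem : f'.toFun c ∈ fib t' i 0 := by
      rw [← mem_fib_map m hm, h]
      exact mem_fib.2 (fibEmb_mem t _ 0 q)
    have hr := (collapseFun_iff t' i (f'.toFun c) ((fibIso t' i 0).symm ⟨_, hmem⟩)).2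
      (fibEmb_symm t' i 0 ⟨_, hmem⟩)
    rw [hr, embBase_succ, Fin.succ_inj]
    apply (fibEmb t (m _ i) 0).injective
    rw [fibEmb_componentEmb, fibEmb_symm, h]
  · intro h
    rcases Fin.eq_zero_or_eq_succ (collapseFun t' i (f'.toFun c).succ) with h0 | ⟨r, hr⟩
    · rw [h0, GammaCat.Hom.map_zero] at h
      exact absurd h.symm (Fin.succ_ne_zero _)
    · rw [hr, embBase_succ, Fin.succ_inj] at h
      rw [← h, fibEmb_componentEmb, (collapseFun_iff t' i _ r).1 hr]

/-- The smaller string has no points over an element outside its last set, so all of it is collapsed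
to the basepoint. -/
theorem embBase_collapse_zero
    (hm : ∀ {j j'} (f : j ⟶ j') p, m j' ((t'.map f).toFun p) = (t.map f).toFun (m j p)) (i : Fin (t.obj (Fin.last l)).card) (hi : i ∉ Set.range (m _))
    {a a' : Omega} (f : a ⟶ t.obj 0)
    (f' : a' ⟶ t'.obj 0) (e : Fin a'.card ↪o Fin a.card)
    (hf : ∀ c, f.toFun (e c) = m 0 (f'.toFun c)) (c : Fin (a'.card + 1)) :
    GammaCat.Hom.toFun (embBase e ≫ (addBase.map f ≫ collapse t i).hom) c = 0 := by
  refine Fin.cases (GammaCat.Hom.map_zero _) (fun c => ?_) c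
  rcases Fin.eq_zero_or_eq_succ (GammaCat.Hom.toFun
    (embBase e ≫ (addBase.map f ≫ collapse t i).hom) c.succ) with h | ⟨q, h⟩
  · exact h
  · obtain ⟨p, hp, hq⟩ := (PStr.collapse_point t f i (embBase e) c q).1 h
    rw [embBase_succ, Fin.succ_inj] at hp
    rw [← hp, hf] at hq
    have hl := fibEmb_mem t i 0 q
    rw [← hq, ← hm] at hl
    exact absurd ⟨_, hl⟩ hi

end Component

theorem rwTerm_alg {l n : SimplexCategory} (θ : l ⟶ n) (s : Str n.len)
    (i : Fin (s.1.obj (θ.toOrderHom (Fin.last l.len))).card) {b : ℕ}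
    (e : Fin b ↪o Fin (s.1.obj 0).card) (z : (⨂[k] _ : Fin b, augIdeal ε) ⊗[k] Triv ε) :
    rwTerm (restrictSurj (loday k A (Triv ε))) θ s i
      (lodayMap k A (Triv ε) (embBase e) (idealIncl ε _ _ z)) =
    algLof ε (componentStr (pull θ s.1) i) (lodayMap k A (Triv ε)
      (embBase e ≫ (addBase.map (toStart θ s.1) ≫ collapse (pull θ s.1) i).hom)
      (idealIncl ε _ _ z)) :=
  congrArg (algLof ε (componentStr (pull θ s.1) i)) (lodayMap_comp ε _ _ _)

/-- By `embBase_collapse`, the term over `i` is again the image of an element of a power of `I` on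
an embedded string, namely the component of `s' ∘ θ`, so `retractOp_emb` evaluates it. -/
theorem retractOp_rwTerm {l n : SimplexCategory} (θ : l ⟶ n) (s s' : Str n.len)
    (m : ∀ j, Fin (s'.1.obj j).card ↪o Fin (s.1.obj j).card)
    (hm : ∀ {j j'} (f : j ⟶ j') p, m j' ((s'.1.map f).toFun p) = (s.1.map f).toFun (m j p))
    (i : Fin (s'.1.obj (θ.toOrderHom (Fin.last l.len))).card)
    (z : (⨂[k] _ : Fin (s'.1.obj 0).card, augIdeal ε) ⊗[k] Triv ε) :
    retractOp ε l.len (rwTerm (restrictSurj (loday k A (Triv ε))) θ s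
      (m (θ.toOrderHom (Fin.last l.len)) i)
      (lodayMap k A (Triv ε) (embBase (m 0)) (idealIncl ε _ _ z))) =
    rwTerm (lodayIdeal ε (Triv ε)) θ s' i z := by
  let μ : ∀ j, Fin ((pull θ s'.1).obj j).card ↪o Fin ((pull θ s.1).obj j).card :=
    fun j => m (θ.toOrderHom j)
  have hμ : ∀ {j j'} (f : j ⟶ j') p,
      μ j' (((pull θ s'.1).map f).toFun p) = ((pull θ s.1).map f).toFun (μ j p) :=
    fun f p => hm _ p
  have e := embBase_collapse μ hμ i (toStart θ s.1) (toStart θ s'.1) (m 0)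
    fun c => (hm _ c).symm
  refine (congrArg (retractOp ε l.len) (rwTerm_alg ε θ s _ (m 0) z)).trans ?_
  have h : lodayMap k A (Triv ε)
      (embBase (m 0) ≫ (addBase.map (toStart θ s.1) ≫ collapse (pull θ s.1) (μ _ i)).hom)
      (idealIncl ε _ _ z) =
      lodayMap k A (Triv ε) (embBase (componentEmb μ hμ i 0)) (idealIncl ε _ _
        (lodayIdealMap ε (Triv ε) (addBase.map (toStart θ s'.1) ≫ collapse (pull θ s'.1) i) z)) := by
    rw [e, ← lodayMap_comp]
    exact congrArg (lodayMap k A (Triv ε) (embBase (componentEmb μ hμ i 0)))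
      (congrArg (fun g => g.hom z) ((lodayIncl ε (Triv ε)).naturality
        (addBase.map (toStart θ s'.1) ≫ collapse (pull θ s'.1) i))).symm
  refine (congrArg (fun x => retractOp ε l.len
    (algLof ε (componentStr (pull θ s.1) (μ _ i)) x)) h).trans ?_
  exact retractOp_emb ε (componentStr (pull θ s.1) (μ _ i)) (componentStr (pull θ s'.1) i)
    (componentEmb μ hμ i) (componentEmb_map μ hμ i) _

end Retraction
end GammaSym

namespace GammaSym

/-! ### Compatibility with the simplicial operators and the splitting in homology -/

section Retraction

variable {k A : Type u} [CommRing k] [CommRing A] [Algebra k A] (ε : A →ₐ[k] k)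

theorem retractOp_rwOp_emb {l n : SimplexCategory} (θ : l ⟶ n) (s s' : Str n.len)
    (m : ∀ j, Fin (s'.1.obj j).card ↪o Fin (s.1.obj j).card)
    (hm : ∀ {j j'} (f : j ⟶ j') p, m j' ((s'.1.map f).toFun p) = (s.1.map f).toFun (m j p))
    (z : (⨂[k] _ : Fin (s'.1.obj 0).card, augIdeal ε) ⊗[k] Triv ε) :
    retractOp ε l.len (rwOp (restrictSurj (loday k A (Triv ε))) θ
      (algLof ε s (lodayMap k A (Triv ε) (embBase (m 0)) (idealIncl ε _ _ z)))) =
    rwOp (lodayIdeal ε (Triv ε)) θ (idealLof ε s' z) := by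
  refine (congrArg (retractOp ε l.len) (rwOp_lof _ θ s _)).trans ?_
  refine Eq.trans ?_ (rwOp_lof (lodayIdeal ε (Triv ε)) θ s' z).symm
  rw [map_sum]
  symm
  -- The terms over elements coming from `s'` match the terms of the operator on `CΓ_*(I, k)`; the
  -- remaining ones vanish because there all factors from `I` go to the basepoint.
  refine Finset.sum_of_injOn (m (θ.toOrderHom (Fin.last l.len))) (m _).injective.injOn
    (fun _ _ => Finset.mem_coe.2 (Finset.mem_univ _)) ?_
    fun i _ => (retractOp_rwTerm ε θ s s' m hm i z).symm
  intro i _ hi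
  refine (congrArg (retractOp ε l.len) (rwTerm_alg ε θ s i (m 0) z)).trans ?_
  refine retractOp_zero ε (componentStr (pull θ s.1) i)
    (embBase (m 0) ≫ (addBase.map (toStart θ s.1) ≫ collapse (pull θ s.1) i).hom) ?_ z
  refine embBase_collapse_zero (t := pull θ s.1) (t' := pull θ s'.1)
    (fun j => m (θ.toOrderHom j)) (fun f p => hm _ p) i ?_
    (toStart θ s.1) (toStart θ s'.1) (m 0) fun c => (hm _ c).symm
  rintro ⟨p, hp⟩
  exact hi ⟨p, Finset.mem_coe.2 (Finset.mem_univ _), hp⟩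

theorem retractOp_rwOp_zero {l n : SimplexCategory} (θ : l ⟶ n) (s : Str n.len)
    (e : Fin 0 ↪o Fin (s.1.obj 0).card) (z : (⨂[k] _ : Fin 0, augIdeal ε) ⊗[k] Triv ε) :
    retractOp ε l.len (rwOp (restrictSurj (loday k A (Triv ε))) θ
      (algLof ε s (lodayMap k A (Triv ε) (embBase e) (idealIncl ε _ _ z)))) = 0 := by
  refine (congrArg (retractOp ε l.len) (rwOp_lof _ θ s _)).trans ?_
  rw [map_sum]
  refine Finset.sum_eq_zero fun i _ => ?_
  refine (congrArg (retractOp ε l.len) (rwTerm_alg ε θ s i e z)).trans ?_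
  refine retractOp_zero ε (componentStr (pull θ s.1) i)
    (embBase e ≫ (addBase.map (toStart θ s.1) ≫ collapse (pull θ s.1) i).hom) (fun c => ?_) z
  exact Fin.cases (GammaCat.Hom.map_zero _) (fun c => c.elim0) c

/-- By multilinearity the identity need only be checked on the summands `I^{⊗S}`. A nonempty `S` is
the first set of its image string, which is embedded in `s`; for empty `S` both sides vanish. -/
theorem retractOp_rwOp {l n : SimplexCategory} (θ : l ⟶ n) :
    retractOp ε l.len ∘ₗ rwOp (restrictSurj (loday k A (Triv ε))) θ =
      rwOp (lodayIdeal ε (Triv ε)) θ ∘ₗ retractOp ε n.len := by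
  refine DirectSum.linearMap_ext k fun s => ?_
  refine loday_hom_ext (a := (s.1.obj 0).card) ε fun S => ?_
  rcases S.eq_empty_or_nonempty with rfl | hS
  · refine ⟨0, OrderEmbedding.ofIsEmpty, by simp, fun z => ?_⟩
    refine (retractOp_rwOp_zero ε θ s _ z).trans ?_
    refine Eq.trans ?_ (congrArg (rwOp (lodayIdeal ε (Triv ε)) θ)
      (retractOp_zero ε s (embBase OrderEmbedding.ofIsEmpty) (fun c => ?_) z)).symm
    · exact (map_zero _).symm
    · exact Fin.cases (GammaCat.Hom.map_zero _) (fun c => c.elim0) c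
  · refine ⟨_, (imageStr s.1 S hS).emb 0, ?_, fun z => ?_⟩
    · rw [PStr.range_emb]
      ext p
      exact mem_imageStr_zero s.1 S hS p
    · refine (retractOp_rwOp_emb ε θ s ⟨(imageStr s.1 S hS).str, imageStr_last s S hS⟩
        (imageStr s.1 S hS).emb (imageStr s.1 S hS).emb_map z).trans ?_
      exact congrArg (rwOp (lodayIdeal ε (Triv ε)) θ)
        (retractOp_emb ε s ⟨(imageStr s.1 S hS).str, imageStr_last s S hS⟩
        (imageStr s.1 S hS).emb (imageStr s.1 S hS).emb_map z).symm

/-- The simplicial retraction of `CΓ_*(A, k)` onto `CΓ_*(I, k)`. -/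
noncomputable def CGammaRetract : CGamma k A (Triv ε) ⟶ CGammaIdeal ε (Triv ε) where
  app Δ := ModuleCat.ofHom (retractOp ε Δ.unop.len)
  naturality {Δ Δ'} θ := by
    ext1
    exact retractOp_rwOp ε θ.unop

/-- This is `retractOp_emb` for the identity embedding, where `S` is the whole first set. -/
theorem CGammaIncl_retract : CGammaIncl ε (Triv ε) ≫ CGammaRetract ε = 𝟙 _ := by
  refine NatTrans.ext (funext fun Δ => ModuleCat.hom_ext ?_)
  refine DirectSum.linearMap_ext (R := k) (ι := Str Δ.unop.len)
    (M := fun s => (lodayIdeal ε (Triv ε)).obj (addBase.obj (s.1.obj 0)))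
    (N := ⨁ s : Str Δ.unop.len, (lodayIdeal ε (Triv ε)).obj (addBase.obj (s.1.obj 0)))
    fun s => LinearMap.ext fun z => ?_
  have h : ((CGammaIncl ε (Triv ε)).app Δ).hom (idealLof ε s z) =
      algLof ε s (lodayMap k A (Triv ε)
        (embBase (RelEmbedding.refl _ : Fin (s.1.obj 0).card ↪o _)) (idealIncl ε _ _ z)) := by
    refine (DirectSum.lmap_lof _ _ _).trans (congrArg (algLof ε s) ?_)
    have e : embBase (RelEmbedding.refl _ : Fin (s.1.obj 0).card ↪o _) =
        𝟙 (⟨(s.1.obj 0).card⟩ : GammaCat) :=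
      GammaCat.hom_eq_of_succ fun _ _ => Iff.rfl
    rw [e]
    exact (LinearMap.congr_fun (congrArg ModuleCat.Hom.hom
      ((loday k A (Triv ε)).map_id (⟨(s.1.obj 0).card⟩ : GammaCat))) _).symm
  refine (congrArg (retractOp ε Δ.unop.len) h).trans ?_
  exact retractOp_emb ε s s (fun j => RelEmbedding.refl _) (fun _ _ => rfl) z

theorem isSplitMono_homologyMap_CGammaIncl (n : ℕ) {X : ModuleCat.{u} k}
    (e : (chains (CGamma k A (Triv ε))).homology n ≅ X) :
    IsSplitMono (HomologicalComplex.homologyMap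
      ((AlgebraicTopology.alternatingFaceMapComplex (ModuleCat.{u} k)).map
        (CGammaIncl ε (Triv ε))) n ≫ e.hom) := by
  refine ⟨⟨⟨e.inv ≫ HomologicalComplex.homologyMap
    ((AlgebraicTopology.alternatingFaceMapComplex (ModuleCat.{u} k)).map (CGammaRetract ε)) n,
    ?_⟩⟩⟩
  rw [Category.assoc, e.hom_inv_id_assoc, ← HomologicalComplex.homologyMap_comp, ← Functor.map_comp,
    CGammaIncl_retract, CategoryTheory.Functor.map_id, HomologicalComplex.homologyMap_id]

end Retraction
end GammaSym

namespace GammaSym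

/-! ### Lifting strings of surjections to `EpiΔS` -/

section Lifting

/-- The permutation `h ∘ h'⁻¹` is order-preserving, and a finite linear order has no nontrivial
order automorphism. -/
theorem DeltaS.perm_eq_of_monotone {a b : ℕ} {ψ : Fin a → Fin b} (hψ : Function.Surjective ψ)
    {h h' : Equiv.Perm (Fin b)} (hm : Monotone (h ∘ ψ)) (hm' : Monotone (h' ∘ ψ)) : h = h' := by
  have hmono : StrictMono (h'.symm.trans h) := by
    refine Monotone.strictMono_of_injective (fun x y hxy => ?_) (Equiv.injective _)
    obtain ⟨i, hi⟩ := hψ (h'.symm x)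
    obtain ⟨j, hj⟩ := hψ (h'.symm y)
    rw [Equiv.trans_apply, Equiv.trans_apply, ← hi, ← hj]
    rcases le_total i j with hij | hij
    · exact hm hij
    · have h1 : h' (ψ j) ≤ h' (ψ i) := hm' hij
      rw [hi, hj, Equiv.apply_symm_apply, Equiv.apply_symm_apply] at h1
      rw [hi, hj, le_antisymm hxy h1]
  have h1 := (StrictMono.range_inj hmono strictMono_id).1
    ((Equiv.surjective _).range_eq.trans Function.surjective_id.range_eq.symm)
  ext x : 1
  have h2 := congrFun h1 (h' x)
  rwa [Equiv.trans_apply, Equiv.symm_apply_apply] at h2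

/-- A morphism of `ΔS` whose underlying map of sets is surjective is an epimorphism. -/
theorem DeltaS.epi_of_surjective {a b : DeltaS} (f : a ⟶ b)
    (hf : Function.Surjective (DeltaS.Hom.toFun f)) : Epi f := by
  refine ⟨fun {c} u v huv => ?_⟩
  have hφ : Function.Surjective (DeltaS.Hom.mono f) := fun y => by
    obtain ⟨x, hx⟩ := hf y
    exact ⟨_, hx⟩
  refine DeltaS.Hom.ext_toFun (hf.injective_comp_right ?_) ?_
  · change DeltaS.Hom.toFun u ∘ DeltaS.Hom.toFun f = DeltaS.Hom.toFun v ∘ DeltaS.Hom.toFun f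
    rw [← DeltaS.comp_toFun, ← DeltaS.comp_toFun, huv]
  · have h : DeltaS.pullPerm (DeltaS.Hom.mono f) (DeltaS.Hom.perm u) * DeltaS.Hom.perm f =
        DeltaS.pullPerm (DeltaS.Hom.mono f) (DeltaS.Hom.perm v) * DeltaS.Hom.perm f :=
      congrArg DeltaS.Hom.perm huv
    -- Equality of the composites says that `u` and `v` sort the elements of the source in the same
    -- way. After this common sorting both permutations composed with the same surjection are
    -- monotone, hence they are equal.
    have h' := inv_injective (mul_right_cancel h)
    refine DeltaS.perm_eq_of_monotone
      (hφ.comp (Tuple.sort (DeltaS.Hom.perm u ∘ DeltaS.Hom.mono f)).surjective)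
      (Tuple.monotone_sort (DeltaS.Hom.perm u ∘ DeltaS.Hom.mono f)) ?_
    rw [h']
    exact Tuple.monotone_sort (DeltaS.Hom.perm v ∘ DeltaS.Hom.mono f)

/-- The object of `EpiΔS` with a given underlying set. -/
def liftObj (a : Omega) : EpiDeltaS := ⟨⟨a.card, a.pos⟩⟩

/-- A morphism of `ΔS` with a given underlying map of sets. -/
def liftHom {a b : Omega} (f : a ⟶ b) : (liftObj a).obj ⟶ (liftObj b).obj :=
  (⟨⟨f.toFun ∘ Tuple.sort f.toFun, Tuple.monotone_sort _⟩, (Tuple.sort f.toFun)⁻¹⟩ :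
    DeltaS.Hom (liftObj a).obj (liftObj b).obj)

theorem liftHom_toFun {a b : Omega} (f : a ⟶ b) : DeltaS.Hom.toFun (liftHom f) = f.toFun := by
  funext i
  exact congrArg f.toFun ((Tuple.sort f.toFun).apply_symm_apply i)

/-- A morphism of `EpiΔS` with a given underlying surjection. -/
def liftEpi {a b : Omega} (f : a ⟶ b) : liftObj a ⟶ liftObj b :=
  ⟨liftHom f, DeltaS.epi_of_surjective (liftHom f) (by
    rw [liftHom_toFun]
    exact f.surj)⟩

theorem forgetU_liftEpi {a b : Omega} (f : a ⟶ b) : forgetU.map (liftEpi f) = f :=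
  Omega.hom_ext (liftHom_toFun f)

/-- A string is freely determined by its consecutive arrows, so these can be lifted one at a time;
no functorial choice of orders on the fibres is needed. -/
theorem exists_lift {n : ℕ} (s : Fin (n + 1) ⥤ Omega) :
    ∃ t : Fin (n + 1) ⥤ EpiDeltaS, t ⋙ forgetU = s := by
  let t : ComposableArrows EpiDeltaS n := ComposableArrows.mkOfObjOfMapSucc
    (fun j => liftObj (s.obj j)) fun i => liftEpi (s.map (homOfLE i.castSucc_le_succ))
  refine ⟨t, ComposableArrows.ext (F := t ⋙ forgetU) (G := s) (fun _ => rfl) fun i hi => ?_⟩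
  refine Eq.trans ?_ ((Category.id_comp _).trans (Category.comp_id (s.map _))).symm
  refine (congrArg forgetU.map (ComposableArrows.mkOfObjOfMapSucc_map_succ
    (fun j => liftObj (s.obj j)) (fun i => liftEpi (s.map (homOfLE i.castSucc_le_succ)))
    i hi)).trans ?_
  exact forgetU_liftEpi _

theorem exists_forgetStr {n : ℕ} (s : Str n) : ∃ t h, forgetStr (n := n) t h = s := by
  obtain ⟨t, ht⟩ := exists_lift s.1
  have hs := s.2
  rw [← ht] at hs
  exact ⟨t, hs, Subtype.ext ht⟩

end Lifting

/-! ### Surjectivity of `Φ ∘ q` and the short exact sequence -/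

section Surjective

variable {k A : Type u} [CommRing k] [CommRing A] [Algebra k A] (ε : A →ₐ[k] k)

theorem tmulOne_surjective (n : ℕ) : Function.Surjective (tmulOne ε n) := by
  rw [← LinearMap.range_eq_top, ← top_le_iff, ← TensorProduct.span_tmul_eq_top,
    Submodule.span_le]
  rintro _ ⟨x, m, rfl⟩
  refine ⟨(show k from m) • x, ?_⟩
  change ((show k from m) • x) ⊗ₜ[k] unitTriv ε = x ⊗ₜ[k] m
  rw [TensorProduct.smul_tmul]
  exact congrArg (x ⊗ₜ[k] ·) (mul_one (show k from m))

/-- Each string ending in the one-element set has a lift ending there too, and each element of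
`I^{⊗x} ⊗ k` has the form `y ⊗ 1`. -/
theorem phiLinear_surjective (n : ℕ) : Function.Surjective (phiLinear ε n) := by
  intro x
  induction x using DirectSum.induction_on with
  | zero => exact ⟨0, map_zero _⟩
  | add x y hx hy =>
    obtain ⟨a, rfl⟩ := hx
    obtain ⟨b, rfl⟩ := hy
    exact ⟨a + b, map_add _ _ _⟩
  | of s x =>
    obtain ⟨t, h, rfl⟩ := exists_forgetStr s
    obtain ⟨y, rfl⟩ := tmulOne_surjective ε _ x
    exact ⟨_, phiLinear_lof ε t h y⟩

theorem q_Phi_surjective (n : ℕ) : Function.Surjective ((q ε ≫ Phi ε).f n).hom := by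
  intro y
  obtain ⟨y, rfl⟩ := Submodule.Quotient.mk_surjective _ y
  obtain ⟨x, rfl⟩ := phiLinear_surjective ε n y
  exact ⟨Submodule.Quotient.mk x, rfl⟩

instance : Epi (q ε ≫ Phi ε) := by
  have (n : ℕ) : Epi ((q ε ≫ Phi ε).f n) :=
    (ModuleCat.epi_iff_surjective _).2 (q_Phi_surjective ε n)
  exact HomologicalComplex.epi_of_epi_f _ this

theorem shortExact_kernel_q_Phi : (ShortComplex.mk (kernel.ι (q ε ≫ Phi ε))
    (q ε ≫ Phi ε) (kernel.condition _)).ShortExact where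
  exact := ShortComplex.exact_kernel _
  mono_f := inferInstanceAs (Mono (kernel.ι (q ε ≫ Phi ε)))
  epi_g := inferInstanceAs (Epi (q ε ≫ Phi ε))

end Surjective

/-! ### Normalized and unnormalized chains -/

section Normalized

variable {k : Type u} [CommRing k] (X : SimplicialObject (ModuleCat.{u} k))

/-- The section of the projection onto the normalized complex given by the Dold-Kan projector. -/
noncomputable def normalizedSection : normalized X ⟶ chains X :=
  quotComplexDesc _ _ _ (AlgebraicTopology.DoldKan.PInfty (X := X)) fun n =>
    (degenerate_eq_ker X n).le

/-- The projector `P` is idempotent, so `P x - x` lies in its kernel, which consists of the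
degenerate elements. -/
theorem normalizedSection_π : normalizedSection X ≫ normalizedπ X = 𝟙 (normalized X) := by
  ext n : 2
  refine Submodule.linearMap_qext _ (LinearMap.ext fun x => ?_)
  refine (Submodule.Quotient.eq (degenerate X n)).2 ?_
  refine (degenerate_eq_ker X n).ge ?_
  refine (map_sub ((AlgebraicTopology.DoldKan.PInfty (X := X)).f n).hom _ x).trans ?_
  exact sub_eq_zero.2
    (congrArg (fun g => g.hom x) (AlgebraicTopology.DoldKan.PInfty_f_idem (X := X) n))

/-- The chain complex of a simplicial module is homotopy equivalent to the normalized one. -/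
noncomputable def normalizedEquiv : HomotopyEquiv (chains X) (normalized X) where
  hom := normalizedπ X
  inv := normalizedSection X
  homotopyHomInvId := AlgebraicTopology.DoldKan.homotopyPInftyToId X
  homotopyInvHomId := Homotopy.ofEq (normalizedSection_π X)

instance : QuasiIso (normalizedπ X) :=
  inferInstanceAs (QuasiIso (normalizedEquiv X).hom)

end Normalized
end GammaSym

namespace GammaSym

/-! ### The long exact homology sequence -/

section LongExact

variable {k : Type u} [CommRing k]

theorem function_exact_of_iso {X₁ X₂ X₃ Y₁ Y₂ Y₃ : ModuleCat.{u} k} {f : X₁ ⟶ X₂} {g : X₂ ⟶ X₃}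
    {w : f ≫ g = 0} (h : (ShortComplex.mk f g w).Exact) {f' : Y₁ ⟶ Y₂} {g' : Y₂ ⟶ Y₃}
    (e₁ : Y₁ ≅ X₁) (e₂ : Y₂ ≅ X₂) (e₃ : Y₃ ≅ X₃) (hf : f' ≫ e₂.hom = e₁.hom ≫ f)
    (hg : g' ≫ e₃.hom = e₂.hom ≫ g) : Function.Exact f'.hom g'.hom := by
  have w' : f' ≫ g' = 0 := by
    rw [← cancel_mono e₃.hom, Category.assoc, hg, reassoc_of% hf, w, comp_zero, zero_comp]
  have e : ShortComplex.mk f' g' w' ≅ ShortComplex.mk f g w :=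
    ShortComplex.isoMk e₁ e₂ e₃ hf.symm hg.symm
  exact (ShortComplex.ShortExact.moduleCat_exact_iff_function_exact _).1
    ((ShortComplex.exact_iff_of_iso e).2 h)

/-- The homology sequence of `S` is conjugated by the isomorphisms that `a` and `b` induce, so it
can be stated for the unnormalized complexes while the connecting map remains that of `S`. -/
theorem longExact_of_quasiIso {S : ShortComplex (ChainComplex (ModuleCat.{u} k) ℕ)}
    (hS : S.ShortExact) {K L : ChainComplex (ModuleCat.{u} k) ℕ} (a : K ⟶ S.X₂) (b : L ⟶ S.X₃)
    [QuasiIso a] [QuasiIso b] :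
    ∃ (α : ∀ n, S.X₁.homology n ⟶ K.homology n) (β : ∀ n, K.homology n ⟶ L.homology n)
      (δ : ∀ n, L.homology (n + 1) ⟶ S.X₁.homology n),
      (∀ n, α n ≫ HomologicalComplex.homologyMap a n = HomologicalComplex.homologyMap S.f n) ∧
      (∀ n, β n ≫ HomologicalComplex.homologyMap b n =
        HomologicalComplex.homologyMap a n ≫ HomologicalComplex.homologyMap S.g n) ∧
      (∀ n, δ n = HomologicalComplex.homologyMap b (n + 1) ≫ hS.δ (n + 1) n rfl) ∧
      (∀ n, Function.Exact (α n).hom (β n).hom) ∧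
      (∀ n, Function.Exact (β (n + 1)).hom (δ n).hom) ∧
      (∀ n, Function.Exact (δ n).hom (α n).hom) ∧
      Function.Surjective (β 0).hom := by
  let ea (n : ℕ) : K.homology n ≅ S.X₂.homology n :=
    asIso (HomologicalComplex.homologyMap a n)
  let eb (n : ℕ) : L.homology n ≅ S.X₃.homology n :=
    asIso (HomologicalComplex.homologyMap b n)
  have hα (n : ℕ) : (HomologicalComplex.homologyMap S.f n ≫ (ea n).inv) ≫ (ea n).hom =
      HomologicalComplex.homologyMap S.f n := by simp
  have hβ (n : ℕ) : ((ea n).hom ≫ HomologicalComplex.homologyMap S.g n ≫ (eb n).inv) ≫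
      (eb n).hom = (ea n).hom ≫ HomologicalComplex.homologyMap S.g n := by simp
  refine ⟨fun n => HomologicalComplex.homologyMap S.f n ≫ (ea n).inv,
    fun n => (ea n).hom ≫ HomologicalComplex.homologyMap S.g n ≫ (eb n).inv,
    fun n => (eb (n + 1)).hom ≫ hS.δ (n + 1) n rfl, hα, hβ, fun n => rfl, fun n => ?_,
    fun n => ?_, fun n => ?_, ?_⟩
  · refine function_exact_of_iso (hS.homology_exact₂ n) (Iso.refl _) (ea n) (eb n) ?_ (hβ n)
    rw [hα, Iso.refl_hom, Category.id_comp]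
  · refine function_exact_of_iso (hS.homology_exact₃ (n + 1) n rfl) (ea _) (eb _) (Iso.refl _)
      (hβ _) ?_
    rw [Iso.refl_hom, Category.comp_id]
  · refine function_exact_of_iso (hS.homology_exact₁ (n + 1) n rfl) (eb _) (Iso.refl _) (ea _)
      ?_ ?_
    · rw [Iso.refl_hom, Category.comp_id]
    · rw [hα, Iso.refl_hom, Category.id_comp]
  · have := hS.epi_g
    -- Degree 0 has no outgoing differential, so there is no further connecting map and the sequence
    -- ends in a surjection.
    have : Epi (HomologicalComplex.homologyMap S.g 0) :=
      HomologicalComplex.epi_homologyMap_of_epi_of_not_rel _ _ (by simp)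
    exact (ModuleCat.epi_iff_surjective _).1 inferInstance

end LongExact
end GammaSym

theorem mainTheorem4 {k A : Type u} [CommRing k] [CommRing A] [Algebra k A] (ε : A →ₐ[k] k) :
    ∃ hS : (ShortComplex.mk (kernel.ι (GammaSym.q ε ≫ GammaSym.Phi ε))
        (GammaSym.q ε ≫ GammaSym.Phi ε) (kernel.condition _)).ShortExact,
      -- the homology of the normalized complexes is the homology of the unnormalized ones
      QuasiIso (GammaSym.normalizedπ (GammaSym.CS ε)) ∧
      QuasiIso (GammaSym.normalizedπ (GammaSym.CGammaIdeal ε (GammaSym.Triv ε))) ∧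
      -- the long exact sequence
      (∃ (α : ∀ n, (kernel (GammaSym.q ε ≫ GammaSym.Phi ε)).homology n ⟶ GammaSym.HSReduced ε n)
        (β : ∀ n, GammaSym.HSReduced ε n ⟶ GammaSym.HGammaIdeal ε n)
        (δ : ∀ n, GammaSym.HGammaIdeal ε (n + 1) ⟶
          (kernel (GammaSym.q ε ≫ GammaSym.Phi ε)).homology n),
        (∀ n, α n ≫ HomologicalComplex.homologyMap (GammaSym.normalizedπ (GammaSym.CS ε)) n =
          HomologicalComplex.homologyMap (kernel.ι (GammaSym.q ε ≫ GammaSym.Phi ε)) n) ∧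
        (∀ n, β n ≫ HomologicalComplex.homologyMap
            (GammaSym.normalizedπ (GammaSym.CGammaIdeal ε (GammaSym.Triv ε))) n =
          HomologicalComplex.homologyMap (GammaSym.normalizedπ (GammaSym.CS ε)) n ≫
            HomologicalComplex.homologyMap (GammaSym.q ε ≫ GammaSym.Phi ε) n) ∧
        (∀ n, δ n = HomologicalComplex.homologyMap
            (GammaSym.normalizedπ (GammaSym.CGammaIdeal ε (GammaSym.Triv ε))) (n + 1) ≫
          hS.δ (n + 1) n rfl) ∧
        (∀ n, Function.Exact (α n).hom (β n).hom) ∧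
        (∀ n, Function.Exact (β (n + 1)).hom (δ n).hom) ∧
        (∀ n, Function.Exact (δ n).hom (α n).hom) ∧
        Function.Surjective (β 0).hom) ∧
      -- `HΓₙ(I, k)` is a direct summand of `HΓₙ(A, k)`, via the inclusion of complexes
      (∀ n, ∃ e : (GammaSym.chains (GammaSym.CGamma k A (GammaSym.Triv ε))).homology n ≅
          GammaSym.HGamma k A (GammaSym.Triv ε) n,
        IsSplitMono (HomologicalComplex.homologyMap
          ((AlgebraicTopology.alternatingFaceMapComplex (ModuleCat.{u} k)).map
            (GammaSym.CGammaIncl ε (GammaSym.Triv ε))) n ≫ e.hom)) := by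
  exact ⟨GammaSym.shortExact_kernel_q_Phi ε, inferInstance, inferInstance,
    GammaSym.longExact_of_quasiIso (GammaSym.shortExact_kernel_q_Phi ε)
      (GammaSym.normalizedπ (GammaSym.CS ε))
      (GammaSym.normalizedπ (GammaSym.CGammaIdeal ε (GammaSym.Triv ε))),
    fun n => ⟨GammaSym.homologyIsoHGammaOf (GammaSym.loday k A (GammaSym.Triv ε)) n,
      GammaSym.isSplitMono_homologyMap_CGammaIncl ε n _⟩⟩
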